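/- **The calculus.** Fix countably infinite sets of qubit names, of tags $t,u$, and, for each type $\mathbb B$ (booleans), $\mathbb N$ (naturals), $\mathcal Q$ (qubit names), of variables $x$ and channels $c$ of that type. Expressions $e$ are built from variables, values $v$, $\neg$, $\lor$, $\le$, $=$ (with $=$ between expressions of one type). Processes are $$P::=\mathbf 0_{\tilde e}\mid t{:}\tau.P\mid (t,u){:}\tau.P\mid t{:}c?x.P\mid t{:}c!e.P\mid t{:}\mathcal E(\tilde e).P\mid t{:}\mathcal M[\tilde e\triangleright x].P\mid \mathbf{if}\ e\ \mathbf{then}\ P\ \mathbf{else}\ P\mid P+P\mid P\parallel P\mid P\setminus c,$$ with $\mathcal E$ a trace-preserving superoperator on $n\ge 1$ qubits and $\mathcal M=\{M_0,\dots,M_{k-1}\}$, $\sum_m M_m^\dagger M_m=\mathbb I$, a measurement. The linear typing judgment $\Sigma\vdash P$ is: $\Sigma\vdash\mathbf 0_{\tilde e}$ iff $\tilde e$ lists $\Sigma$ without repetition; $\mathcal E(\tilde e)$ and $\mathcal M[\tilde e\triangleright x]$ act on distinct elements of $\Sigma$ (and $x:\mathbb N$); $\Sigma\vdash t{:}c?x.P$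 iff $x$ has the type of $c$ and $\Sigma\vdash P$ (classical $c$), or $x\notin\Sigma$ and $\Sigma\cup\{x\}\vdash P$ (quantum $c$); $\Sigma\vdash t{:}c!e.P$ iff $e$ has the type of $c$ and $\Sigma\vdash P$ (classical $c$), or $e\in\Sigma$ and $\Sigma\setminus\{e\}\vdash P$ (quantum $c$); the branches of a boolean conditional and of $+$ have the same $\Sigma$; $\parallel$ takes disjoint unions; $\tau$-prefixes and $\setminus c$ keep $\Sigma$. The type of $P$ is unique; call it $\Sigma_P$. **Probabilistic semantics.** Fix a finite set $\Sigma$ of qubits with Hilbert space $\mathcal H_\Sigma=(\mathbb C^2)^{\otimes\Sigma}$; a *state* is a density operator on $\mathcal H_\Sigma$ of trace $1$. Actions are $\tau,c!v,c?v$; schedulers $s$ are tags $t$ or pairs $(t,u)$. Transitions $\langle\rho,P\rangle\xrightarrow{\mu}_s\Delta$ go from configurations to finitely supported probability distributions of configurations: $\tau$-prefixes act with their tag(s); $t{:}\mathcal E(\tilde q)$ applies $\mathcal E$ to the qubits $\tilde q$; $t{:}\mathcal M[\tilde q\triangleright x].P$ gives $\bigoplus_m \mathrm{tr}(\rho_m)\bullet\langle\rho_m/\mathrm{tr}(\rho_m),P[m/x]\rangle$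 with $\rho_m=M_m^{\tilde q}\rho M_m^{\tilde q\,\dagger}$; $t{:}c!e$ does $c!v$ if $e$ evaluates to $v$; $t{:}c?x.P$ does $c?v$ to $P[v/x]$ for each $v$ of the type of $c$, where $v\in\Sigma\setminus\Sigma_P$ if $c$ is quantum; conditionals, sums and restrictions are as in CCS; in $P\parallel Q$ one component moves (but does not input a qubit owned by the other one), or complementary $c!v$, $c?v$ with tags $t$ (left) and $u$ (right) synchronize to $\tau$ with scheduler $(t,u)$. A process is *deterministic* if in every state over every register containing $\Sigma_P$ each scheduler allows at most one pair $(\mu,\Delta)$, except that several inputs $c?v$ on one channel are allowed, with one $\Delta$ for each $v$. All processes considered are closed, and they and all processes reachable from them are deterministic. Let $\mathcal D$ be the set of finitely supported distributions of mass $|\Delta|\le1$ of such configurations. Completing $\xrightarrow{\mu}_s$ with moves to the empty distribution $\varepsilon$ from the configurations that have no $\mu,s$-transition, and taking the least left-linear lifting, gives the moves $\Delta\xrightarrow{\mu}_s\Theta$ on $\mathcal D$. We write $(\Sigma,\Sigma')\vdash\Delta$ if $\Sigma'\subseteq\Sigma$ and $\Sigma'\vdash P$ for all $P$ in the support. A *context*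 is $[\cdot]$ or $[\cdot]\parallel R$; it is compatible with $\Delta$ of type $(\Sigma,\Sigma')$ if $R$ is typed by a subset of $\Sigma\setminus\Sigma'$ and shares no tag with $\Delta$. *Scheduled saturated bisimilarity* $\sim_s$ is the largest relation on $\mathcal D$ such that related $\Delta,\Theta$ have a common type and the same mass and, for all contexts $B$ compatible with both and all schedulers $s$, each move $B[\Delta]\xrightarrow{\tau}_s\Delta'$ is matched by some $B[\Theta]\xrightarrow{\tau}_s\Theta'$ with $\Delta'\sim_s\Theta'$, and conversely. **Quantum distributions.** A *quantum distribution* is a finitely supported map $\mathfrak D$ from processes to positive operators on $\mathcal H_\Sigma$ with $\sum_P\mathrm{tr}\,\mathfrak D(P)\le1$; its mass is $\sum_P\mathfrak D(P)$, and $\rho\bullet P$ is the one with value $\rho$ on $P$ and $0$ elsewhere. The transitions of $\rho\bullet P$ are given by the same rules as above, except that a measurement yields $\bigoplus_m\rho_m\bullet P[m/x]$; $\rho\bullet P$ also moves to $\varepsilon$ if it has no transition with the given action and scheduler; and moves with the same action and scheduler add up: $\mathfrak D\oplus\mathfrak T$ moves to $\mathfrak D'\oplus\mathfrak T'$ if $\mathfrak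 D,\mathfrak T$ move to $\mathfrak D',\mathfrak T'$. Typing and context application are as before. *Labelled scheduled bisimilarity* $\sim_l$ is the largest relation on quantum distributions such that related $\mathfrak D,\mathfrak T$ 1. have a common type $(\Sigma,\Sigma')$; 2. match each other's moves, for every action and every scheduler, by moves with the same action and scheduler to related quantum distributions; 3. have equal environments, $\mathrm{tr}_{\Sigma'}|\mathfrak D|=\mathrm{tr}_{\Sigma'}|\mathfrak T|$; 4. satisfy $\mathcal E(\mathfrak D)\sim_l\mathcal E(\mathfrak T)$ for every trace non-increasing superoperator $\mathcal E$ on $\mathcal H_{\Sigma\setminus\Sigma'}$, padded with the identity and applied to all weights. **Theorem (Full Abstraction).** For every finite set $\Sigma$ of qubits, all states $\rho,\sigma$ on $\mathcal H_\Sigma$ and all processes $P,Q$, $$1\bullet\langle\rho,P\rangle\ \sim_s\ 1\bullet\langle\sigma,Q\rangle\quad\Longleftrightarrow\quad \rho\bullet P\ \sim_l\ \sigma\bullet Q .$$ Moreover, $\sim_l$ is preserved by parallel contexts: if $\mathfrak D\sim_l\mathfrak T$ and $B$ is a context compatible with both $\mathfrak D$ and $\mathfrak T$, then $B[\mathfrak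 D]\sim_l B[\mathfrak T]$. -/

import Mathlib

open scoped NNReal ComplexOrder Matrix

namespace LqCCS

noncomputable section

/-! ### Names, values, expressions -/

/-- Qubit names. -/
abbrev Qubit := ℕ

/-- Tags (a denumerable set). -/
abbrev Tag := ℕ

/-- Types of values: booleans, naturals, qubit names. -/
inductive Ty where
  | bool
  | nat
  | qubit
  deriving DecidableEq

/-- Variables come with the type of their possible values (denumerably many for each type). -/
structure Var where
  ty : Ty
  id : ℕ
  deriving DecidableEq

/-- A channel comes with the type of the values it carries (denumerably many for each type). -/
structure Chan where
  ty : Ty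
  id : ℕ
  deriving DecidableEq

/-- Values. -/
inductive Val where
  | bool (b : Bool)
  | nat (n : ℕ)
  | qubit (q : Qubit)
  deriving DecidableEq

/-- The type of a value. -/
def Val.ty : Val → Ty
  | .bool _ => .bool
  | .nat _ => .nat
  | .qubit _ => .qubit

/-- Expressions. -/
inductive Expr where
  | var (x : Var)
  | val (v : Val)
  | not (e : Expr)
  | or (e f : Expr)
  | le (e f : Expr)
  | eq (e f : Expr)

/-- Typing of expressions. Two expressions of the same type, qubit names included, can be
compared for equality. -/
inductive Expr.HasTy : Expr → Ty → Prop where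
  | var (x : Var) : HasTy (.var x) x.ty
  | val (v : Val) : HasTy (.val v) v.ty
  | not {e : Expr} : HasTy e .bool → HasTy (.not e) .bool
  | or {e f : Expr} : HasTy e .bool → HasTy f .bool → HasTy (.or e f) .bool
  | le {e f : Expr} : HasTy e .nat → HasTy f .nat → HasTy (.le e f) .bool
  | eq {e f : Expr} {T : Ty} : HasTy e T → HasTy f T → HasTy (.eq e f) .bool

/-- Evaluation `e ⇓ v`, written `e.eval = some v`. Variables are not evaluated. -/
def Expr.eval : Expr → Option Val
  | .var _ => none
  | .val v => some v
  | .not e =>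
    match e.eval with
    | some (.bool b) => some (.bool (!b))
    | _ => none
  | .or e f =>
    match e.eval, f.eval with
    | some (.bool a), some (.bool b) => some (.bool (a || b))
    | _, _ => none
  | .le e f =>
    match e.eval, f.eval with
    | some (.nat m), some (.nat n) => some (.bool (decide (m ≤ n)))
    | _, _ => none
  | .eq e f =>
    match e.eval, f.eval with
    | some v, some w => if v.ty = w.ty then some (.bool (decide (v = w))) else none
    | _, _ => none

/-- Substitution `e[v/x]`. -/
def Expr.subst (x : Var) (v : Val) : Expr → Expr
  | .var y => if y = x then .val v else .var y
  | .val w => .val w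
  | .not e => .not (e.subst x v)
  | .or e f => .or (e.subst x v) (f.subst x v)
  | .le e f => .le (e.subst x v) (f.subst x v)
  | .eq e f => .eq (e.subst x v) (f.subst x v)

/-- Free variables of an expression. -/
def Expr.fv : Expr → Set Var
  | .var y => {y}
  | .val _ => ∅
  | .not e => e.fv
  | .or e f => e.fv ∪ f.fv
  | .le e f => e.fv ∪ f.fv
  | .eq e f => e.fv ∪ f.fv

/-- The terms that may occur in a typing context: qubit names and variables. -/
inductive Name where
  | qubit (q : Qubit)
  | var (x : Var)
  deriving DecidableEq

/-- A name as an expression. -/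
def Name.toExpr : Name → Expr
  | .qubit q => .val (.qubit q)
  | .var x => .var x

/-- A set of qubits as a typing context. -/
def ctxOf (T : Finset Qubit) : Finset Name := T.image Name.qubit

/-! ### Quantum states, superoperators, measurements -/

/-- Indices of the computational basis of the Hilbert space of the qubits labelled by `κ`. -/
abbrev Idx (κ : Type) := κ → Fin 2

/-- Linear operators on the Hilbert space of the qubits labelled by `κ`. -/
abbrev QMat (κ : Type) := Matrix (Idx κ) (Idx κ) ℂ

/-- Density operators of trace one. -/
def IsDensity {κ : Type} [Fintype κ] [DecidableEq κ] (ρ : QMat κ) : Prop :=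
  ρ.PosSemidef ∧ ρ.trace = 1

/-- Partial density operators (trace at most one). -/
def IsSubDensity {κ : Type} [Fintype κ] [DecidableEq κ] (ρ : QMat κ) : Prop :=
  ρ.PosSemidef ∧ ρ.trace.re ≤ 1

open Classical in
/-- The operator that acts as `K` on the qubits `f k` (`k : κ`), in the order given by `f`, and as
the identity on all other qubits. -/
def pad {κ ι : Type} (f : κ → ι) (K : QMat κ) : QMat ι :=
  Matrix.of fun i j => if ∀ q, q ∉ Set.range f → i q = j q then K (i ∘ f) (j ∘ f) else 0

/-- The map `ρ ↦ ∑ i, Kᵢ ρ Kᵢ†`, with every `Kᵢ` padded with the identity. -/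
def applyKraus {κ ι : Type} [Fintype ι] [DecidableEq ι] (f : κ → ι) {len : ℕ}
    (K : Fin len → QMat κ) (ρ : QMat ι) : QMat ι :=
  ∑ i, pad f (K i) * ρ * (pad f (K i))ᴴ

/-- Trace non-increasing superoperators, given by a Kraus decomposition. -/
structure SuperOp (κ : Type) [Fintype κ] [DecidableEq κ] where
  len : ℕ
  kraus : Fin len → QMat κ
  nonincreasing : (1 - ∑ i, (kraus i)ᴴ * kraus i).PosSemidef

/-- Trace-preserving superoperators of arity `n`. -/
structure TPOp (n : ℕ) extends SuperOp (Fin n) where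
  preserving : ∑ i, (kraus i)ᴴ * kraus i = 1

/-- Measurements on `n` qubits. -/
structure Meas (n : ℕ) where
  outcomes : ℕ
  ops : Fin outcomes → QMat (Fin n)
  complete : ∑ m, (ops m)ᴴ * ops m = 1

/-- The unnormalized state `M ρ M†` after an outcome `M`, on the qubits `f`. -/
def collapse {κ ι : Type} [Fintype ι] [DecidableEq ι] (f : κ → ι) (M : QMat κ) (ρ : QMat ι) :
    QMat ι :=
  pad f M * ρ * (pad f M)ᴴ

/-- The basis index of `S` that agrees with `k` on `T` and with `i` elsewhere. -/
def glue {S T : Finset Qubit} (i : Idx ↥(S \ T)) (k : Idx ↥T) : Idx ↥S := fun q =>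
  if h : q.1 ∈ T then k ⟨q.1, h⟩ else i ⟨q.1, Finset.mem_sdiff.mpr ⟨q.2, h⟩⟩

/-- The partial trace over the qubits in `T`. -/
def ptrace {S : Finset Qubit} (T : Finset Qubit) (ρ : QMat ↥S) : QMat ↥(S \ T) :=
  Matrix.of fun i j => ∑ k : Idx ↥T, ρ (glue i k) (glue j k)

/-- The inclusion of the qubits in `S \ T` into those in `S`. -/
def envIncl (S T : Finset Qubit) (q : ↥(S \ T)) : ↥S :=
  ⟨q.1, (Finset.mem_sdiff.mp q.2).1⟩

/-! ### Processes -/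

/-- Tagged processes. -/
inductive Proc where
  | nil (es : List Expr)
  | tau (t : Tag) (P : Proc)
  | tauPair (t u : Tag) (P : Proc)
  | recv (t : Tag) (c : Chan) (x : Var) (P : Proc)
  | send (t : Tag) (c : Chan) (e : Expr) (P : Proc)
  | op (t : Tag) (n : ℕ) (E : TPOp n) (es : Fin n → Expr) (P : Proc)
  | meas (t : Tag) (n : ℕ) (M : Meas n) (es : Fin n → Expr) (x : Var) (P : Proc)
  | ite (e : Expr) (P Q : Proc)
  | sum (P Q : Proc)
  | par (P Q : Proc)
  | res (P : Proc) (c : Chan)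

/-- The tags that occur in a process. -/
def Proc.tags : Proc → Finset Tag
  | .nil _ => ∅
  | .tau t P => insert t P.tags
  | .tauPair t u P => insert t (insert u P.tags)
  | .recv t _ _ P => insert t P.tags
  | .send t _ _ P => insert t P.tags
  | .op t _ _ _ P => insert t P.tags
  | .meas t _ _ _ _ P => insert t P.tags
  | .ite _ P Q => P.tags ∪ Q.tags
  | .sum P Q => P.tags ∪ Q.tags
  | .par P Q => P.tags ∪ Q.tags
  | .res P _ => P.tags

/-- Free variables of a process; `recv` and `meas` bind their variable in the continuation. -/
def Proc.fv : Proc → Set Var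
  | .nil es => {y | ∃ e ∈ es, y ∈ e.fv}
  | .tau _ P => P.fv
  | .tauPair _ _ P => P.fv
  | .recv _ _ x P => P.fv \ {x}
  | .send _ _ e P => e.fv ∪ P.fv
  | .op _ _ _ es P => (⋃ i, (es i).fv) ∪ P.fv
  | .meas _ _ _ es x P => (⋃ i, (es i).fv) ∪ (P.fv \ {x})
  | .ite e P Q => e.fv ∪ (P.fv ∪ Q.fv)
  | .sum P Q => P.fv ∪ Q.fv
  | .par P Q => P.fv ∪ Q.fv
  | .res P _ => P.fv

/-- Substitution `P[v/x]` of a value for the free occurrences of a variable. -/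
def Proc.subst (x : Var) (v : Val) : Proc → Proc
  | .nil es => .nil (es.map (Expr.subst x v))
  | .tau t P => .tau t (P.subst x v)
  | .tauPair t u P => .tauPair t u (P.subst x v)
  | .recv t c y P => .recv t c y (if y = x then P else P.subst x v)
  | .send t c e P => .send t c (e.subst x v) (P.subst x v)
  | .op t n E es P => .op t n E (fun i => (es i).subst x v) (P.subst x v)
  | .meas t n M es y P =>
      .meas t n M (fun i => (es i).subst x v) y (if y = x then P else P.subst x v)
  | .ite e P Q => .ite (e.subst x v) (P.subst x v) (Q.subst x v)
  | .sum P Q => .sum (P.subst x v) (Q.subst x v)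
  | .par P Q => .par (P.subst x v) (Q.subst x v)
  | .res P c => .res (P.subst x v) c

/-- The linear typing judgment `G ⊢ P`: the process uses exactly the qubits in `G`. -/
inductive Typed : Finset Name → Proc → Prop where
  | nil {l : List Name} : l.Nodup → Typed l.toFinset (.nil (l.map Name.toExpr))
  | tau {G : Finset Name} {t : Tag} {P : Proc} : Typed G P → Typed G (.tau t P)
  | tauPair {G : Finset Name} {t u : Tag} {P : Proc} : Typed G P → Typed G (.tauPair t u P)
  | op {G : Finset Name} {t : Tag} {n : ℕ} {E : TPOp n} {P : Proc} (a : Fin n → Name) :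
      0 < n → Function.Injective a → (∀ i, a i ∈ G) → Typed G P →
      Typed G (.op t n E (fun i => (a i).toExpr) P)
  | meas {G : Finset Name} {t : Tag} {n : ℕ} {M : Meas n} {x : Var} {P : Proc} (a : Fin n → Name) :
      Function.Injective a → (∀ i, a i ∈ G) → x.ty = .nat → Typed G P →
      Typed G (.meas t n M (fun i => (a i).toExpr) x P)
  | crecv {G : Finset Name} {t : Tag} {c : Chan} {x : Var} {P : Proc} :
      c.ty ≠ .qubit → x.ty = c.ty → Typed G P → Typed G (.recv t c x P)
  | qrecv {G : Finset Name} {t : Tag} {c : Chan} {x : Var} {P : Proc} :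
      c.ty = .qubit → x.ty = .qubit → Name.var x ∉ G → Typed (insert (Name.var x) G) P →
      Typed G (.recv t c x P)
  | csend {G : Finset Name} {t : Tag} {c : Chan} {e : Expr} {P : Proc} :
      c.ty ≠ .qubit → e.HasTy c.ty → Typed G P → Typed G (.send t c e P)
  | qsend {G : Finset Name} {t : Tag} {c : Chan} {a : Name} {P : Proc} :
      c.ty = .qubit → a ∈ G → Typed (G.erase a) P → Typed G (.send t c a.toExpr P)
  | ite {G : Finset Name} {e : Expr} {P Q : Proc} :
      e.HasTy .bool → Typed G P → Typed G Q → Typed G (.ite e P Q)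
  | sum {G : Finset Name} {P Q : Proc} : Typed G P → Typed G Q → Typed G (.sum P Q)
  | par {G H : Finset Name} {P Q : Proc} :
      Disjoint G H → Typed G P → Typed H Q → Typed (G ∪ H) (.par P Q)
  | res {G : Finset Name} {P : Proc} {c : Chan} : Typed G P → Typed G (.res P c)

/-- `q` belongs to the (unique) typing context of `P`. -/
def Owns (P : Proc) (q : Qubit) : Prop := ∃ G, Typed G P ∧ Name.qubit q ∈ G

/-! ### Actions, schedulers, and the probabilistic semantics -/

/-- Actions. -/
inductive Act where
  | tau
  | send (c : Chan) (v : Val)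
  | recv (c : Chan) (v : Val)

/-- Schedulers: a tag, or a pair of tags for a synchronization. -/
inductive Sched where
  | one (t : Tag)
  | two (t u : Tag)

/-- The action is an input of a qubit owned by `Q`. -/
def Act.Steals (μ : Act) (Q : Proc) : Prop := ∃ c q, μ = .recv c (.qubit q) ∧ Owns Q q

/-- The action takes place on the channel `c`. -/
def Act.On (μ : Act) (c : Chan) : Prop := ∃ v, μ = .send c v ∨ μ = .recv c v

/-- Side condition for the reception of `v` on `c` with continuation `P` in the register `S`:
the value has the type of the channel, and a received qubit is in the register and not yet owned. -/
def CanRecv (S : Finset Qubit) (c : Chan) (v : Val) (P : Proc) : Prop :=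
  v.ty = c.ty ∧ ∀ q, v = .qubit q → q ∈ S ∧ ¬ Owns P q

/-- Configurations over a register `S` of qubits. -/
abbrev Conf (S : Finset Qubit) := QMat ↥S × Proc

/-- Finitely supported weights on configurations; see `IsDist` for the probability
distributions among them. The empty distribution is `0`, the point distribution is
`Finsupp.single C 1`. -/
abbrev Dist (S : Finset Qubit) := Conf S →₀ ℝ≥0

/-- The mass of a distribution. -/
def mass {A : Type} (Δ : A →₀ ℝ≥0) : ℝ≥0 := Δ.sum fun _ p => p

/-- Apply a function on processes to all processes of a distribution. -/
def Dist.mapProc {S : Finset Qubit} (f : Proc → Proc) (Δ : Dist S) : Dist S :=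
  Δ.mapDomain fun C => (C.1, f C.2)

/-- The probability of an outcome with unnormalized resulting state `ρ`. -/
def prob {κ : Type} [Fintype κ] [DecidableEq κ] (ρ : QMat κ) : ℝ≥0 := ρ.trace.re.toNNReal

/-- The transitions of configurations. Outcomes of probability zero have weight zero, hence do not
occur in the resulting distribution of a measurement. -/
inductive CStep {S : Finset Qubit} : QMat ↥S → Proc → Act → Sched → Dist S → Prop where
  | tau {ρ : QMat ↥S} {t : Tag} {P : Proc} :
      CStep ρ (.tau t P) .tau (.one t) (Finsupp.single (ρ, P) 1)
  | tauPair {ρ : QMat ↥S} {t u : Tag} {P : Proc} :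
      CStep ρ (.tauPair t u P) .tau (.two t u) (Finsupp.single (ρ, P) 1)
  | op {ρ : QMat ↥S} {t : Tag} {n : ℕ} {E : TPOp n} {P : Proc} (f : Fin n ↪ ↥S) :
      CStep ρ (.op t n E (fun i => .val (.qubit (f i))) P) .tau (.one t)
        (Finsupp.single (applyKraus f E.kraus ρ, P) 1)
  | meas {ρ : QMat ↥S} {t : Tag} {n : ℕ} {M : Meas n} {x : Var} {P : Proc} (f : Fin n ↪ ↥S) :
      CStep ρ (.meas t n M (fun i => .val (.qubit (f i))) x P) .tau (.one t)
        (∑ m : Fin M.outcomes, Finsupp.single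
          ((collapse f (M.ops m) ρ).trace⁻¹ • collapse f (M.ops m) ρ, P.subst x (.nat m))
          (prob (collapse f (M.ops m) ρ)))
  | send {ρ : QMat ↥S} {t : Tag} {c : Chan} {e : Expr} {v : Val} {P : Proc} :
      e.eval = some v → CStep ρ (.send t c e P) (.send c v) (.one t) (Finsupp.single (ρ, P) 1)
  | recv {ρ : QMat ↥S} {t : Tag} {c : Chan} {x : Var} {v : Val} {P : Proc} :
      CanRecv S c v P →
      CStep ρ (.recv t c x P) (.recv c v) (.one t) (Finsupp.single (ρ, P.subst x v) 1)
  | iteT {ρ : QMat ↥S} {e : Expr} {P Q : Proc} {μ : Act} {s : Sched} {Δ : Dist S} :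
      e.eval = some (.bool true) → CStep ρ P μ s Δ → CStep ρ (.ite e P Q) μ s Δ
  | iteF {ρ : QMat ↥S} {e : Expr} {P Q : Proc} {μ : Act} {s : Sched} {Δ : Dist S} :
      e.eval = some (.bool false) → CStep ρ Q μ s Δ → CStep ρ (.ite e P Q) μ s Δ
  | sumL {ρ : QMat ↥S} {P Q : Proc} {μ : Act} {s : Sched} {Δ : Dist S} :
      CStep ρ P μ s Δ → CStep ρ (.sum P Q) μ s Δ
  | sumR {ρ : QMat ↥S} {P Q : Proc} {μ : Act} {s : Sched} {Δ : Dist S} :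
      CStep ρ Q μ s Δ → CStep ρ (.sum P Q) μ s Δ
  | parL {ρ : QMat ↥S} {P Q : Proc} {μ : Act} {s : Sched} {Δ : Dist S} :
      CStep ρ P μ s Δ → ¬ μ.Steals Q → CStep ρ (.par P Q) μ s (Δ.mapProc fun R => .par R Q)
  | parR {ρ : QMat ↥S} {P Q : Proc} {μ : Act} {s : Sched} {Δ : Dist S} :
      CStep ρ Q μ s Δ → ¬ μ.Steals P → CStep ρ (.par P Q) μ s (Δ.mapProc fun R => .par P R)
  | synchL {ρ : QMat ↥S} {P P' Q Q' : Proc} {c : Chan} {v : Val} {t u : Tag} :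
      CStep ρ P (.send c v) (.one t) (Finsupp.single (ρ, P') 1) →
      CStep ρ Q (.recv c v) (.one u) (Finsupp.single (ρ, Q') 1) →
      CStep ρ (.par P Q) .tau (.two t u) (Finsupp.single (ρ, .par P' Q') 1)
  | synchR {ρ : QMat ↥S} {P P' Q Q' : Proc} {c : Chan} {v : Val} {t u : Tag} :
      CStep ρ P (.recv c v) (.one t) (Finsupp.single (ρ, P') 1) →
      CStep ρ Q (.send c v) (.one u) (Finsupp.single (ρ, Q') 1) →
      CStep ρ (.par P Q) .tau (.two t u) (Finsupp.single (ρ, .par P' Q') 1)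
  | res {ρ : QMat ↥S} {P : Proc} {c : Chan} {μ : Act} {s : Sched} {Δ : Dist S} :
      CStep ρ P μ s Δ → ¬ μ.On c → CStep ρ (.res P c) μ s (Δ.mapProc fun R => .res R c)

/-- A process is deterministic when, in every state, a scheduler forces a unique transition, up to
the choice of the value received from outside. -/
def Deterministic (P : Proc) : Prop :=
  ∀ (S T : Finset Qubit), T ⊆ S → Typed (ctxOf T) P → ∀ ρ : QMat ↥S, IsDensity ρ →
    ∀ (s : Sched) (μ ν : Act) (Δ Θ : Dist S), CStep ρ P μ s Δ → CStep ρ P ν s Θ →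
      (μ = ν ∧ Δ = Θ) ∨ (μ ≠ ν ∧ ∃ c v w, μ = .recv c v ∧ ν = .recv c w)

/-- `Q` is reached with positive probability by one transition of `P` in some state. -/
def Derives (P Q : Proc) : Prop :=
  ∃ (S T : Finset Qubit), T ⊆ S ∧ Typed (ctxOf T) P ∧ ∃ ρ : QMat ↥S, IsDensity ρ ∧
    ∃ (μ : Act) (s : Sched) (Δ : Dist S), CStep ρ P μ s Δ ∧ ∃ σ : QMat ↥S, (σ, Q) ∈ Δ.support

/-- The processes that are considered: closed processes that are deterministic, together with
all the processes they evolve to. -/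
def Admissible (P : Proc) : Prop :=
  P.fv = ∅ ∧ ∀ Q, Relation.ReflTransGen Derives P Q → Deterministic Q

/-- Probability distributions (of mass at most one) of configurations. -/
def IsDist {S : Finset Qubit} (Δ : Dist S) : Prop :=
  mass Δ ≤ 1 ∧ ∀ C ∈ Δ.support, IsDensity C.1 ∧ Admissible C.2

/-- The judgment `(S, T) ⊢ Δ`. -/
def Dist.HasType {S : Finset Qubit} (T : Finset Qubit) (Δ : Dist S) : Prop :=
  T ⊆ S ∧ ∀ C ∈ Δ.support, Typed (ctxOf T) C.2

/-- The left-linear lifting of a relation: the least left-linear relation that relates the point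
distribution on `a` to `Θ` whenever `a` is related to `Θ`. -/
inductive Lift {A B : Type} (R : A → (B →₀ ℝ≥0) → Prop) : (A →₀ ℝ≥0) → (B →₀ ℝ≥0) → Prop where
  | point {a : A} {Θ : B →₀ ℝ≥0} : R a Θ → Lift R (Finsupp.single a 1) Θ
  | linear {n : ℕ} (p : Fin n → ℝ≥0) (Δ : Fin n → A →₀ ℝ≥0) (Θ : Fin n → B →₀ ℝ≥0) :
      (∀ i, p i ≤ 1) → (∀ i, Lift R (Δ i) (Θ i)) → mass (∑ i, p i • Δ i) ≤ 1 →
      Lift R (∑ i, p i • Δ i) (∑ i, p i • Θ i)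

/-- Transitions of configurations, completed with a move to the empty distribution for those
that have no transition with the given action and scheduler. -/
def Bot {S : Finset Qubit} (μ : Act) (s : Sched) (C : Conf S) (Δ : Dist S) : Prop :=
  CStep C.1 C.2 μ s Δ ∨ ((∀ Θ, ¬ CStep C.1 C.2 μ s Θ) ∧ Δ = 0)

/-- Scheduled transitions of distributions. -/
def DMove {S : Finset Qubit} (Δ : Dist S) (μ : Act) (s : Sched) (Θ : Dist S) : Prop :=
  Lift (Bot μ s) Δ Θ

/-! ### Contexts and scheduled saturated bisimilarity -/

/-- Contexts: the hole, or the hole in parallel with a process. -/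
inductive Ctx where
  | hole
  | par (R : Proc)

/-- Apply a context to a process. -/
def Ctx.fill : Ctx → Proc → Proc
  | .hole, P => P
  | .par R, P => .par P R

/-- The tags of a context. -/
def Ctx.tags : Ctx → Finset Tag
  | .hole => ∅
  | .par R => R.tags

/-- The judgment `U ⊢ B[·]_T`. -/
inductive Ctx.HasType : Finset Qubit → Finset Qubit → Ctx → Prop where
  | hole {T : Finset Qubit} : HasType T T .hole
  | par {U T : Finset Qubit} {R : Proc} :
      Admissible R → Typed (ctxOf (U \ T)) R → T ⊆ U → HasType U T (.par R)

/-- The context `B`, with hole of type `T` and result of type `U`, is compatible with `Δ`. -/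
def Ctx.Compatible {S : Finset Qubit} (U T : Finset Qubit) (B : Ctx) (Δ : Dist S) : Prop :=
  B.HasType U T ∧ Δ.HasType T ∧ U ⊆ S ∧ ∀ C ∈ Δ.support, Disjoint C.2.tags B.tags

/-- Scheduled saturated bisimulations. -/
structure IsSatBisim {S : Finset Qubit} (R : Dist S → Dist S → Prop) : Prop where
  dist : ∀ Δ Θ, R Δ Θ → IsDist Δ ∧ IsDist Θ
  typed : ∀ Δ Θ, R Δ Θ → ∃ T, Δ.HasType T ∧ Θ.HasType T
  mass_eq : ∀ Δ Θ, R Δ Θ → mass Δ = mass Θ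
  left : ∀ Δ Θ, R Δ Θ → ∀ (U T : Finset Qubit) (B : Ctx), B.Compatible U T Δ → B.Compatible U T Θ →
    ∀ (s : Sched) (Δ' : Dist S), DMove (Δ.mapProc B.fill) .tau s Δ' →
      ∃ Θ', DMove (Θ.mapProc B.fill) .tau s Θ' ∧ R Δ' Θ'
  right : ∀ Δ Θ, R Δ Θ → ∀ (U T : Finset Qubit) (B : Ctx), B.Compatible U T Δ → B.Compatible U T Θ →
    ∀ (s : Sched) (Θ' : Dist S), DMove (Θ.mapProc B.fill) .tau s Θ' →
      ∃ Δ', DMove (Δ.mapProc B.fill) .tau s Δ' ∧ R Δ' Θ'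

/-- Scheduled saturated bisimilarity, the largest scheduled saturated bisimulation. -/
def SatBisimilar {S : Finset Qubit} (Δ Θ : Dist S) : Prop :=
  ∃ R : Dist S → Dist S → Prop, IsSatBisim R ∧ R Δ Θ

/-! ### Quantum distributions and their semantics -/

/-- Finitely supported operator weights on processes; see `IsQDist` for the quantum
distributions among them. The empty distribution is `0`, the quantum distribution with weight `ρ` on
`P` is `Finsupp.single P ρ`. -/
abbrev QDist (S : Finset Qubit) := Proc →₀ QMat ↥S

/-- The mass of a quantum distribution, the sum of its weights. -/
def qmass {S : Finset Qubit} (D : QDist S) : QMat ↥S := D.sum fun _ ρ => ρ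

/-- Quantum distributions: the weights are positive operators of total trace at most one. -/
def IsQDist {S : Finset Qubit} (D : QDist S) : Prop :=
  (∀ P, (D P).PosSemidef) ∧ (qmass D).trace.re ≤ 1 ∧ ∀ P ∈ D.support, Admissible P

/-- The judgment `(S, T) ⊢ D`. -/
def QDist.HasType {S : Finset Qubit} (T : Finset Qubit) (D : QDist S) : Prop :=
  T ⊆ S ∧ ∀ P ∈ D.support, Typed (ctxOf T) P

/-- Apply a function on processes to all processes of a quantum distribution. -/
def QDist.mapProc {S : Finset Qubit} (f : Proc → Proc) (D : QDist S) : QDist S :=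
  D.mapDomain f

/-- The transitions of the quantum distributions with weight `ρ` on the single process `P`. -/
inductive QStep {S : Finset Qubit} : QMat ↥S → Proc → Act → Sched → QDist S → Prop where
  | tau {ρ : QMat ↥S} {t : Tag} {P : Proc} :
      QStep ρ (.tau t P) .tau (.one t) (Finsupp.single P ρ)
  | tauPair {ρ : QMat ↥S} {t u : Tag} {P : Proc} :
      QStep ρ (.tauPair t u P) .tau (.two t u) (Finsupp.single P ρ)
  | op {ρ : QMat ↥S} {t : Tag} {n : ℕ} {E : TPOp n} {P : Proc} (f : Fin n ↪ ↥S) :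
      QStep ρ (.op t n E (fun i => .val (.qubit (f i))) P) .tau (.one t)
        (Finsupp.single P (applyKraus f E.kraus ρ))
  | meas {ρ : QMat ↥S} {t : Tag} {n : ℕ} {M : Meas n} {x : Var} {P : Proc} (f : Fin n ↪ ↥S) :
      QStep ρ (.meas t n M (fun i => .val (.qubit (f i))) x P) .tau (.one t)
        (∑ m : Fin M.outcomes, Finsupp.single (P.subst x (.nat m)) (collapse f (M.ops m) ρ))
  | send {ρ : QMat ↥S} {t : Tag} {c : Chan} {e : Expr} {v : Val} {P : Proc} :
      e.eval = some v → QStep ρ (.send t c e P) (.send c v) (.one t) (Finsupp.single P ρ)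
  | recv {ρ : QMat ↥S} {t : Tag} {c : Chan} {x : Var} {v : Val} {P : Proc} :
      CanRecv S c v P →
      QStep ρ (.recv t c x P) (.recv c v) (.one t) (Finsupp.single (P.subst x v) ρ)
  | iteT {ρ : QMat ↥S} {e : Expr} {P Q : Proc} {μ : Act} {s : Sched} {D : QDist S} :
      e.eval = some (.bool true) → QStep ρ P μ s D → QStep ρ (.ite e P Q) μ s D
  | iteF {ρ : QMat ↥S} {e : Expr} {P Q : Proc} {μ : Act} {s : Sched} {D : QDist S} :
      e.eval = some (.bool false) → QStep ρ Q μ s D → QStep ρ (.ite e P Q) μ s D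
  | sumL {ρ : QMat ↥S} {P Q : Proc} {μ : Act} {s : Sched} {D : QDist S} :
      QStep ρ P μ s D → QStep ρ (.sum P Q) μ s D
  | sumR {ρ : QMat ↥S} {P Q : Proc} {μ : Act} {s : Sched} {D : QDist S} :
      QStep ρ Q μ s D → QStep ρ (.sum P Q) μ s D
  | parL {ρ : QMat ↥S} {P Q : Proc} {μ : Act} {s : Sched} {D : QDist S} :
      QStep ρ P μ s D → ¬ μ.Steals Q → QStep ρ (.par P Q) μ s (D.mapProc fun R => .par R Q)
  | parR {ρ : QMat ↥S} {P Q : Proc} {μ : Act} {s : Sched} {D : QDist S} :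
      QStep ρ Q μ s D → ¬ μ.Steals P → QStep ρ (.par P Q) μ s (D.mapProc fun R => .par P R)
  | synchL {ρ : QMat ↥S} {P P' Q Q' : Proc} {c : Chan} {v : Val} {t u : Tag} :
      QStep ρ P (.send c v) (.one t) (Finsupp.single P' ρ) →
      QStep ρ Q (.recv c v) (.one u) (Finsupp.single Q' ρ) →
      QStep ρ (.par P Q) .tau (.two t u) (Finsupp.single (.par P' Q') ρ)
  | synchR {ρ : QMat ↥S} {P P' Q Q' : Proc} {c : Chan} {v : Val} {t u : Tag} :
      QStep ρ P (.recv c v) (.one t) (Finsupp.single P' ρ) →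
      QStep ρ Q (.send c v) (.one u) (Finsupp.single Q' ρ) →
      QStep ρ (.par P Q) .tau (.two t u) (Finsupp.single (.par P' Q') ρ)
  | res {ρ : QMat ↥S} {P : Proc} {c : Chan} {μ : Act} {s : Sched} {D : QDist S} :
      QStep ρ P μ s D → ¬ μ.On c → QStep ρ (.res P c) μ s (D.mapProc fun R => .res R c)

/-- Scheduled transitions of quantum distributions: the components evolve altogether with the same
action and scheduler, and those that cannot move evolve to the empty distribution. -/
inductive QMove {S : Finset Qubit} : QDist S → Act → Sched → QDist S → Prop where
  | step {ρ : QMat ↥S} {P : Proc} {μ : Act} {s : Sched} {D : QDist S} :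
      IsSubDensity ρ → QStep ρ P μ s D → QMove (Finsupp.single P ρ) μ s D
  | stuck {ρ : QMat ↥S} {P : Proc} {μ : Act} {s : Sched} :
      IsSubDensity ρ → (∀ D, ¬ QStep ρ P μ s D) → QMove (Finsupp.single P ρ) μ s 0
  | conv {D D' E E' : QDist S} {μ : Act} {s : Sched} :
      QMove D μ s D' → QMove E μ s E' → (qmass (D + E)).trace.re ≤ 1 →
      QMove (D + E) μ s (D' + E')

/-! ### Labelled scheduled bisimilarity -/

/-- Well-typed relations. -/
def WellTypedRel {S : Finset Qubit} (R : QDist S → QDist S → Prop) : Prop :=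
  ∀ D E, R D E → ∃ T, D.HasType T ∧ E.HasType T

/-- Transition-closed relations. -/
def TransitionClosed {S : Finset Qubit} (R : QDist S → QDist S → Prop) : Prop :=
  ∀ D E, R D E → ∀ (s : Sched) (μ : Act),
    (∀ D', QMove D μ s D' → ∃ E', QMove E μ s E' ∧ R D' E') ∧
    (∀ E', QMove E μ s E' → ∃ D', QMove D μ s D' ∧ R D' E')

/-- The state `tr_T (mass D)` of the qubits outside `T`: the environment of a quantum distribution
`D` of type `(S, T)`; it is zero for the empty distribution. -/
def QDist.env {S : Finset Qubit} (T : Finset Qubit) (D : QDist S) : QMat ↥(S \ T) :=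
  ptrace T (qmass D)

/-- Environment-preserving relations: related quantum distributions have a common type, and
the same environment at that type. -/
def EnvPreserving {S : Finset Qubit} (R : QDist S → QDist S → Prop) : Prop :=
  ∀ D E, R D E → ∃ T, D.HasType T ∧ E.HasType T ∧ D.env T = E.env T

theorem applyKraus_zero {κ ι : Type} [Fintype ι] [DecidableEq ι] (f : κ → ι) {len : ℕ}
    (K : Fin len → QMat κ) : applyKraus f K (0 : QMat ι) = 0 := by
  simp [applyKraus]

/-- Apply to all the weights a superoperator on the qubits outside `T`, padded with the identity. -/
def SuperOp.onEnv {S T : Finset Qubit} (E : SuperOp ↥(S \ T)) (D : QDist S) : QDist S :=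
  D.mapRange (applyKraus (envIncl S T) E.kraus) (applyKraus_zero _ _)

/-- Relations closed for compatible superoperators: those on the qubits outside a type of both
related quantum distributions. -/
def SuperOpClosed {S : Finset Qubit} (R : QDist S → QDist S → Prop) : Prop :=
  ∀ D E, R D E → ∀ T, D.HasType T → E.HasType T → ∀ F : SuperOp ↥(S \ T), R (F.onEnv D) (F.onEnv E)

/-- Labelled scheduled bisimulations. -/
structure IsLabBisim {S : Finset Qubit} (R : QDist S → QDist S → Prop) : Prop where
  dist : ∀ D E, R D E → IsQDist D ∧ IsQDist E
  typed : WellTypedRel R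
  closed : TransitionClosed R
  env : EnvPreserving R
  superOp : SuperOpClosed R

/-- Labelled scheduled bisimilarity, the largest labelled scheduled bisimulation. -/
def LabBisimilar {S : Finset Qubit} (D E : QDist S) : Prop :=
  ∃ R : QDist S → QDist S → Prop, IsLabBisim R ∧ R D E

/-- The context `B`, with hole of type `T` and result of type `U`, is compatible with the quantum
distribution `D`. -/
def Ctx.QCompatible {S : Finset Qubit} (U T : Finset Qubit) (B : Ctx) (D : QDist S) : Prop :=
  B.HasType U T ∧ D.HasType T ∧ U ⊆ S ∧ ∀ P ∈ D.support, Disjoint P.tags B.tags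

end

end LqCCS

namespace LqCCS

noncomputable section

/-! Determinism makes every move the value of a linear map. The transitions of a process with a
given action and scheduler have a form that does not depend on the state (`Sh`), and each is given
by a complete family of Kraus operators on the qubits that the process owns (`Sh.exists_kraus`).
Determinism, which speaks of density operators, extends to all positive weights by linearity
(`Sh.unique`). A well-typed quantum distribution `D` therefore has exactly one move, to `next μ s
D`, and `next μ s` is linear (`QMove.eq_next`, `QGood.qmove_next`). The map `toQ` multiplies states
by their probabilities and adds up the weights of equal processes. It turns mass into trace and
carries the moves of distributions of configurations to the same maps (`DMove.toQ_eq_next`).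
Matching a move thus never involves a choice, and both bisimilarities become statements about
iterating linear maps.

Congruence: `ParClosure` consists of sums of pairs `parMap R D`, `parMap R E` with `D` and `E`
labelled bisimilar. As tags are disjoint, the scheduler decides who moves. If it is the hole, `D`
and `E` move and stay bisimilar. If it is `R`, its Kraus operators act on the environment of `D` and
`E`, where bisimilarity is closed under superoperators. In a synchronization, `D` and `E` perform
one of finitely many visible actions while `R` performs the dual one. The last two cases produce
sums. Environments stay equal because a context only shrinks them. The crucial step is
`ParClosure.next`.

From labelled to saturated: by congruence, labelled bisimilarity of the images under `toQ` is a
saturated bisimulation (`isSatBisim_labBisimilar`); masses agree because equal environments have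
equal traces.

From saturated to labelled: a saturated bisimulation equates the final traces of all tests, a test
being a process `R` on the remaining qubits together with a list of schedulers for silent moves
(`IsSatBisim.trace_run_parMap_eq`). The relation `Tested`, which requires only this, is already a
labelled bisimulation (`isLabBisim_tested`). Indeed a test of `next μ s D` becomes a test of `D` by
prefixing `R` with a complementary send or with a receive that checks the value
(`exists_test_next`). A test of a superoperator applied to `D` becomes a test of `D` by prefixing
`R` with a measurement whose extra outcome blocks (`exists_test_onEnv`). Environments agree because
all projectors on them are among these superoperators and traces agree. -/

open scoped MatrixOrder Matrix.Norms.L2Operator in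
-- The factor transports positivity through `pad`, and later supplies the operator that completes a
-- trace non-increasing map to a measurement.
theorem exists_eq_conjTranspose_mul_self {n : Type} [Fintype n] [DecidableEq n] {K : Matrix n n ℂ}
    (hK : K.PosSemidef) : ∃ B : Matrix n n ℂ, K = Bᴴ * B :=
  CStarAlgebra.nonneg_iff_eq_star_mul_self.mp hK.nonneg

/-! ### Operators padded with the identity -/

theorem pad_apply {κ ι : Type} (f : κ → ι) (K : QMat κ) (i j : Idx ι)
    (h : ∀ q, q ∉ Set.range f → i q = j q) : pad f K i j = K (i ∘ f) (j ∘ f) := by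
  simp only [pad, Matrix.of_apply, if_pos h]

theorem pad_apply_of_not {κ ι : Type} (f : κ → ι) (K : QMat κ) (i j : Idx ι)
    (h : ¬ ∀ q, q ∉ Set.range f → i q = j q) : pad f K i j = 0 := by
  simp only [pad, Matrix.of_apply, if_neg h]

theorem pad_add {κ ι : Type} (f : κ → ι) (K L : QMat κ) :
    pad f (K + L) = pad f K + pad f L := by
  ext i j
  by_cases h : ∀ q, q ∉ Set.range f → i q = j q
  · simp [pad_apply f _ i j h]
  · simp [pad_apply_of_not f _ i j h]

@[simp] theorem pad_zero {κ ι : Type} (f : κ → ι) : pad f (0 : QMat κ) = 0 := by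
  ext i j
  by_cases h : ∀ q, q ∉ Set.range f → i q = j q
  · simp [pad_apply f _ i j h]
  · simp [pad_apply_of_not f _ i j h]

theorem pad_sub {κ ι : Type} (f : κ → ι) (K L : QMat κ) :
    pad f (K - L) = pad f K - pad f L := by
  rw [eq_sub_iff_add_eq, ← pad_add, sub_add_cancel]

theorem pad_sum {κ ι α : Type} (f : κ → ι) (s : Finset α) (K : α → QMat κ) :
    pad f (∑ a ∈ s, K a) = ∑ a ∈ s, pad f (K a) := by
  classical
  induction s using Finset.induction_on with
  | empty => simp
  | insert a s ha ih => rw [Finset.sum_insert ha, Finset.sum_insert ha, pad_add, ih]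

theorem pad_conjTranspose {κ ι : Type} (f : κ → ι) (K : QMat κ) :
    (pad f K)ᴴ = pad f Kᴴ := by
  ext i j
  rw [Matrix.conjTranspose_apply]
  by_cases h : ∀ q, q ∉ Set.range f → i q = j q
  · rw [pad_apply f _ i j h, pad_apply f _ j i fun q hq => (h q hq).symm,
      Matrix.conjTranspose_apply]
  · rw [pad_apply_of_not f _ i j h, pad_apply_of_not f _ j i, star_zero]
    exact fun h' => h fun q hq => (h' q hq).symm

theorem pad_one {κ ι : Type} [DecidableEq κ] [DecidableEq ι] [Fintype κ] [Fintype ι]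
    (f : κ → ι) : pad f (1 : QMat κ) = 1 := by
  ext i j
  by_cases h : ∀ q, q ∉ Set.range f → i q = j q
  · rw [pad_apply f _ i j h, Matrix.one_apply, Matrix.one_apply]
    congr 1
    refine propext ⟨fun e => funext fun q => ?_, fun e => by rw [e]⟩
    by_cases hq : q ∈ Set.range f
    · obtain ⟨k, rfl⟩ := hq
      exact congrFun e k
    · exact h q hq
  · rw [pad_apply_of_not f _ i j h, Matrix.one_apply_ne]
    rintro rfl
    exact h fun _ _ => rfl

/-- In the product only the middle indices that agree with `i` off the range of `f` contribute.
Injectivity of `f` makes them correspond to the indices `a` of the small system, through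
`Function.extend f a i`. -/
theorem pad_mul {κ ι : Type} [DecidableEq κ] [DecidableEq ι] [Fintype κ] [Fintype ι]
    {f : κ → ι} (hf : Function.Injective f) (K L : QMat κ) :
    pad f (K * L) = pad f K * pad f L := by
  classical
  ext i j
  rw [Matrix.mul_apply]
  have key : ∀ k : Idx ι, (∀ q, q ∉ Set.range f → i q = k q) ∨ pad f K i k * pad f L k j = 0 := by
    intro k
    by_cases h : ∀ q, q ∉ Set.range f → i q = k q
    · exact Or.inl h
    · exact Or.inr (by rw [pad_apply_of_not f _ i k h, zero_mul])
  rw [← Finset.sum_filter_of_ne (p := fun k => ∀ q, q ∉ Set.range f → i q = k q)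
    (fun k _ hk => (key k).resolve_right hk)]
  have hext : ∀ a : Idx κ, Function.extend f a i ∘ f = a := fun a =>
    funext fun k => hf.extend_apply a i k
  have hoff : ∀ (a : Idx κ) q, q ∉ Set.range f → i q = Function.extend f a i q := by
    intro a q hq
    rw [Function.extend_apply' _ _ _ hq]
  have hsum : ∑ k with ∀ q, q ∉ Set.range f → i q = k q, pad f K i k * pad f L k j
      = ∑ a : Idx κ, pad f K i (Function.extend f a i) * pad f L (Function.extend f a i) j := by
    refine Finset.sum_nbij' (fun k => k ∘ f) (fun a => Function.extend f a i) ?_ ?_ ?_ ?_ ?_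
    · simp
    · intro a _
      simpa using hoff a
    · intro k hk
      rw [Finset.mem_filter] at hk
      funext q
      by_cases hq : q ∈ Set.range f
      · obtain ⟨k', rfl⟩ := hq
        exact hf.extend_apply _ _ _
      · rw [Function.extend_apply' _ _ _ hq]
        exact hk.2 q hq
    · intro a _
      exact hext a
    · intro k hk
      rw [Finset.mem_filter] at hk
      have : Function.extend f (k ∘ f) i = k := by
        funext q
        by_cases hq : q ∈ Set.range f
        · obtain ⟨k', rfl⟩ := hq
          exact hf.extend_apply _ _ _
        · rw [Function.extend_apply' _ _ _ hq]
          exact hk.2 q hq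
      rw [this]
  rw [hsum]
  by_cases h : ∀ q, q ∉ Set.range f → i q = j q
  · rw [pad_apply f _ i j h, Matrix.mul_apply]
    refine Finset.sum_congr rfl fun a _ => ?_
    rw [pad_apply f _ _ _ (hoff a), pad_apply f _ _ _ fun q hq => (hoff a q hq).symm.trans (h q hq),
      hext]
  · rw [pad_apply_of_not f _ i j h]
    refine (Finset.sum_eq_zero fun a _ => ?_).symm
    rw [pad_apply_of_not f L, mul_zero]
    exact fun h' => h fun q hq => (hoff a q hq).trans (h' q hq)

theorem pad_pad {κ ι ν : Type} {g : ι → ν} (hg : Function.Injective g) (f : κ → ι) (K : QMat κ) :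
    pad g (pad f K) = pad (g ∘ f) K := by
  ext i j
  by_cases h : ∀ q, q ∉ Set.range (g ∘ f) → i q = j q
  · rw [pad_apply (g ∘ f) _ i j h, pad_apply g, pad_apply f]
    · rfl
    · intro q hq
      refine h (g q) ?_
      rintro ⟨k, hk⟩
      exact hq ⟨k, hg hk⟩
    · intro q hq
      refine h q ?_
      rintro ⟨k, rfl⟩
      exact hq ⟨f k, rfl⟩
  · rw [pad_apply_of_not (g ∘ f) _ i j h]
    by_cases h1 : ∀ q, q ∉ Set.range g → i q = j q
    · rw [pad_apply g _ i j h1, pad_apply_of_not f]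
      intro h2
      refine h fun q hq => ?_
      by_cases hq' : q ∈ Set.range g
      · obtain ⟨r, rfl⟩ := hq'
        refine h2 r ?_
        rintro ⟨k, rfl⟩
        exact hq ⟨k, rfl⟩
      · exact h1 q hq'
    · rw [pad_apply_of_not g _ i j h1]

/-- With `pad_one`, completeness of a family of Kraus operators passes from a subsystem to the
register. -/
theorem pad_sum_adjoint_mul {κ ι α : Type} [DecidableEq κ] [DecidableEq ι] [Fintype κ] [Fintype ι]
    {f : κ → ι} (hf : Function.Injective f) (s : Finset α) (K : α → QMat κ) :
    ∑ a ∈ s, (pad f (K a))ᴴ * pad f (K a) = pad f (∑ a ∈ s, (K a)ᴴ * K a) := by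
  rw [pad_sum]
  exact Finset.sum_congr rfl fun a _ => by rw [pad_conjTranspose, pad_mul hf]

theorem pad_posSemidef {κ ι : Type} [DecidableEq κ] [DecidableEq ι] [Fintype κ] [Fintype ι]
    {f : κ → ι} (hf : Function.Injective f) {K : QMat κ} (hK : K.PosSemidef) :
    (pad f K).PosSemidef := by
  obtain ⟨B, rfl⟩ := exists_eq_conjTranspose_mul_self hK
  rw [pad_mul hf, ← pad_conjTranspose]
  exact Matrix.posSemidef_conjTranspose_mul_self _

/-! ### Partial trace -/

theorem envIncl_injective (S T : Finset Qubit) : Function.Injective (envIncl S T) :=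
  fun _ _ h => Subtype.ext (congrArg (fun q : ↥S => q.1) h)

theorem range_envIncl {S T : Finset Qubit} (q : ↥S) : q ∈ Set.range (envIncl S T) ↔ q.1 ∉ T :=
  ⟨by rintro ⟨r, rfl⟩; exact (Finset.mem_sdiff.mp r.2).2,
    fun h => ⟨⟨q.1, Finset.mem_sdiff.mpr ⟨q.2, h⟩⟩, rfl⟩⟩

theorem sum_glue {S T : Finset Qubit} (h : T ⊆ S) (g : Idx ↥S → ℂ) :
    ∑ i, g i = ∑ a : Idx ↥(S \ T), ∑ k : Idx ↥T, g (glue a k) := by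
  rw [← Fintype.sum_prod_type']
  symm
  refine Fintype.sum_equiv
    (⟨fun p => glue p.1 p.2, fun i => (i ∘ envIncl S T, fun q => i ⟨q.1, h q.2⟩), ?_, ?_⟩ :
      Idx ↥(S \ T) × Idx ↥T ≃ Idx ↥S) _ _ fun _ => rfl
  · rintro ⟨a, k⟩
    refine Prod.ext (funext fun q => ?_) (funext fun q => ?_)
    · have := (Finset.mem_sdiff.mp q.2).2
      simp [glue, envIncl, this]
    · simp [glue]
  · intro i
    funext q
    by_cases hq : q.1 ∈ T
    · simp [glue, hq]
    · simp [glue, hq, envIncl]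

theorem pad_envIncl_glue {S T : Finset Qubit} (h : T ⊆ S) (A : QMat ↥(S \ T))
    (a b : Idx ↥(S \ T)) (k l : Idx ↥T) :
    pad (envIncl S T) A (glue a k) (glue b l) = if k = l then A a b else 0 := by
  have hcomp : ∀ (a : Idx ↥(S \ T)) (k : Idx ↥T), glue a k ∘ envIncl S T = a := by
    intro a k
    funext q
    have := (Finset.mem_sdiff.mp q.2).2
    simp [glue, envIncl, this]
  split_ifs with hkl
  · subst hkl
    rw [pad_apply, hcomp, hcomp]
    intro q hq
    rw [range_envIncl, not_not] at hq
    simp [glue, hq]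
  · rw [pad_apply_of_not]
    intro hq
    refine hkl (funext fun q => ?_)
    have := hq ⟨q.1, h q.2⟩ (by rw [range_envIncl, not_not]; exact q.2)
    simpa [glue] using this

/-- Partial trace is adjoint to padding for the trace pairing: on glued indices the padded operator
is `A ⊗ 1`. The later facts about `ptrace` come from this duality. -/
theorem trace_pad_envIncl_mul {S T : Finset Qubit} (h : T ⊆ S) (A : QMat ↥(S \ T)) (ρ : QMat ↥S) :
    (pad (envIncl S T) A * ρ).trace = (A * ptrace T ρ).trace := by
  simp only [Matrix.trace, Matrix.diag, Matrix.mul_apply, ptrace, Matrix.of_apply]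
  rw [sum_glue h]
  refine Finset.sum_congr rfl fun a _ => ?_
  simp only [sum_glue h, pad_envIncl_glue h, ite_mul, zero_mul, Finset.mul_sum,
    Finset.sum_ite_eq, Finset.mem_univ, if_true]
  exact Finset.sum_comm

theorem ptrace_eq_iff {S T : Finset Qubit} (h : T ⊆ S) (ρ σ : QMat ↥S) :
    ptrace T ρ = ptrace T σ ↔
      ∀ A, (pad (envIncl S T) A * ρ).trace = (pad (envIncl S T) A * σ).trace := by
  simp only [trace_pad_envIncl_mul h]
  exact Matrix.ext_iff_trace_mul_left

/-- The inclusion of the qubits of `V` into those of `S`. -/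
def incl {V S : Finset Qubit} (h : V ⊆ S) (q : ↥V) : ↥S := ⟨q.1, h q.2⟩

theorem incl_injective {V S : Finset Qubit} (h : V ⊆ S) : Function.Injective (incl h) :=
  fun _ _ e => Subtype.ext (congrArg (fun q : ↥S => q.1) e)

/-- Dually, an observable on the qubits outside `U` is also one on the larger set of those outside
`T`. -/
theorem ptrace_eq_mono {S T U : Finset Qubit} (hTU : T ⊆ U) (hU : U ⊆ S) {ρ σ : QMat ↥S}
    (h : ptrace T ρ = ptrace T σ) : ptrace U ρ = ptrace U σ := by
  rw [ptrace_eq_iff hU]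
  rw [ptrace_eq_iff (hTU.trans hU)] at h
  intro A
  have e : envIncl S U = envIncl S T ∘ incl (Finset.sdiff_subset_sdiff subset_rfl hTU) := rfl
  rw [e, ← pad_pad (envIncl_injective S T)]
  exact h _

theorem trace_ptrace {S T : Finset Qubit} (h : T ⊆ S) (ρ : QMat ↥S) :
    (ptrace T ρ).trace = ρ.trace := by
  have := trace_pad_envIncl_mul h 1 ρ
  rwa [pad_one, one_mul, one_mul, eq_comm] at this

/-! ### Conjugation -/

/-- The map `ρ ↦ K ρ K†`. -/
def conj {ι : Type} [Fintype ι] [DecidableEq ι] (K : QMat ι) : QMat ι →ₗ[ℂ] QMat ι where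
  toFun ρ := K * ρ * Kᴴ
  map_add' ρ σ := by rw [mul_add, add_mul]
  map_smul' c ρ := by simp

theorem conj_apply {ι : Type} [Fintype ι] [DecidableEq ι] (K ρ : QMat ι) :
    conj K ρ = K * ρ * Kᴴ := rfl

theorem conj_posSemidef {ι : Type} [Fintype ι] [DecidableEq ι] (K : QMat ι) {ρ : QMat ι}
    (h : ρ.PosSemidef) : (conj K ρ).PosSemidef :=
  h.mul_mul_conjTranspose_same K

theorem trace_conj {ι : Type} [Fintype ι] [DecidableEq ι] (K ρ : QMat ι) :
    (conj K ρ).trace = (Kᴴ * K * ρ).trace := by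
  rw [conj_apply, Matrix.trace_mul_cycle]

theorem collapse_eq_conj {κ ι : Type} [Fintype ι] [DecidableEq ι] (f : κ → ι) (M : QMat κ)
    (ρ : QMat ι) : collapse f M ρ = conj (pad f M) ρ := rfl

/-- `applyKraus` as a linear map. -/
def krausMap {κ ι : Type} [Fintype ι] [DecidableEq ι] (f : κ → ι) {len : ℕ}
    (K : Fin len → QMat κ) : QMat ι →ₗ[ℂ] QMat ι :=
  ∑ i, conj (pad f (K i))

theorem krausMap_apply {κ ι : Type} [Fintype ι] [DecidableEq ι] (f : κ → ι) {len : ℕ}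
    (K : Fin len → QMat κ) (ρ : QMat ι) : krausMap f K ρ = applyKraus f K ρ := by
  simp [krausMap, applyKraus, conj_apply]

theorem applyKraus_posSemidef {κ ι : Type} [Fintype ι] [DecidableEq ι] (f : κ → ι) {len : ℕ}
    (K : Fin len → QMat κ) {ρ : QMat ι} (h : ρ.PosSemidef) : (applyKraus f K ρ).PosSemidef :=
  Matrix.posSemidef_sum _ fun i _ => conj_posSemidef (pad f (K i)) h

theorem trace_applyKraus {κ ι : Type} [Fintype ι] [DecidableEq ι] [Fintype κ] [DecidableEq κ]
    {f : κ → ι} (hf : Function.Injective f) {len : ℕ} (K : Fin len → QMat κ) (ρ : QMat ι) :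
    (applyKraus f K ρ).trace = (pad f (∑ i, (K i)ᴴ * K i) * ρ).trace := by
  rw [← pad_sum_adjoint_mul hf, Finset.sum_mul, Matrix.trace_sum, applyKraus, Matrix.trace_sum]
  exact Finset.sum_congr rfl fun i _ => trace_conj (pad f (K i)) ρ

/-! ### Positive operators -/

theorem trace_re_nonneg {ι : Type} [Fintype ι] [DecidableEq ι] {ρ : QMat ι} (h : ρ.PosSemidef) :
    0 ≤ ρ.trace.re := (Complex.le_def.mp h.trace_nonneg).1

theorem trace_eq_re {ι : Type} [Fintype ι] [DecidableEq ι] {ρ : QMat ι} (h : ρ.PosSemidef) :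
    ((ρ.trace.re : ℝ) : ℂ) = ρ.trace :=
  Complex.ext rfl (by simpa using (Complex.le_def.mp h.trace_nonneg).2)

theorem eq_zero_of_trace_re_le {ι : Type} [Fintype ι] [DecidableEq ι] {ρ : QMat ι}
    (h : ρ.PosSemidef) (h0 : ρ.trace.re ≤ 0) : ρ = 0 := by
  refine h.trace_eq_zero_iff.mp ?_
  rw [← trace_eq_re h, le_antisymm h0 (trace_re_nonneg h), Complex.ofReal_zero]

theorem eq_zero_of_sum_eq_zero {ι α : Type} [Fintype ι] [DecidableEq ι] {s : Finset α}
    {ρ : α → QMat ι} (h : ∀ a ∈ s, (ρ a).PosSemidef) (h0 : ∑ a ∈ s, ρ a = 0) {a : α}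
    (ha : a ∈ s) : ρ a = 0 := by
  refine eq_zero_of_trace_re_le (h a ha) ?_
  have h1 : ∑ a ∈ s, (ρ a).trace.re = 0 := by
    rw [← Complex.re_sum, ← Matrix.trace_sum, h0]
    simp
  rw [(Finset.sum_eq_zero_iff_of_nonneg fun a ha => trace_re_nonneg (h a ha)).mp h1 a ha]

/-- Positive weights cannot cancel, so supports only grow when quantum distributions are added. -/
theorem eq_zero_of_add_eq_zero {ι : Type} [Fintype ι] [DecidableEq ι] {ρ σ : QMat ι}
    (hρ : ρ.PosSemidef) (hσ : σ.PosSemidef) (h0 : ρ + σ = 0) : ρ = 0 := by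
  refine eq_zero_of_trace_re_le hρ ?_
  have h1 := congrArg (fun x => (Matrix.trace x).re) h0
  simp only [Matrix.trace_add, Complex.add_re, Matrix.trace_zero, Complex.zero_re] at h1
  linarith [trace_re_nonneg hσ]

/-- No condition on the trace is needed: a positive operator of trace zero vanishes. This identifies
a normalized measurement branch, weighted by its probability, with the unnormalized one. -/
theorem prob_smul_normalize {ι : Type} [Fintype ι] [DecidableEq ι] {ρ : QMat ι}
    (h : ρ.PosSemidef) : prob ρ • (ρ.trace⁻¹ • ρ) = ρ := by
  by_cases h0 : ρ.trace = 0
  · rw [h.trace_eq_zero_iff.mp h0]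
    simp
  · have : prob ρ • (ρ.trace⁻¹ • ρ) = ((ρ.trace.re : ℝ) : ℂ) • (ρ.trace⁻¹ • ρ) := by
      ext i j
      simp [prob, NNReal.smul_def, max_eq_left (trace_re_nonneg h)]
    rw [this, trace_eq_re h, smul_smul, mul_inv_cancel₀ h0, one_smul]

theorem isDensity_normalize {ι : Type} [Fintype ι] [DecidableEq ι] {ρ : QMat ι}
    (h : ρ.PosSemidef) (h0 : prob ρ ≠ 0) : IsDensity (ρ.trace⁻¹ • ρ) := by
  have h1 : ρ.trace ≠ 0 := by
    intro h1
    exact h0 (by simp [prob, h1])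
  refine ⟨h.smul ?_, by simp [h1]⟩
  rw [← trace_eq_re h, ← Complex.ofReal_inv]
  exact_mod_cast inv_nonneg.mpr (trace_re_nonneg h)

theorem prob_eq_zero_iff {ι : Type} [Fintype ι] [DecidableEq ι] {ρ : QMat ι}
    (h : ρ.PosSemidef) : prob ρ = 0 ↔ ρ = 0 := by
  constructor
  · intro h0
    exact eq_zero_of_trace_re_le h (Real.toNNReal_eq_zero.mp h0)
  · rintro rfl
    simp [prob]

theorem exists_isDensity (ι : Type) [Fintype ι] [DecidableEq ι] : ∃ ρ : QMat ι, IsDensity ρ := by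
  have h1 : (1 : QMat ι).PosSemidef := Matrix.PosSemidef.one
  refine ⟨_, isDensity_normalize h1 ?_⟩
  rw [Ne, prob_eq_zero_iff h1]
  exact one_ne_zero

theorem IsDensity.ne_zero {ι : Type} [Fintype ι] [DecidableEq ι] {ρ : QMat ι} (h : IsDensity ρ) :
    ρ ≠ 0 := by
  rintro rfl
  simpa using h.2

/-- Each operator of a complete family is by itself a trace non-increasing superoperator; the
branches of a move can thus be treated one at a time. -/
theorem posSemidef_one_sub_of_sum_eq_one {ι α : Type} [Fintype ι] [DecidableEq ι] [Fintype α]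
    [DecidableEq α] (K : α → QMat ι) (h : ∑ a, (K a)ᴴ * K a = 1) (a : α) :
    (1 - (K a)ᴴ * K a).PosSemidef := by
  rw [← h, ← Finset.add_sum_erase _ _ (Finset.mem_univ a), add_sub_cancel_left]
  exact Matrix.posSemidef_sum _ fun b _ => Matrix.posSemidef_conjTranspose_mul_self _

/-- The projector on a nonzero vector. -/
theorem exists_projector {ι : Type} [Fintype ι] [DecidableEq ι] (v : Idx ι → ℂ) (hv : v ≠ 0) :
    ∃ (K : QMat ι) (c : ℂ), c ≠ 0 ∧ Kᴴ * K = K ∧ (1 - Kᴴ * K).PosSemidef ∧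
      ∀ X : QMat ι, (K * X).trace = c * (star v ⬝ᵥ X *ᵥ v) := by
  have hd : star v ⬝ᵥ v ≠ 0 := by
    simpa using hv
  have hstar : star (star v ⬝ᵥ v) = star v ⬝ᵥ v := (Matrix.star_dotProduct v v).symm
  -- The inverse squared norm of `v` makes the rank-one operator idempotent.
  set c := (star v ⬝ᵥ v)⁻¹ with hc
  have hcs : star c = c := by rw [hc, star_inv₀, hstar]
  have hH : (c • Matrix.vecMulVec v (star v))ᴴ = c • Matrix.vecMulVec v (star v) := by
    rw [Matrix.conjTranspose_smul, Matrix.conjTranspose_vecMulVec, star_star, hcs]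
  have hKK : (c • Matrix.vecMulVec v (star v)) * (c • Matrix.vecMulVec v (star v))
      = c • Matrix.vecMulVec v (star v) := by
    rw [Matrix.smul_mul, Matrix.mul_smul, Matrix.vecMulVec_mul_vecMulVec, smul_smul]
    ext i j
    simp only [Matrix.smul_apply, Matrix.vecMulVec_apply, Pi.smul_apply, smul_eq_mul]
    simp [hc]
    field_simp
  refine ⟨c • Matrix.vecMulVec v (star v), c, inv_ne_zero hd, by rw [hH, hKK], ?_, ?_⟩
  · rw [hH, hKK]
    have : (1 - c • Matrix.vecMulVec v (star v) : QMat ι)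
        = (1 - c • Matrix.vecMulVec v (star v))ᴴ * (1 - c • Matrix.vecMulVec v (star v)) := by
      rw [Matrix.conjTranspose_sub, hH, Matrix.conjTranspose_one, sub_mul, mul_sub, mul_sub, hKK]
      simp
    rw [this]
    exact Matrix.posSemidef_conjTranspose_mul_self _
  · intro X
    rw [Matrix.smul_mul, Matrix.trace_smul, Matrix.vecMulVec_mul, Matrix.trace_vecMulVec,
      dotProduct_comm, Matrix.dotProduct_mulVec, smul_eq_mul]

/-- Polarization over `ℂ`: the diagonal values of the form determine the operator. -/
theorem eq_of_quadratic_form_eq {n : Type} [Fintype n] [DecidableEq n] {X Y : Matrix n n ℂ}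
    (h : ∀ v : n → ℂ, star v ⬝ᵥ X *ᵥ v = star v ⬝ᵥ Y *ᵥ v) : X = Y := by
  have h0 : Matrix.toEuclideanLin (X - Y) = 0 := by
    rw [← inner_map_self_eq_zero]
    intro x
    have := h (WithLp.ofLp x)
    rw [← sub_eq_zero, ← dotProduct_sub, ← Matrix.sub_mulVec] at this
    have h2 := congrArg star this
    rw [EuclideanSpace.inner_eq_star_dotProduct]
    rw [star_zero] at h2
    rw [← h2, ← Matrix.star_dotProduct_star, star_star, dotProduct_comm]
    simp [Matrix.toLpLin_apply, Matrix.sub_mulVec]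
  rw [← sub_eq_zero]
  exact (LinearEquiv.map_eq_zero_iff _).mp h0

/-! ### Inversion of the typing judgment -/

theorem Name.toExpr_injective : Function.Injective Name.toExpr := by
  rintro (q | x) (r | y) h <;> simp_all [Name.toExpr]

theorem Typed.nil_inv {G : Finset Name} {es : List Expr} (h : Typed G (.nil es)) :
    ∃ l : List Name, l.Nodup ∧ G = l.toFinset ∧ es = l.map Name.toExpr := by
  cases h with
  | nil hl => exact ⟨_, hl, rfl, rfl⟩

theorem Typed.tau_inv {G : Finset Name} {t : Tag} {P : Proc} (h : Typed G (.tau t P)) :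
    Typed G P := by
  cases h; assumption

theorem Typed.tauPair_inv {G : Finset Name} {t u : Tag} {P : Proc}
    (h : Typed G (.tauPair t u P)) : Typed G P := by
  cases h; assumption

theorem Typed.op_inv {G : Finset Name} {t : Tag} {n : ℕ} {E : TPOp n} {es : Fin n → Expr}
    {P : Proc} (h : Typed G (.op t n E es P)) :
    ∃ a : Fin n → Name, 0 < n ∧ Function.Injective a ∧ (∀ i, a i ∈ G) ∧
      (es = fun i => (a i).toExpr) ∧ Typed G P := by
  cases h with
  | op a h1 h2 h3 h4 => exact ⟨a, h1, h2, h3, rfl, h4⟩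

theorem Typed.meas_inv {G : Finset Name} {t : Tag} {n : ℕ} {M : Meas n} {es : Fin n → Expr}
    {x : Var} {P : Proc} (h : Typed G (.meas t n M es x P)) :
    ∃ a : Fin n → Name, Function.Injective a ∧ (∀ i, a i ∈ G) ∧
      (es = fun i => (a i).toExpr) ∧ x.ty = .nat ∧ Typed G P := by
  cases h with
  | meas a h1 h2 h3 h4 => exact ⟨a, h1, h2, rfl, h3, h4⟩

theorem Typed.recv_inv {G : Finset Name} {t : Tag} {c : Chan} {x : Var} {P : Proc}
    (h : Typed G (.recv t c x P)) :
    x.ty = c.ty ∧ ((c.ty ≠ .qubit ∧ Typed G P) ∨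
      (c.ty = .qubit ∧ Name.var x ∉ G ∧ Typed (insert (Name.var x) G) P)) := by
  cases h with
  | crecv h1 h2 h3 => exact ⟨h2, Or.inl ⟨h1, h3⟩⟩
  | qrecv h1 h2 h3 h4 => exact ⟨h2.trans h1.symm, Or.inr ⟨h1, h3, h4⟩⟩

theorem Typed.send_inv {G : Finset Name} {t : Tag} {c : Chan} {e : Expr} {P : Proc}
    (h : Typed G (.send t c e P)) :
    (c.ty ≠ .qubit ∧ e.HasTy c.ty ∧ Typed G P) ∨
      (c.ty = .qubit ∧ ∃ a ∈ G, e = a.toExpr ∧ Typed (G.erase a) P) := by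
  cases h with
  | csend h1 h2 h3 => exact Or.inl ⟨h1, h2, h3⟩
  | qsend h1 h2 h3 => exact Or.inr ⟨h1, _, h2, rfl, h3⟩

theorem Typed.ite_inv {G : Finset Name} {e : Expr} {P Q : Proc} (h : Typed G (.ite e P Q)) :
    e.HasTy .bool ∧ Typed G P ∧ Typed G Q := by
  cases h; exact ⟨by assumption, by assumption, by assumption⟩

theorem Typed.sum_inv {G : Finset Name} {P Q : Proc} (h : Typed G (.sum P Q)) :
    Typed G P ∧ Typed G Q := by
  cases h; exact ⟨by assumption, by assumption⟩

theorem Typed.par_inv {G : Finset Name} {P Q : Proc} (h : Typed G (.par P Q)) :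
    ∃ G₁ G₂, Disjoint G₁ G₂ ∧ G = G₁ ∪ G₂ ∧ Typed G₁ P ∧ Typed G₂ Q := by
  cases h with
  | par h1 h2 h3 => exact ⟨_, _, h1, rfl, h2, h3⟩

theorem Typed.res_inv {G : Finset Name} {P : Proc} {c : Chan} (h : Typed G (.res P c)) :
    Typed G P := by
  cases h; assumption

/-- Uniqueness allows `Owns`, which quantifies over contexts, to be decided by any one typing. Under
a quantum input the context of the continuation is unique by induction, and the bound variable can
be erased from it because it was fresh. -/
theorem Typed.unique {G H : Finset Name} {P : Proc} (h : Typed G P) (h' : Typed H P) : G = H := by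
  induction h generalizing H with
  | nil hl =>
    obtain ⟨l', _, rfl, e⟩ := h'.nil_inv
    rw [List.map_injective_iff.mpr Name.toExpr_injective e]
  | tau _ ih => exact ih h'.tau_inv
  | tauPair _ ih => exact ih h'.tauPair_inv
  | op a _ _ _ _ ih =>
    obtain ⟨_, _, _, _, _, h⟩ := h'.op_inv
    exact ih h
  | meas a _ _ _ _ ih =>
    obtain ⟨_, _, _, _, _, h⟩ := h'.meas_inv
    exact ih h
  | crecv h1 _ _ ih =>
    rcases h'.recv_inv.2 with ⟨_, h⟩ | ⟨h, _⟩
    · exact ih h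
    · exact absurd h h1
  | qrecv h1 _ h2 _ ih =>
    rcases h'.recv_inv.2 with ⟨h, _⟩ | ⟨_, h3, h⟩
    · exact absurd h1 h
    · rw [← Finset.erase_insert h2, ih h, Finset.erase_insert h3]
  | csend h1 _ _ ih =>
    rcases h'.send_inv with ⟨_, _, h⟩ | ⟨h, _⟩
    · exact ih h
    · exact absurd h h1
  | qsend h1 h2 _ ih =>
    rcases h'.send_inv with ⟨h, _⟩ | ⟨_, b, h3, e, h⟩
    · exact absurd h1 h
    · obtain rfl := Name.toExpr_injective e
      rw [← Finset.insert_erase h2, ih h, Finset.insert_erase h3]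
  | ite _ _ _ ih _ => exact ih h'.ite_inv.2.1
  | sum _ _ ih _ => exact ih h'.sum_inv.1
  | par _ _ _ ih1 ih2 =>
    obtain ⟨G₁, G₂, _, rfl, h1, h2⟩ := h'.par_inv
    rw [ih1 h1, ih2 h2]
  | res _ ih => exact ih h'.res_inv

theorem mem_ctxOf {T : Finset Qubit} {q : Qubit} : Name.qubit q ∈ ctxOf T ↔ q ∈ T := by
  simp [ctxOf]

theorem exists_of_mem_ctxOf {T : Finset Qubit} {a : Name} (h : a ∈ ctxOf T) :
    ∃ q ∈ T, a = .qubit q := by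
  obtain ⟨q, hq, rfl⟩ := Finset.mem_image.mp h
  exact ⟨q, hq, rfl⟩

theorem var_notMem_ctxOf {T : Finset Qubit} {x : Var} : Name.var x ∉ ctxOf T := by
  simp [ctxOf]

theorem qubit_injective : Function.Injective Name.qubit := fun _ _ h => Name.qubit.inj h

theorem ctxOf_injective : Function.Injective ctxOf := Finset.image_injective qubit_injective

theorem ctxOf_union (T U : Finset Qubit) : ctxOf (T ∪ U) = ctxOf T ∪ ctxOf U :=
  Finset.image_union _ _

theorem ctxOf_insert (q : Qubit) (T : Finset Qubit) :
    ctxOf (insert q T) = insert (.qubit q) (ctxOf T) :=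
  Finset.image_insert _ _ _

theorem ctxOf_erase (T : Finset Qubit) (q : Qubit) :
    ctxOf (T.erase q) = (ctxOf T).erase (.qubit q) :=
  Finset.image_erase qubit_injective _ _

theorem disjoint_ctxOf {T U : Finset Qubit} : Disjoint (ctxOf T) (ctxOf U) ↔ Disjoint T U :=
  Finset.disjoint_image qubit_injective

theorem Typed.owns_iff {G : Finset Name} {P : Proc} (h : Typed G P) (q : Qubit) :
    Owns P q ↔ Name.qubit q ∈ G :=
  ⟨fun ⟨_, h', hq⟩ => h.unique h' ▸ hq, fun hq => ⟨G, h, hq⟩⟩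

theorem Typed.owns_ctxOf_iff {T : Finset Qubit} {P : Proc} (h : Typed (ctxOf T) P) (q : Qubit) :
    Owns P q ↔ q ∈ T :=
  (h.owns_iff q).trans mem_ctxOf

/-- The two components of a parallel composition split the register of the process. -/
theorem Typed.par_ctxOf_inv {T : Finset Qubit} {P Q : Proc} (h : Typed (ctxOf T) (.par P Q)) :
    ∃ T₁ T₂, Disjoint T₁ T₂ ∧ T = T₁ ∪ T₂ ∧ Typed (ctxOf T₁) P ∧ Typed (ctxOf T₂) Q := by
  obtain ⟨G₁, G₂, hd, e, h1, h2⟩ := h.par_inv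
  have hG : ∀ G ⊆ ctxOf T, ∃ T', ctxOf T' = G := by
    intro G hG
    obtain ⟨T', _, e⟩ := Finset.subset_image_iff.mp hG
    exact ⟨T', e⟩
  obtain ⟨T₁, rfl⟩ := hG G₁ (e ▸ Finset.subset_union_left)
  obtain ⟨T₂, rfl⟩ := hG G₂ (e ▸ Finset.subset_union_right)
  exact ⟨T₁, T₂, disjoint_ctxOf.mp hd, ctxOf_injective (by rw [e, ctxOf_union]), h1, h2⟩

/-! ### Substitution -/

theorem Expr.HasTy.subst {e : Expr} {A : Ty} (h : e.HasTy A) {x : Var} {v : Val}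
    (hv : v.ty = x.ty) : (e.subst x v).HasTy A := by
  induction h with
  | var y =>
    unfold Expr.subst
    split_ifs with hy
    · subst hy
      exact hv ▸ .val v
    · exact .var y
  | val w => exact .val w
  | not _ ih => exact .not ih
  | or _ _ ih1 ih2 => exact .or ih1 ih2
  | le _ _ ih1 ih2 => exact .le ih1 ih2
  | eq _ _ ih1 ih2 => exact .eq ih1 ih2

theorem Expr.subst_of_notMem {e : Expr} {x : Var} {v : Val} (h : x ∉ e.fv) : e.subst x v = e := by
  induction e with
  | var y =>
    have : y ≠ x := fun h' => h (by simp [Expr.fv, h'])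
    simp [Expr.subst, this]
  | val w => rfl
  | not e ih => simp_all [Expr.subst, Expr.fv]
  | or e f ih1 ih2 => simp_all [Expr.subst, Expr.fv]
  | le e f ih1 ih2 => simp_all [Expr.subst, Expr.fv]
  | eq e f ih1 ih2 => simp_all [Expr.subst, Expr.fv]

theorem Expr.fv_subst (e : Expr) (x : Var) (v : Val) : (e.subst x v).fv ⊆ e.fv \ {x} := by
  induction e with
  | var y =>
    unfold Expr.subst
    split_ifs with h
    · simp [Expr.fv]
    · simp [Expr.fv, Ne.symm h]
  | val w => simp [Expr.subst, Expr.fv]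
  | not e ih => exact ih
  | or e f ih1 ih2 =>
    simp only [Expr.subst, Expr.fv, Set.union_sdiff_distrib]
    exact Set.union_subset_union ih1 ih2
  | le e f ih1 ih2 =>
    simp only [Expr.subst, Expr.fv, Set.union_sdiff_distrib]
    exact Set.union_subset_union ih1 ih2
  | eq e f ih1 ih2 =>
    simp only [Expr.subst, Expr.fv, Set.union_sdiff_distrib]
    exact Set.union_subset_union ih1 ih2

theorem Proc.tags_subst (P : Proc) (x : Var) (v : Val) : (P.subst x v).tags = P.tags := by
  induction P with
  | recv t c y P ih => simp only [Proc.subst, Proc.tags]; split_ifs <;> simp [ih]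
  | meas t n M es y P ih => simp only [Proc.subst, Proc.tags]; split_ifs <;> simp [ih]
  | _ => simp_all [Proc.subst, Proc.tags]

theorem Proc.subst_of_notMem {P : Proc} {x : Var} {v : Val} (h : x ∉ P.fv) : P.subst x v = P := by
  induction P with
  | nil es =>
    simp only [Proc.fv, Set.mem_ofPred_eq, not_exists, not_and] at h
    simp only [Proc.subst, Proc.nil.injEq]
    conv_rhs => rw [← List.map_id es]
    exact List.map_congr_left fun e he => Expr.subst_of_notMem (h e he)
  | tau t P ih => simp only [Proc.subst]; rw [ih h]
  | tauPair t u P ih => simp only [Proc.subst]; rw [ih h]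
  | recv t c y P ih =>
    simp only [Proc.subst]
    split_ifs with hy
    · rfl
    · rw [ih fun h' => h ⟨h', by simpa using Ne.symm hy⟩]
  | send t c e P ih =>
    simp only [Proc.fv, Set.mem_union, not_or] at h
    simp only [Proc.subst]
    rw [ih h.2, Expr.subst_of_notMem h.1]
  | op t n E es P ih =>
    simp only [Proc.fv, Set.mem_union, not_or, Set.mem_iUnion, not_exists] at h
    simp only [Proc.subst]
    rw [ih h.2]
    simp only [Expr.subst_of_notMem (h.1 _)]
  | meas t n M es y P ih =>
    simp only [Proc.fv, Set.mem_union, not_or, Set.mem_iUnion, not_exists] at h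
    simp only [Proc.subst, Expr.subst_of_notMem (h.1 _)]
    split_ifs with hy
    · rfl
    · rw [ih fun h' => h.2 ⟨h', by simpa using Ne.symm hy⟩]
  | ite e P Q ih1 ih2 =>
    simp only [Proc.fv, Set.mem_union, not_or] at h
    simp only [Proc.subst]
    rw [Expr.subst_of_notMem h.1, ih1 h.2.1, ih2 h.2.2]
  | sum P Q ih1 ih2 =>
    simp only [Proc.fv, Set.mem_union, not_or] at h
    simp only [Proc.subst]
    rw [ih1 h.1, ih2 h.2]
  | par P Q ih1 ih2 =>
    simp only [Proc.fv, Set.mem_union, not_or] at h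
    simp only [Proc.subst]
    rw [ih1 h.1, ih2 h.2]
  | res P c ih => simp only [Proc.subst]; rw [ih h]

theorem Proc.fv_subst (P : Proc) (x : Var) (v : Val) : (P.subst x v).fv ⊆ P.fv \ {x} := by
  have he := fun e => Expr.fv_subst e x v
  simp only [Set.subset_def, Set.mem_sdiff, Set.mem_singleton_iff] at he ⊢
  induction P with
  | nil es =>
    simp only [Proc.subst, Proc.fv, Set.mem_ofPred_eq, List.mem_map]
    rintro y ⟨_, ⟨e, h, rfl⟩, hy⟩
    exact ⟨⟨e, h, (he e y hy).1⟩, (he e y hy).2⟩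
  | tau t P ih => exact ih
  | tauPair t u P ih => exact ih
  | recv t c z P ih =>
    simp only [Proc.subst, Proc.fv, Set.mem_sdiff, Set.mem_singleton_iff]
    rintro y ⟨h, hz⟩
    split_ifs at h with hy
    · exact ⟨⟨h, hz⟩, hy ▸ hz⟩
    · exact ⟨⟨(ih y h).1, hz⟩, (ih y h).2⟩
  | send t c e P ih =>
    simp only [Proc.subst, Proc.fv, Set.mem_union]
    rintro y (h | h)
    · exact ⟨Or.inl (he e y h).1, (he e y h).2⟩
    · exact ⟨Or.inr (ih y h).1, (ih y h).2⟩
  | op t n E es P ih =>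
    simp only [Proc.subst, Proc.fv, Set.mem_union, Set.mem_iUnion]
    rintro y (⟨i, h⟩ | h)
    · exact ⟨Or.inl ⟨i, (he _ y h).1⟩, (he _ y h).2⟩
    · exact ⟨Or.inr (ih y h).1, (ih y h).2⟩
  | meas t n M es z P ih =>
    simp only [Proc.subst, Proc.fv, Set.mem_union, Set.mem_iUnion, Set.mem_sdiff,
      Set.mem_singleton_iff]
    rintro y (⟨i, h⟩ | ⟨h, hz⟩)
    · exact ⟨Or.inl ⟨i, (he _ y h).1⟩, (he _ y h).2⟩
    · split_ifs at h with hy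
      · exact ⟨Or.inr ⟨h, hz⟩, hy ▸ hz⟩
      · exact ⟨Or.inr ⟨(ih y h).1, hz⟩, (ih y h).2⟩
  | ite e P Q ih1 ih2 =>
    simp only [Proc.subst, Proc.fv, Set.mem_union]
    rintro y (h | h | h)
    · exact ⟨Or.inl (he e y h).1, (he e y h).2⟩
    · exact ⟨Or.inr (Or.inl (ih1 y h).1), (ih1 y h).2⟩
    · exact ⟨Or.inr (Or.inr (ih2 y h).1), (ih2 y h).2⟩
  | sum P Q ih1 ih2 =>
    simp only [Proc.subst, Proc.fv, Set.mem_union]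
    rintro y (h | h)
    · exact ⟨Or.inl (ih1 y h).1, (ih1 y h).2⟩
    · exact ⟨Or.inr (ih2 y h).1, (ih2 y h).2⟩
  | par P Q ih1 ih2 =>
    simp only [Proc.subst, Proc.fv, Set.mem_union]
    rintro y (h | h)
    · exact ⟨Or.inl (ih1 y h).1, (ih1 y h).2⟩
    · exact ⟨Or.inr (ih2 y h).1, (ih2 y h).2⟩
  | res P c ih => exact ih

theorem Name.toExpr_subst_of_ne {x : Var} {v : Val} {a : Name} (h : a ≠ .var x) :
    a.toExpr.subst x v = a.toExpr := by
  cases a with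
  | qubit q => rfl
  | var y =>
    have : y ≠ x := fun h' => h (by rw [h'])
    simp [Name.toExpr, Expr.subst, this]

/-- A variable outside the linear context never occupies a qubit position, so the substitution
touches only classical expressions, whose types it respects. -/
theorem Typed.subst_of_notMem {G : Finset Name} {P : Proc} (h : Typed G P) {x : Var} {v : Val}
    (hv : v.ty = x.ty) (hx : Name.var x ∉ G) : Typed G (P.subst x v) := by
  have key : ∀ {G : Finset Name} {a : Name}, Name.var x ∉ G → a ∈ G →
      a.toExpr.subst x v = a.toExpr := fun hx ha =>
    Name.toExpr_subst_of_ne fun h => hx (h ▸ ha)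
  induction h with
  | @nil l hl =>
    simp only [Proc.subst, List.map_map]
    have e : l.map (Expr.subst x v ∘ Name.toExpr) = l.map Name.toExpr :=
      List.map_congr_left fun a ha => key hx (List.mem_toFinset.mpr ha)
    rw [e]
    exact .nil hl
  | tau _ ih => exact .tau (ih hx)
  | tauPair _ ih => exact .tauPair (ih hx)
  | op a h1 h2 h3 _ ih =>
    simp only [Proc.subst, key hx (h3 _)]
    exact .op a h1 h2 h3 (ih hx)
  | meas a h1 h2 h3 h4 ih =>
    simp only [Proc.subst, key hx (h2 _)]
    refine .meas a h1 h2 h3 ?_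
    split_ifs
    · exact h4
    · exact ih hx
  | crecv h1 h2 h3 ih =>
    refine .crecv h1 h2 ?_
    split_ifs
    · exact h3
    · exact ih hx
  | @qrecv G t c y P h1 h2 h3 h4 ih =>
    refine .qrecv h1 h2 h3 ?_
    split_ifs with hy
    · exact h4
    · refine ih ?_
      simp only [Finset.mem_insert, Name.var.injEq, not_or]
      exact ⟨Ne.symm hy, hx⟩
  | csend h1 h2 _ ih => exact .csend h1 (h2.subst hv) (ih hx)
  | qsend h1 h2 _ ih =>
    simp only [Proc.subst, key hx h2]
    exact .qsend h1 h2 (ih fun h => hx (Finset.mem_of_mem_erase h))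
  | ite h1 _ _ ih1 ih2 => exact .ite (h1.subst hv) (ih1 hx) (ih2 hx)
  | sum _ _ ih1 ih2 => exact .sum (ih1 hx) (ih2 hx)
  | par hd _ _ ih1 ih2 =>
    simp only [Finset.mem_union, not_or] at hx
    exact .par hd (ih1 hx.1) (ih2 hx.2)
  | res _ ih => exact .res (ih hx)

/-- The exchange of a variable and a qubit name. -/
def nameSwap (x : Var) (q : Qubit) : Equiv.Perm Name := Equiv.swap (.var x) (.qubit q)

theorem nameSwap_var (x : Var) (q : Qubit) : nameSwap x q (.var x) = .qubit q :=
  Equiv.swap_apply_left _ _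

theorem nameSwap_qubit (x : Var) (q : Qubit) : nameSwap x q (.qubit q) = .var x :=
  Equiv.swap_apply_right _ _

theorem nameSwap_of_ne {x : Var} {q : Qubit} {a : Name} (h : a ≠ .var x) (h' : a ≠ .qubit q) :
    nameSwap x q a = a :=
  Equiv.swap_apply_of_ne_of_ne h h'

theorem image_nameSwap_of_notMem {x : Var} {q : Qubit} {G : Finset Name} (h : Name.var x ∉ G)
    (h' : Name.qubit q ∉ G) : G.image (nameSwap x q) = G := by
  conv_rhs => rw [← Finset.image_id (s := G)]
  exact Finset.image_congr fun a ha =>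
    nameSwap_of_ne (fun e => h (e ▸ ha)) fun e => h' (e ▸ ha)

theorem toFinset_map_nameSwap (x : Var) (q : Qubit) (l : List Name) :
    (l.map (nameSwap x q)).toFinset = l.toFinset.image (nameSwap x q) := by
  ext a; simp

/-- On a context without `q` the substitution acts as the exchange of `x` and `q`. Being a
permutation, the exchange preserves distinctness, disjointness and erasure. The context may lack
`x`, as it does in one component of a parallel composition. -/
theorem Typed.subst_qubit {G : Finset Name} {P : Proc} (h : Typed G P) {x : Var} {q : Qubit}
    (hx : x.ty = .qubit) (hq : Name.qubit q ∉ G) :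
    Typed (G.image (nameSwap x q)) (P.subst x (.qubit q)) := by
  have hinj := (nameSwap x q).injective
  have key : ∀ {G : Finset Name} {a : Name}, Name.qubit q ∉ G → a ∈ G →
      a.toExpr.subst x (.qubit q) = (nameSwap x q a).toExpr := by
    intro G a hq ha
    by_cases h : a = .var x
    · subst h
      simp [nameSwap_var, Name.toExpr, Expr.subst]
    · rw [nameSwap_of_ne h fun e => hq (e ▸ ha), Name.toExpr_subst_of_ne h]
  induction h with
  | @nil l hl =>
    simp only [Proc.subst, List.map_map]
    have e : l.map (Expr.subst x (.qubit q) ∘ Name.toExpr)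
        = (l.map (nameSwap x q)).map Name.toExpr := by
      rw [List.map_map]
      exact List.map_congr_left fun a ha => key hq (List.mem_toFinset.mpr ha)
    rw [e, ← toFinset_map_nameSwap]
    exact .nil (hl.map hinj)
  | tau _ ih => exact .tau (ih hq)
  | tauPair _ ih => exact .tauPair (ih hq)
  | op a h1 h2 h3 _ ih =>
    simp only [Proc.subst, key hq (h3 _)]
    exact .op _ h1 (hinj.comp h2) (fun i => Finset.mem_image_of_mem _ (h3 i)) (ih hq)
  | @meas G t n M y P a h1 h2 h3 h4 ih =>
    simp only [Proc.subst, key hq (h2 _)]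
    have hy : y ≠ x := by
      rintro rfl
      rw [hx] at h3
      exact absurd h3 (by decide)
    rw [if_neg hy]
    exact .meas _ (hinj.comp h1) (fun i => Finset.mem_image_of_mem _ (h2 i)) h3 (ih hq)
  | @crecv G t c y P h1 h2 h3 ih =>
    have hy : y ≠ x := by
      rintro rfl
      exact h1 (h2 ▸ hx)
    simp only [Proc.subst, if_neg hy]
    exact .crecv h1 h2 (ih hq)
  | @qrecv G t c y P h1 h2 h3 h4 ih =>
    simp only [Proc.subst]
    split_ifs with hy
    · subst hy
      rw [image_nameSwap_of_notMem h3 hq]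
      exact .qrecv h1 h2 h3 h4
    · have e : nameSwap x q (.var y) = .var y := nameSwap_of_ne (by simpa using hy) (by simp)
      refine .qrecv h1 h2 ?_ ?_
      · rw [← e, Finset.mem_image]
        rintro ⟨a, ha, he⟩
        exact h3 (hinj he ▸ ha)
      · have := ih (by simpa using hq)
        rwa [Finset.image_insert, e] at this
  | csend h1 h2 _ ih => exact .csend h1 (h2.subst hx.symm) (ih hq)
  | qsend h1 h2 _ ih =>
    simp only [Proc.subst, key hq h2]
    refine .qsend h1 (Finset.mem_image_of_mem _ h2) ?_
    rw [← Finset.image_erase hinj]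
    exact ih fun h => hq (Finset.mem_of_mem_erase h)
  | ite h1 _ _ ih1 ih2 => exact .ite (h1.subst hx.symm) (ih1 hq) (ih2 hq)
  | sum _ _ ih1 ih2 => exact .sum (ih1 hq) (ih2 hq)
  | par hd _ _ ih1 ih2 =>
    simp only [Finset.mem_union, not_or] at hq
    rw [Finset.image_union]
    exact .par ((Finset.disjoint_image hinj).mpr hd) (ih1 hq.1) (ih2 hq.2)
  | res _ ih => exact .res (ih hq)

/-- Substitution of a received value in a well-typed continuation. -/
theorem Typed.recv_subst {T : Finset Qubit} {t : Tag} {c : Chan} {x : Var} {P : Proc}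
    (h : Typed (ctxOf T) (.recv t c x P)) {v : Val} (hv : v.ty = c.ty) (hc : c.ty ≠ .qubit) :
    Typed (ctxOf T) (P.subst x v) := by
  obtain ⟨hx, ⟨_, h⟩ | ⟨h, _⟩⟩ := h.recv_inv
  · exact h.subst_of_notMem (hv.trans hx.symm) var_notMem_ctxOf
  · exact absurd h hc

/-- The continuation owns at most the bound variable in addition, which is not a qubit name; so the
side condition of an input can be read on the prefix. -/
theorem Typed.recv_owns_iff {T : Finset Qubit} {t : Tag} {c : Chan} {x : Var} {P : Proc}
    (h : Typed (ctxOf T) (.recv t c x P)) (q : Qubit) : Owns P q ↔ q ∈ T := by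
  obtain ⟨hx, ⟨_, h⟩ | ⟨_, _, h⟩⟩ := h.recv_inv
  · exact h.owns_ctxOf_iff q
  · rw [h.owns_iff, Finset.mem_insert, mem_ctxOf]
    simp

theorem Typed.recv_subst_qubit {T : Finset Qubit} {t : Tag} {c : Chan} {x : Var} {P : Proc}
    (h : Typed (ctxOf T) (.recv t c x P)) {q : Qubit} (hc : c.ty = .qubit) (hq : q ∉ T) :
    Typed (ctxOf (insert q T)) (P.subst x (.qubit q)) := by
  obtain ⟨hx, ⟨h, _⟩ | ⟨_, _, h⟩⟩ := h.recv_inv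
  · exact absurd hc h
  · have := h.subst_qubit (hx.trans hc) (q := q) (by simpa [mem_ctxOf] using hq)
    rwa [Finset.image_insert, nameSwap_var,
      image_nameSwap_of_notMem var_notMem_ctxOf (mem_ctxOf.not.mpr hq), ← ctxOf_insert] at this

/-! ### Replacing a qubit name by a variable -/

/-- Replace a qubit name by a variable in an expression. -/
def Expr.abs (q : Qubit) (x : Var) : Expr → Expr
  | .var y => .var y
  | .val w => if w = .qubit q then .var x else .val w
  | .not e => .not (e.abs q x)
  | .or e f => .or (e.abs q x) (f.abs q x)
  | .le e f => .le (e.abs q x) (f.abs q x)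
  | .eq e f => .eq (e.abs q x) (f.abs q x)

/-- Replace a qubit name by a variable in a process. -/
def Proc.abs (q : Qubit) (x : Var) : Proc → Proc
  | .nil es => .nil (es.map (Expr.abs q x))
  | .tau t P => .tau t (P.abs q x)
  | .tauPair t u P => .tauPair t u (P.abs q x)
  | .recv t c y P => .recv t c y (P.abs q x)
  | .send t c e P => .send t c (e.abs q x) (P.abs q x)
  | .op t n E es P => .op t n E (fun i => (es i).abs q x) (P.abs q x)
  | .meas t n M es y P => .meas t n M (fun i => (es i).abs q x) y (P.abs q x)
  | .ite e P Q => .ite (e.abs q x) (P.abs q x) (Q.abs q x)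
  | .sum P Q => .sum (P.abs q x) (Q.abs q x)
  | .par P Q => .par (P.abs q x) (Q.abs q x)
  | .res P c => .res (P.abs q x) c

/-- The variable occurs neither free nor bound in the process. -/
def Proc.Avoids (x : Var) : Proc → Prop
  | .nil es => ∀ e ∈ es, x ∉ e.fv
  | .tau _ P => P.Avoids x
  | .tauPair _ _ P => P.Avoids x
  | .recv _ _ y P => y ≠ x ∧ P.Avoids x
  | .send _ _ e P => x ∉ e.fv ∧ P.Avoids x
  | .op _ _ _ es P => (∀ i, x ∉ (es i).fv) ∧ P.Avoids x
  | .meas _ _ _ es y P => (∀ i, x ∉ (es i).fv) ∧ y ≠ x ∧ P.Avoids x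
  | .ite e P Q => x ∉ e.fv ∧ P.Avoids x ∧ Q.Avoids x
  | .sum P Q => P.Avoids x ∧ Q.Avoids x
  | .par P Q => P.Avoids x ∧ Q.Avoids x
  | .res P _ => P.Avoids x

theorem Expr.exists_bound (e : Expr) : ∃ N, ∀ x ∈ e.fv, x.id < N := by
  induction e with
  | var y => exact ⟨y.id + 1, by simp [Expr.fv]⟩
  | val w => exact ⟨0, by simp [Expr.fv]⟩
  | not e ih => exact ih
  | or e f ih1 ih2 | le e f ih1 ih2 | eq e f ih1 ih2 =>
    obtain ⟨N, hN⟩ := ih1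
    obtain ⟨M, hM⟩ := ih2
    refine ⟨max N M, ?_⟩
    rintro x (h | h)
    · exact lt_max_of_lt_left (hN x h)
    · exact lt_max_of_lt_right (hM x h)

/-- A bound on identifiers leaves the type of the fresh variable free. -/
theorem Proc.exists_avoids (P : Proc) : ∃ N, ∀ x : Var, N ≤ x.id → P.Avoids x := by
  have he : ∀ e : Expr, ∃ N, ∀ x : Var, N ≤ x.id → x ∉ e.fv := by
    intro e
    obtain ⟨N, hN⟩ := e.exists_bound
    exact ⟨N, fun x hx h => absurd (hN x h) (not_lt.mpr hx)⟩
  have hfin : ∀ {n : ℕ} (es : Fin n → Expr), ∃ N, ∀ x : Var, N ≤ x.id → ∀ i, x ∉ (es i).fv := by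
    intro n es
    choose N hN using fun i => he (es i)
    exact ⟨Finset.univ.sup N, fun x hx i => hN i x ((Finset.le_sup (Finset.mem_univ i)).trans hx)⟩
  have hne : ∀ y : Var, ∀ x : Var, y.id + 1 ≤ x.id → y ≠ x := by
    rintro y x h rfl
    omega
  induction P with
  | nil es =>
    obtain ⟨N, hN⟩ := hfin fun i => es.get i
    refine ⟨N, fun x hx e h => ?_⟩
    obtain ⟨i, rfl⟩ := List.get_of_mem h
    exact hN x hx i
  | tau t P ih => exact ih
  | tauPair t u P ih => exact ih
  | recv t c y P ih =>
    obtain ⟨N, hN⟩ := ih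
    exact ⟨max N (y.id + 1), fun x hx => ⟨hne y x (le_of_max_le_right hx),
      hN x (le_of_max_le_left hx)⟩⟩
  | send t c e P ih =>
    obtain ⟨N, hN⟩ := ih
    obtain ⟨M, hM⟩ := he e
    exact ⟨max N M, fun x hx => ⟨hM x (le_of_max_le_right hx), hN x (le_of_max_le_left hx)⟩⟩
  | op t n E es P ih =>
    obtain ⟨N, hN⟩ := ih
    obtain ⟨M, hM⟩ := hfin es
    exact ⟨max N M, fun x hx => ⟨hM x (le_of_max_le_right hx), hN x (le_of_max_le_left hx)⟩⟩
  | meas t n E es y P ih =>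
    obtain ⟨N, hN⟩ := ih
    obtain ⟨M, hM⟩ := hfin es
    exact ⟨max (max N (y.id + 1)) M, fun x hx => ⟨hM x (le_of_max_le_right hx),
      hne y x (le_of_max_le_right (le_of_max_le_left hx)),
      hN x (le_of_max_le_left (le_of_max_le_left hx))⟩⟩
  | ite e P Q ih1 ih2 =>
    obtain ⟨N, hN⟩ := ih1
    obtain ⟨N', hN'⟩ := ih2
    obtain ⟨M, hM⟩ := he e
    exact ⟨max (max N N') M, fun x hx => ⟨hM x (le_of_max_le_right hx),
      hN x (le_of_max_le_left (le_of_max_le_left hx)),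
      hN' x (le_of_max_le_right (le_of_max_le_left hx))⟩⟩
  | sum P Q ih1 ih2 =>
    obtain ⟨N, hN⟩ := ih1
    obtain ⟨M, hM⟩ := ih2
    exact ⟨max N M, fun x hx => ⟨hN x (le_of_max_le_left hx), hM x (le_of_max_le_right hx)⟩⟩
  | par P Q ih1 ih2 =>
    obtain ⟨N, hN⟩ := ih1
    obtain ⟨M, hM⟩ := ih2
    exact ⟨max N M, fun x hx => ⟨hN x (le_of_max_le_left hx), hM x (le_of_max_le_right hx)⟩⟩
  | res P c ih => exact ih

theorem Expr.abs_subst {e : Expr} {q : Qubit} {x : Var} (h : x ∉ e.fv) :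
    (e.abs q x).subst x (.qubit q) = e := by
  induction e with
  | var y =>
    have : y ≠ x := fun h' => h (by simp [Expr.fv, h'])
    simp [Expr.abs, Expr.subst, this]
  | val w =>
    simp only [Expr.abs]
    split_ifs with hw
    · simp [Expr.subst, hw]
    · rfl
  | _ => simp_all [Expr.abs, Expr.subst, Expr.fv]

/-- Freshness excludes capture. A test that must become `P` on receiving `q` can thus be written
with `x` in place of `q`. -/
theorem Proc.abs_subst {P : Proc} {q : Qubit} {x : Var} (h : P.Avoids x) :
    (P.abs q x).subst x (.qubit q) = P := by
  induction P with
  | nil es =>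
    simp only [Proc.abs, Proc.subst, List.map_map, Proc.nil.injEq]
    conv_rhs => rw [← List.map_id es]
    exact List.map_congr_left fun e he => Expr.abs_subst (h e he)
  | tau t P ih => simp only [Proc.abs, Proc.subst]; rw [ih h]
  | tauPair t u P ih => simp only [Proc.abs, Proc.subst]; rw [ih h]
  | recv t c y P ih => simp only [Proc.abs, Proc.subst]; rw [ih h.2, if_neg h.1]
  | send t c e P ih => simp only [Proc.abs, Proc.subst]; rw [ih h.2, Expr.abs_subst h.1]
  | op t n E es P ih => simp only [Proc.abs, Proc.subst, Expr.abs_subst (h.1 _)]; rw [ih h.2]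
  | meas t n M es y P ih =>
    simp only [Proc.abs, Proc.subst, Expr.abs_subst (h.1 _)]; rw [ih h.2.2, if_neg h.2.1]
  | ite e P Q ih1 ih2 =>
    simp only [Proc.abs, Proc.subst]; rw [Expr.abs_subst h.1, ih1 h.2.1, ih2 h.2.2]
  | sum P Q ih1 ih2 => simp only [Proc.abs, Proc.subst]; rw [ih1 h.1, ih2 h.2]
  | par P Q ih1 ih2 => simp only [Proc.abs, Proc.subst]; rw [ih1 h.1, ih2 h.2]
  | res P c ih => simp only [Proc.abs, Proc.subst]; rw [ih h]

theorem Proc.tags_abs (P : Proc) (q : Qubit) (x : Var) : (P.abs q x).tags = P.tags := by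
  induction P <;> simp_all [Proc.abs, Proc.tags]

theorem Expr.HasTy.abs {e : Expr} {A : Ty} (h : e.HasTy A) {q : Qubit} {x : Var}
    (hx : x.ty = .qubit) : (e.abs q x).HasTy A := by
  induction h with
  | var y => exact .var y
  | val w =>
    unfold Expr.abs
    split_ifs with hw
    · subst hw
      exact (show (Expr.var x).HasTy .qubit from hx ▸ .var x)
    · exact .val w
  | not _ ih => exact .not ih
  | or _ _ ih1 ih2 => exact .or ih1 ih2
  | le _ _ ih1 ih2 => exact .le ih1 ih2
  | eq _ _ ih1 ih2 => exact .eq ih1 ih2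

theorem Expr.fv_abs (e : Expr) (q : Qubit) (x : Var) : (e.abs q x).fv ⊆ insert x e.fv := by
  induction e with
  | var y => exact Set.subset_insert _ _
  | val w =>
    unfold Expr.abs
    split_ifs <;> simp [Expr.fv]
  | not e ih => exact ih
  | or e f ih1 ih2 | le e f ih1 ih2 | eq e f ih1 ih2 =>
    simp only [Expr.abs, Expr.fv]
    refine Set.union_subset (ih1.trans (Set.insert_subset_insert Set.subset_union_left))
      (ih2.trans (Set.insert_subset_insert Set.subset_union_right))

theorem Proc.fv_abs (P : Proc) (q : Qubit) (x : Var) : (P.abs q x).fv ⊆ insert x P.fv := by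
  have he := fun e => Expr.fv_abs e q x
  simp only [Set.subset_def, Set.mem_insert_iff] at he ⊢
  induction P with
  | nil es =>
    simp only [Proc.abs, Proc.fv, Set.mem_ofPred_eq, List.mem_map]
    rintro y ⟨_, ⟨e, h, rfl⟩, hy⟩
    exact (he e y hy).imp_right fun h' => ⟨e, h, h'⟩
  | tau t P ih => exact ih
  | tauPair t u P ih => exact ih
  | recv t c z P ih =>
    simp only [Proc.abs, Proc.fv, Set.mem_sdiff]
    exact fun y h => (ih y h.1).imp_right fun h' => ⟨h', h.2⟩
  | send t c e P ih =>
    simp only [Proc.abs, Proc.fv, Set.mem_union]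
    rintro y (h | h)
    · exact (he e y h).imp_right Or.inl
    · exact (ih y h).imp_right Or.inr
  | op t n E es P ih =>
    simp only [Proc.abs, Proc.fv, Set.mem_union, Set.mem_iUnion]
    rintro y (⟨i, h⟩ | h)
    · exact (he _ y h).imp_right fun h => Or.inl ⟨i, h⟩
    · exact (ih y h).imp_right Or.inr
  | meas t n M es z P ih =>
    simp only [Proc.abs, Proc.fv, Set.mem_union, Set.mem_iUnion, Set.mem_sdiff]
    rintro y (⟨i, h⟩ | h)
    · exact (he _ y h).imp_right fun h => Or.inl ⟨i, h⟩
    · exact (ih y h.1).imp_right fun h' => Or.inr ⟨h', h.2⟩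
  | ite e P Q ih1 ih2 =>
    simp only [Proc.abs, Proc.fv, Set.mem_union]
    rintro y (h | h | h)
    · exact (he e y h).imp_right Or.inl
    · exact (ih1 y h).imp_right fun h => Or.inr (Or.inl h)
    · exact (ih2 y h).imp_right fun h => Or.inr (Or.inr h)
  | sum P Q ih1 ih2 | par P Q ih1 ih2 =>
    simp only [Proc.abs, Proc.fv, Set.mem_union]
    rintro y (h | h)
    · exact (ih1 y h).imp_right Or.inl
    · exact (ih2 y h).imp_right Or.inr
  | res P c ih => exact ih

/-- The counterpart of `Typed.subst_qubit`: on a context without `x`, abstracting `q` is again the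
exchange of the two names. -/
theorem Typed.abs {G : Finset Name} {P : Proc} (h : Typed G P) {x : Var} {q : Qubit}
    (hx : x.ty = .qubit) (hG : Name.var x ∉ G) (hP : P.Avoids x) :
    Typed (G.image (nameSwap x q)) (P.abs q x) := by
  have hinj := (nameSwap x q).injective
  have key : ∀ {G : Finset Name} {a : Name}, Name.var x ∉ G → a ∈ G →
      a.toExpr.abs q x = (nameSwap x q a).toExpr := by
    intro G a hG ha
    by_cases h : a = .qubit q
    · subst h
      simp [nameSwap_qubit, Name.toExpr, Expr.abs]
    · rw [nameSwap_of_ne (fun e => hG (e ▸ ha)) h]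
      cases a with
      | var y => rfl
      | qubit r =>
        have : r ≠ q := fun e => h (by rw [e])
        simp [Name.toExpr, Expr.abs, this]
  induction h with
  | @nil l hl =>
    simp only [Proc.abs, List.map_map]
    have e : l.map (Expr.abs q x ∘ Name.toExpr) = (l.map (nameSwap x q)).map Name.toExpr := by
      rw [List.map_map]
      exact List.map_congr_left fun a ha => key hG (List.mem_toFinset.mpr ha)
    rw [e, ← toFinset_map_nameSwap]
    exact .nil (hl.map hinj)
  | tau _ ih => exact .tau (ih hG hP)
  | tauPair _ ih => exact .tauPair (ih hG hP)
  | op a h1 h2 h3 _ ih =>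
    simp only [Proc.abs, key hG (h3 _)]
    exact .op _ h1 (hinj.comp h2) (fun i => Finset.mem_image_of_mem _ (h3 i)) (ih hG hP.2)
  | @meas G t n M y P a h1 h2 h3 h4 ih =>
    simp only [Proc.abs, key hG (h2 _)]
    exact .meas _ (hinj.comp h1) (fun i => Finset.mem_image_of_mem _ (h2 i)) h3 (ih hG hP.2.2)
  | @crecv G t c y P h1 h2 h3 ih => exact .crecv h1 h2 (ih hG hP.2)
  | @qrecv G t c y P h1 h2 h3 h4 ih =>
    have e : nameSwap x q (.var y) = .var y := nameSwap_of_ne (by simpa using hP.1) (by simp)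
    refine .qrecv h1 h2 ?_ ?_
    · rw [← e, Finset.mem_image]
      rintro ⟨a, ha, he⟩
      exact h3 (hinj he ▸ ha)
    · have := ih (by simpa using ⟨Ne.symm hP.1, hG⟩) hP.2
      rwa [Finset.image_insert, e] at this
  | csend h1 h2 _ ih => exact .csend h1 (h2.abs hx) (ih hG hP.2)
  | qsend h1 h2 _ ih =>
    simp only [Proc.abs, key hG h2]
    refine .qsend h1 (Finset.mem_image_of_mem _ h2) ?_
    rw [← Finset.image_erase hinj]
    exact ih (fun h => hG (Finset.mem_of_mem_erase h)) hP.2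
  | ite h1 _ _ ih1 ih2 => exact .ite (h1.abs hx) (ih1 hG hP.2.1) (ih2 hG hP.2.2)
  | sum _ _ ih1 ih2 => exact .sum (ih1 hG hP.1) (ih2 hG hP.2)
  | par hd _ _ ih1 ih2 =>
    simp only [Finset.mem_union, not_or] at hG
    rw [Finset.image_union]
    exact .par ((Finset.disjoint_image hinj).mpr hd) (ih1 hG.1 hP.1) (ih2 hG.2 hP.2)
  | res _ ih => exact .res (ih hG hP)

/-- A process that owns `q`, with `q` replaced by a variable. -/
theorem Typed.abs_ctxOf {T : Finset Qubit} {P : Proc} {x : Var} {q : Qubit} (hq : q ∉ T)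
    (h : Typed (ctxOf (insert q T)) P) (hx : x.ty = .qubit) (hP : P.Avoids x) :
    Typed (insert (.var x) (ctxOf T)) (P.abs q x) := by
  have := h.abs hx var_notMem_ctxOf hP (q := q)
  rwa [ctxOf_insert, Finset.image_insert, nameSwap_qubit,
    image_nameSwap_of_notMem var_notMem_ctxOf (mem_ctxOf.not.mpr hq)] at this

/-! ### Transitions of configurations -/

/-- The tags of a scheduler. -/
def Sched.tags : Sched → Finset Tag
  | .one t => {t}
  | .two t u => {t, u}

/-- The action that synchronizes with an input or output. -/
def Act.dual : Act → Act
  | .tau => .tau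
  | .send c v => .recv c v
  | .recv c v => .send c v

theorem Act.dual_dual (α : Act) : α.dual.dual = α := by cases α <;> rfl

theorem Act.dual_injective : Function.Injective Act.dual :=
  Function.LeftInverse.injective Act.dual_dual

/-- The register of a process after an action, given the one before. -/
def Act.after : Act → Finset Qubit → Finset Qubit
  | .send _ (.qubit q), T => T.erase q
  | .recv _ (.qubit q), T => insert q T
  | _, T => T

/-- The actions that processes with register `T` can perform: they only send qubits in `T`, and
only receive qubits in `S \ T`. -/
def Act.Enabled (S T : Finset Qubit) : Act → Prop
  | .tau => True
  | .send c v => v.ty = c.ty ∧ ∀ q, v = .qubit q → q ∈ T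
  | .recv c v => v.ty = c.ty ∧ ∀ q, v = .qubit q → q ∈ S ∧ q ∉ T

theorem Act.Enabled.after_subset {S T : Finset Qubit} {μ : Act} (h : μ.Enabled S T) (hT : T ⊆ S) :
    μ.after T ⊆ S := by
  rcases μ with _ | ⟨c, _ | _ | q⟩ | ⟨c, _ | _ | q⟩
  · exact hT
  · exact hT
  · exact hT
  · exact (Finset.erase_subset _ _).trans hT
  · exact hT
  · exact hT
  · exact Finset.insert_subset (h.2 q rfl).1 hT

theorem Act.after_of_ne {T : Finset Qubit} {μ : Act} (h : ∀ c q, μ ≠ .send c (.qubit q))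
    (h' : ∀ c q, μ ≠ .recv c (.qubit q)) : μ.after T = T := by
  rcases μ with _ | ⟨c, _ | _ | q⟩ | ⟨c, _ | _ | q⟩
  all_goals first
    | rfl
    | exact absurd rfl (h c q)
    | exact absurd rfl (h' c q)

theorem Act.steals_iff {μ : Act} {T : Finset Qubit} {Q : Proc} (h : Typed (ctxOf T) Q) :
    μ.Steals Q ↔ ∃ c q, μ = .recv c (.qubit q) ∧ q ∈ T := by
  simp only [Act.Steals, h.owns_ctxOf_iff]

/-- An idle component keeps its register: a sent qubit lies in `T`, hence not in `U`, and `hU` says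
that a received one is not in `U` either. -/
theorem Act.Enabled.after_union {S T U : Finset Qubit} {μ : Act} (h : μ.Enabled S T)
    (hd : Disjoint T U) (hU : ¬ ∃ c q, μ = .recv c (.qubit q) ∧ q ∈ U) :
    Disjoint (μ.after T) U ∧ μ.after (T ∪ U) = μ.after T ∪ U ∧ μ.Enabled S (T ∪ U) := by
  rcases μ with _ | ⟨c, _ | _ | q⟩ | ⟨c, _ | _ | q⟩
  · exact ⟨hd, rfl, h⟩
  · exact ⟨hd, rfl, h.1, fun _ e => by cases e⟩
  · exact ⟨hd, rfl, h.1, fun _ e => by cases e⟩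
  · have hq := h.2 q rfl
    refine ⟨hd.mono_left (Finset.erase_subset _ _), ?_, h.1, ?_⟩
    · simp only [Act.after, Finset.erase_union_distrib,
        Finset.erase_eq_of_notMem (Finset.disjoint_left.mp hd hq)]
    · rintro r e
      exact Finset.mem_union_left _ (h.2 r e)
  · exact ⟨hd, rfl, h.1, fun _ e => by cases e⟩
  · exact ⟨hd, rfl, h.1, fun _ e => by cases e⟩
  · have hq : q ∉ U := fun hq => hU ⟨c, q, rfl, hq⟩
    refine ⟨Finset.disjoint_insert_left.mpr ⟨hq, hd⟩, by simp only [Act.after]; rw [Finset.insert_union], h.1, ?_⟩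
    rintro r e
    obtain rfl : q = r := by cases e; rfl
    exact ⟨(h.2 q rfl).1, by simp [(h.2 q rfl).2, hq]⟩

/-- A synchronization preserves the joint register. -/
theorem after_synch {S T U : Finset Qubit} {c : Chan} {v : Val}
    (h : (Act.send c v).Enabled S T) (h' : (Act.recv c v).Enabled S U) (hd : Disjoint T U) :
    Disjoint ((Act.send c v).after T) ((Act.recv c v).after U) ∧
      T ∪ U = (Act.send c v).after T ∪ (Act.recv c v).after U := by
  rcases v with _ | _ | q
  · exact ⟨hd, rfl⟩
  · exact ⟨hd, rfl⟩
  · have hq := h.2 q rfl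
    constructor
    · exact Finset.disjoint_insert_right.mpr
        ⟨Finset.notMem_erase _ _, hd.mono_left (Finset.erase_subset _ _)⟩
    · simp only [Act.after]
      rw [Finset.union_insert, ← Finset.insert_union, Finset.insert_erase hq]

theorem Dist.mem_support_mapProc {S : Finset Qubit} {f : Proc → Proc} {Δ : Dist S} {C : Conf S}
    (h : C ∈ (Δ.mapProc f).support) : ∃ D ∈ Δ.support, C = (D.1, f D.2) := by
  classical
  obtain ⟨D, hD, rfl⟩ := Finset.mem_image.mp (Finsupp.mapDomain_support h)
  exact ⟨D, hD, rfl⟩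

theorem mem_support_single {A M : Type} [Zero M] {a b : A} {m : M}
    (h : b ∈ (Finsupp.single a m).support) : b = a :=
  Finset.mem_singleton.mp (Finsupp.support_single_subset h)

theorem mem_support_sum {A M ι : Type} [AddCommMonoid M] {s : Finset ι} {f : ι → A →₀ M} {a : A}
    (h : a ∈ (∑ i ∈ s, f i).support) : ∃ i ∈ s, a ∈ (f i).support := by
  classical
  exact Finset.mem_biUnion.mp (Finsupp.support_finsetSum h)

section CStep

variable {S : Finset Qubit} {ρ : QMat ↥S} {P : Proc} {μ : Act} {s : Sched} {Δ : Dist S}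

theorem CStep.par_inv {P Q : Proc} (h : CStep ρ (.par P Q) μ s Δ) :
    (∃ Δ', CStep ρ P μ s Δ' ∧ ¬ μ.Steals Q ∧ Δ = Δ'.mapProc fun R => .par R Q) ∨
    (∃ Δ', CStep ρ Q μ s Δ' ∧ ¬ μ.Steals P ∧ Δ = Δ'.mapProc fun R => .par P R) ∨
    (∃ t u α P' Q', μ = .tau ∧ s = .two t u ∧ α ≠ .tau ∧
      CStep ρ P α (.one t) (Finsupp.single (ρ, P') 1) ∧
      CStep ρ Q α.dual (.one u) (Finsupp.single (ρ, Q') 1) ∧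
      Δ = Finsupp.single (ρ, .par P' Q') 1) := by
  cases h with
  | parL h h' => exact Or.inl ⟨_, h, h', rfl⟩
  | parR h h' => exact Or.inr (Or.inl ⟨_, h, h', rfl⟩)
  | synchL h h' => exact Or.inr (Or.inr ⟨_, _, _, _, _, rfl, rfl, by simp, h, h', rfl⟩)
  | synchR h h' => exact Or.inr (Or.inr ⟨_, _, _, _, _, rfl, rfl, by simp, h, h', rfl⟩)

/-- Inputs and outputs have a single tag, and do not change the state. -/
theorem CStep.visible (h : CStep ρ P μ s Δ) (hμ : μ ≠ .tau) :
    ∃ t P', s = .one t ∧ Δ = Finsupp.single (ρ, P') 1 := by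
  induction h with
  | tau | tauPair | op | meas | synchL | synchR => exact absurd rfl hμ
  | send _ => exact ⟨_, _, rfl, rfl⟩
  | recv _ => exact ⟨_, _, rfl, rfl⟩
  | iteT _ _ ih => exact ih hμ
  | iteF _ _ ih => exact ih hμ
  | sumL _ ih => exact ih hμ
  | sumR _ ih => exact ih hμ
  | parL _ _ ih =>
    obtain ⟨t, P', rfl, rfl⟩ := ih hμ
    exact ⟨t, _, rfl, by rw [Dist.mapProc, Finsupp.mapDomain_single]⟩
  | parR _ _ ih =>
    obtain ⟨t, P', rfl, rfl⟩ := ih hμ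
    exact ⟨t, _, rfl, by rw [Dist.mapProc, Finsupp.mapDomain_single]⟩
  | res _ _ ih =>
    obtain ⟨t, P', rfl, rfl⟩ := ih hμ
    exact ⟨t, _, rfl, by rw [Dist.mapProc, Finsupp.mapDomain_single]⟩

theorem mem_support_single_one (C : Conf S) : C ∈ (Finsupp.single C (1 : ℝ≥0)).support := by
  simp

/-- Tags are only consumed, so disjointness from the tags of a context persists along transitions.
-/
theorem CStep.tags_subset (h : CStep ρ P μ s Δ) :
    s.tags ⊆ P.tags ∧ ∀ C ∈ Δ.support, C.2.tags ⊆ P.tags := by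
  induction h with
  | tau | op =>
    refine ⟨by simp [Sched.tags, Proc.tags], fun C hC => ?_⟩
    rw [mem_support_single hC]
    exact Finset.subset_insert _ _
  | tauPair =>
    refine ⟨by simp [Sched.tags, Proc.tags, Finset.insert_subset_iff], fun C hC => ?_⟩
    rw [mem_support_single hC]
    exact (Finset.subset_insert _ _).trans (Finset.subset_insert _ _)
  | meas f =>
    refine ⟨by simp [Sched.tags, Proc.tags], fun C hC => ?_⟩
    obtain ⟨m, _, hm⟩ := mem_support_sum hC
    rw [mem_support_single hm, Proc.tags_subst]
    exact Finset.subset_insert _ _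
  | send _ =>
    refine ⟨by simp [Sched.tags, Proc.tags], fun C hC => ?_⟩
    rw [mem_support_single hC]
    exact Finset.subset_insert _ _
  | recv _ =>
    refine ⟨by simp [Sched.tags, Proc.tags], fun C hC => ?_⟩
    rw [mem_support_single hC, Proc.tags_subst]
    exact Finset.subset_insert _ _
  | iteT _ _ ih => exact ⟨ih.1.trans Finset.subset_union_left,
      fun C hC => (ih.2 C hC).trans Finset.subset_union_left⟩
  | iteF _ _ ih => exact ⟨ih.1.trans Finset.subset_union_right,
      fun C hC => (ih.2 C hC).trans Finset.subset_union_right⟩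
  | sumL _ ih => exact ⟨ih.1.trans Finset.subset_union_left,
      fun C hC => (ih.2 C hC).trans Finset.subset_union_left⟩
  | sumR _ ih => exact ⟨ih.1.trans Finset.subset_union_right,
      fun C hC => (ih.2 C hC).trans Finset.subset_union_right⟩
  | parL _ _ ih =>
    refine ⟨ih.1.trans Finset.subset_union_left, fun C hC => ?_⟩
    obtain ⟨D, hD, rfl⟩ := Dist.mem_support_mapProc hC
    exact Finset.union_subset_union_left (ih.2 D hD)
  | parR _ _ ih =>
    refine ⟨ih.1.trans Finset.subset_union_right, fun C hC => ?_⟩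
    obtain ⟨D, hD, rfl⟩ := Dist.mem_support_mapProc hC
    exact Finset.union_subset_union_right (ih.2 D hD)
  | synchL _ _ ih1 ih2 | synchR _ _ ih1 ih2 =>
    refine ⟨?_, fun C hC => ?_⟩
    · exact Finset.union_subset_union ih1.1 ih2.1
    · rw [mem_support_single hC]
      exact Finset.union_subset_union (ih1.2 _ (mem_support_single_one _))
        (ih2.2 _ (mem_support_single_one _))
  | res _ _ ih =>
    refine ⟨ih.1, fun C hC => ?_⟩
    obtain ⟨D, hD, rfl⟩ := Dist.mem_support_mapProc hC
    exact ih.2 D hD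

theorem CStep.closed (h : CStep ρ P μ s Δ) (hP : P.fv = ∅) {C : Conf S} (hC : C ∈ Δ.support) :
    C.2.fv = ∅ := by
  have hsub : ∀ {P : Proc} {x : Var} {v : Val}, P.fv \ {x} = ∅ → (P.subst x v).fv = ∅ :=
    fun h => Set.subset_empty_iff.mp ((Proc.fv_subst _ _ _).trans h.subset)
  induction h generalizing C with
  | tau | tauPair =>
    rw [mem_support_single hC]
    exact hP
  | op f =>
    rw [mem_support_single hC]
    exact (Set.union_empty_iff.mp hP).2
  | meas f =>
    obtain ⟨m, _, hm⟩ := mem_support_sum hC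
    rw [mem_support_single hm]
    exact hsub (Set.union_empty_iff.mp hP).2
  | send _ =>
    rw [mem_support_single hC]
    exact (Set.union_empty_iff.mp hP).2
  | recv _ =>
    rw [mem_support_single hC]
    exact hsub hP
  | iteT _ _ ih => exact ih (Set.union_empty_iff.mp (Set.union_empty_iff.mp hP).2).1 hC
  | iteF _ _ ih => exact ih (Set.union_empty_iff.mp (Set.union_empty_iff.mp hP).2).2 hC
  | sumL _ ih => exact ih (Set.union_empty_iff.mp hP).1 hC
  | sumR _ ih => exact ih (Set.union_empty_iff.mp hP).2 hC
  | parL _ _ ih =>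
    obtain ⟨D, hD, rfl⟩ := Dist.mem_support_mapProc hC
    exact Set.union_empty_iff.mpr
      ⟨ih (Set.union_empty_iff.mp hP).1 hD, (Set.union_empty_iff.mp hP).2⟩
  | parR _ _ ih =>
    obtain ⟨D, hD, rfl⟩ := Dist.mem_support_mapProc hC
    exact Set.union_empty_iff.mpr
      ⟨(Set.union_empty_iff.mp hP).1, ih (Set.union_empty_iff.mp hP).2 hD⟩
  | synchL _ _ ih1 ih2 | synchR _ _ ih1 ih2 =>
    rw [mem_support_single hC]
    exact Set.union_empty_iff.mpr ⟨ih1 (Set.union_empty_iff.mp hP).1 (mem_support_single_one _),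
      ih2 (Set.union_empty_iff.mp hP).2 (mem_support_single_one _)⟩
  | res _ _ ih =>
    obtain ⟨D, hD, rfl⟩ := Dist.mem_support_mapProc hC
    exact (ih hP hD : D.2.fv = ∅)

theorem Expr.HasTy.eval_ty {e : Expr} {A : Ty} (h : e.HasTy A) {v : Val} (hv : e.eval = some v) :
    v.ty = A := by
  cases h with
  | var x => simp [Expr.eval] at hv
  | val w => simp only [Expr.eval, Option.some.injEq] at hv; rw [hv]
  | not h =>
    simp only [Expr.eval] at hv
    split at hv
    · cases hv; rfl
    · cases hv
  | or h h' | le h h' =>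
    simp only [Expr.eval] at hv
    split at hv
    · cases hv; rfl
    · cases hv
  | eq h h' =>
    simp only [Expr.eval] at hv
    split at hv
    · split_ifs at hv
      cases hv; rfl
    · cases hv

/-- Subject reduction. -/
theorem CStep.typed (h : CStep ρ P μ s Δ) {T : Finset Qubit} (hP : Typed (ctxOf T) P) :
    μ.Enabled S T ∧ ∀ C ∈ Δ.support, Typed (ctxOf (μ.after T)) C.2 := by
  induction h generalizing T with
  | tau =>
    refine ⟨trivial, fun C hC => ?_⟩
    rw [mem_support_single hC]
    exact hP.tau_inv
  | tauPair =>
    refine ⟨trivial, fun C hC => ?_⟩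
    rw [mem_support_single hC]
    exact hP.tauPair_inv
  | op f =>
    refine ⟨trivial, fun C hC => ?_⟩
    rw [mem_support_single hC]
    exact hP.op_inv.choose_spec.2.2.2.2
  | meas f =>
    refine ⟨trivial, fun C hC => ?_⟩
    obtain ⟨m, _, hm⟩ := mem_support_sum hC
    rw [mem_support_single hm]
    obtain ⟨_, _, _, _, hx, h⟩ := hP.meas_inv
    exact h.subst_of_notMem hx.symm var_notMem_ctxOf
  | @send t c e v P h =>
    rcases hP.send_inv with ⟨hc, he, hP'⟩ | ⟨hc, a, ha, rfl, hP'⟩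
    · have hv := he.eval_ty h
      refine ⟨⟨hv, ?_⟩, fun C hC => ?_⟩
      · rintro q rfl
        exact absurd hv.symm hc
      · rw [mem_support_single hC, Act.after_of_ne]
        · exact hP'
        · rintro c' q e
          cases e
          exact hc hv.symm
        · rintro c' q e
          cases e
    · obtain ⟨q, hq, rfl⟩ := exists_of_mem_ctxOf ha
      obtain rfl : Val.qubit q = v := by simpa [Name.toExpr, Expr.eval] using h
      refine ⟨⟨hc.symm, ?_⟩, fun C hC => ?_⟩
      · rintro r e
        cases e
        exact hq
      · rw [mem_support_single hC]
        simpa only [Act.after, ctxOf_erase] using hP'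
  | @recv t c x v P h =>
    refine ⟨⟨h.1, fun q hq => ⟨(h.2 q hq).1, fun hq' => (h.2 q hq).2 ?_⟩⟩, fun C hC => ?_⟩
    · exact (hP.recv_owns_iff q).mpr hq'
    · rw [mem_support_single hC]
      by_cases hc : c.ty = .qubit
      · obtain ⟨q, rfl⟩ : ∃ q, v = .qubit q := by
          have := h.1.trans hc
          rcases v with _ | _ | q
          · cases this
          · cases this
          · exact ⟨q, rfl⟩
        exact hP.recv_subst_qubit hc fun hq => (h.2 q rfl).2 ((hP.recv_owns_iff q).mpr hq)
      · rw [Act.after_of_ne]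
        · exact hP.recv_subst h.1 hc
        · rintro c' q e
          cases e
        · rintro c' q e
          cases e
          exact hc h.1.symm
  | iteT _ _ ih => exact ih hP.ite_inv.2.1
  | iteF _ _ ih => exact ih hP.ite_inv.2.2
  | sumL _ ih => exact ih hP.sum_inv.1
  | sumR _ ih => exact ih hP.sum_inv.2
  | @parL P Q μ s Δ _ hs ih =>
    obtain ⟨T₁, T₂, hd, rfl, h1, h2⟩ := hP.par_ctxOf_inv
    obtain ⟨he, h⟩ := ih h1
    rw [Act.steals_iff h2] at hs
    obtain ⟨hd', e, he'⟩ := he.after_union hd hs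
    refine ⟨he', fun C hC => ?_⟩
    obtain ⟨D, hD, rfl⟩ := Dist.mem_support_mapProc hC
    rw [e, ctxOf_union]
    exact .par (disjoint_ctxOf.mpr hd') (h D hD) h2
  | @parR P Q μ s Δ _ hs ih =>
    obtain ⟨T₁, T₂, hd, rfl, h1, h2⟩ := hP.par_ctxOf_inv
    obtain ⟨he, h⟩ := ih h2
    rw [Act.steals_iff h1] at hs
    obtain ⟨hd', e, he'⟩ := he.after_union hd.symm hs
    rw [Finset.union_comm] at e he'
    refine ⟨he', fun C hC => ?_⟩
    obtain ⟨D, hD, rfl⟩ := Dist.mem_support_mapProc hC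
    rw [e, Finset.union_comm, ctxOf_union]
    exact .par (disjoint_ctxOf.mpr hd'.symm) h1 (h D hD)
  | synchL _ _ ih1 ih2 =>
    refine ⟨trivial, fun C hC => ?_⟩
    rw [mem_support_single hC]
    obtain ⟨T₁, T₂, hd, rfl, h1, h2⟩ := hP.par_ctxOf_inv
    obtain ⟨hd', e⟩ := after_synch (ih1 h1).1 (ih2 h2).1 hd
    rw [show Act.after .tau (T₁ ∪ T₂) = T₁ ∪ T₂ from rfl, e, ctxOf_union]
    exact .par (disjoint_ctxOf.mpr hd') ((ih1 h1).2 _ (mem_support_single_one _))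
      ((ih2 h2).2 _ (mem_support_single_one _))
  | synchR _ _ ih1 ih2 =>
    refine ⟨trivial, fun C hC => ?_⟩
    rw [mem_support_single hC]
    obtain ⟨T₁, T₂, hd, rfl, h1, h2⟩ := hP.par_ctxOf_inv
    obtain ⟨hd', e⟩ := after_synch (ih2 h2).1 (ih1 h1).1 hd.symm
    rw [show Act.after .tau (T₁ ∪ T₂) = T₁ ∪ T₂ from rfl, Finset.union_comm, e,
      Finset.union_comm, ctxOf_union]
    exact .par (disjoint_ctxOf.mpr hd'.symm) ((ih1 h1).2 _ (mem_support_single_one _))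
      ((ih2 h2).2 _ (mem_support_single_one _))
  | res _ _ ih =>
    obtain ⟨he, h⟩ := ih hP.res_inv
    refine ⟨he, fun C hC => ?_⟩
    obtain ⟨D, hD, rfl⟩ := Dist.mem_support_mapProc hC
    exact .res (h D hD)

theorem applyKraus_isDensity {n : ℕ} (E : TPOp n) (f : Fin n ↪ ↥S) (hρ : IsDensity ρ) :
    IsDensity (applyKraus f E.kraus ρ) := by
  refine ⟨applyKraus_posSemidef _ _ hρ.1, ?_⟩
  rw [trace_applyKraus f.injective, E.preserving, pad_one, one_mul]
  exact hρ.2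

theorem CStep.isDensity (h : CStep ρ P μ s Δ) (hρ : IsDensity ρ) :
    ∀ C ∈ Δ.support, IsDensity C.1 := by
  have hpar : ∀ {Δ : Dist S} {f : Proc → Proc}, (∀ C ∈ Δ.support, IsDensity C.1) →
      ∀ C ∈ (Δ.mapProc f).support, IsDensity C.1 := by
    intro Δ f h C hC
    obtain ⟨D, hD, rfl⟩ := Dist.mem_support_mapProc hC
    exact h D hD
  induction h with
  | tau | tauPair | send | recv | synchL | synchR =>
    intro C hC
    rw [mem_support_single hC]
    exact hρ
  | op f =>
    intro C hC
    rw [mem_support_single hC]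
    exact applyKraus_isDensity _ f hρ
  | @meas t n M x P f =>
    intro C hC
    obtain ⟨m, _, hm⟩ := mem_support_sum hC
    -- An impossible outcome has weight zero and is absent from the support, so the states that
    -- remain can be normalized.
    have hne : prob (collapse f (M.ops m) ρ) ≠ 0 := by
      intro h0
      rw [h0] at hm
      simp at hm
    rw [mem_support_single hm]
    exact isDensity_normalize (conj_posSemidef _ hρ.1) hne
  | iteT _ _ ih | iteF _ _ ih | sumL _ ih | sumR _ ih => exact ih
  | parL _ _ ih | parR _ _ ih | res _ _ ih => exact hpar ih

end CStep

/-! ### Moves as linear maps -/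

/-- The transitions of quantum distributions on a single process, as linear functions of the
weight. -/
inductive Sh {S : Finset Qubit} : Proc → Act → Sched → (QMat ↥S →ₗ[ℂ] QDist S) → Prop where
  | tau {t : Tag} {P : Proc} : Sh (.tau t P) .tau (.one t) (Finsupp.lsingle P)
  | tauPair {t u : Tag} {P : Proc} : Sh (.tauPair t u P) .tau (.two t u) (Finsupp.lsingle P)
  | op {t : Tag} {n : ℕ} {E : TPOp n} {P : Proc} (f : Fin n ↪ ↥S) :
      Sh (.op t n E (fun i => .val (.qubit (f i))) P) .tau (.one t)
        (Finsupp.lsingle P ∘ₗ krausMap f E.kraus)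
  | meas {t : Tag} {n : ℕ} {M : Meas n} {x : Var} {P : Proc} (f : Fin n ↪ ↥S) :
      Sh (.meas t n M (fun i => .val (.qubit (f i))) x P) .tau (.one t)
        (∑ m : Fin M.outcomes, Finsupp.lsingle (P.subst x (.nat m)) ∘ₗ conj (pad f (M.ops m)))
  | send {t : Tag} {c : Chan} {e : Expr} {v : Val} {P : Proc} :
      e.eval = some v → Sh (.send t c e P) (.send c v) (.one t) (Finsupp.lsingle P)
  | recv {t : Tag} {c : Chan} {x : Var} {v : Val} {P : Proc} :
      CanRecv S c v P →
      Sh (.recv t c x P) (.recv c v) (.one t) (Finsupp.lsingle (P.subst x v))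
  | iteT {e : Expr} {P Q : Proc} {μ : Act} {s : Sched} {F : QMat ↥S →ₗ[ℂ] QDist S} :
      e.eval = some (.bool true) → Sh P μ s F → Sh (.ite e P Q) μ s F
  | iteF {e : Expr} {P Q : Proc} {μ : Act} {s : Sched} {F : QMat ↥S →ₗ[ℂ] QDist S} :
      e.eval = some (.bool false) → Sh Q μ s F → Sh (.ite e P Q) μ s F
  | sumL {P Q : Proc} {μ : Act} {s : Sched} {F : QMat ↥S →ₗ[ℂ] QDist S} :
      Sh P μ s F → Sh (.sum P Q) μ s F
  | sumR {P Q : Proc} {μ : Act} {s : Sched} {F : QMat ↥S →ₗ[ℂ] QDist S} :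
      Sh Q μ s F → Sh (.sum P Q) μ s F
  | parL {P Q : Proc} {μ : Act} {s : Sched} {F : QMat ↥S →ₗ[ℂ] QDist S} :
      Sh P μ s F → ¬ μ.Steals Q →
      Sh (.par P Q) μ s (Finsupp.lmapDomain (QMat ↥S) ℂ (fun R => Proc.par R Q) ∘ₗ F)
  | parR {P Q : Proc} {μ : Act} {s : Sched} {F : QMat ↥S →ₗ[ℂ] QDist S} :
      Sh Q μ s F → ¬ μ.Steals P →
      Sh (.par P Q) μ s (Finsupp.lmapDomain (QMat ↥S) ℂ (fun R => Proc.par P R) ∘ₗ F)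
  | synchL {P P' Q Q' : Proc} {c : Chan} {v : Val} {t u : Tag} :
      Sh P (.send c v) (.one t) (Finsupp.lsingle P') →
      Sh Q (.recv c v) (.one u) (Finsupp.lsingle Q') →
      Sh (.par P Q) .tau (.two t u) (Finsupp.lsingle (.par P' Q'))
  | synchR {P P' Q Q' : Proc} {c : Chan} {v : Val} {t u : Tag} :
      Sh P (.recv c v) (.one t) (Finsupp.lsingle P') →
      Sh Q (.send c v) (.one u) (Finsupp.lsingle Q') →
      Sh (.par P Q) .tau (.two t u) (Finsupp.lsingle (.par P' Q'))
  | res {P : Proc} {c : Chan} {μ : Act} {s : Sched} {F : QMat ↥S →ₗ[ℂ] QDist S} :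
      Sh P μ s F → ¬ μ.On c →
      Sh (.res P c) μ s (Finsupp.lmapDomain (QMat ↥S) ℂ (fun R => Proc.res R c) ∘ₗ F)

section Sh

variable {S : Finset Qubit} {P : Proc} {μ : Act} {s : Sched} {F : QMat ↥S →ₗ[ℂ] QDist S}

theorem lmapDomain_comp_lsingle (f : Proc → Proc) (P : Proc) :
    Finsupp.lmapDomain (QMat ↥S) ℂ f ∘ₗ Finsupp.lsingle P = Finsupp.lsingle (f P) := by
  ext1 ρ
  simp [Finsupp.lmapDomain, Finsupp.mapDomain_single]

theorem Sh.visible (h : Sh P μ s F) (hμ : μ ≠ .tau) :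
    ∃ t P', s = .one t ∧ F = Finsupp.lsingle P' := by
  induction h with
  | tau | tauPair | op | meas | synchL | synchR => exact absurd rfl hμ
  | send _ => exact ⟨_, _, rfl, rfl⟩
  | recv _ => exact ⟨_, _, rfl, rfl⟩
  | iteT _ _ ih => exact ih hμ
  | iteF _ _ ih => exact ih hμ
  | sumL _ ih => exact ih hμ
  | sumR _ ih => exact ih hμ
  | parL _ _ ih | parR _ _ ih | res _ _ ih =>
    obtain ⟨t, P', rfl, rfl⟩ := ih hμ
    exact ⟨t, _, rfl, lmapDomain_comp_lsingle _ _⟩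

theorem Sh.qstep (h : Sh P μ s F) (ρ : QMat ↥S) : QStep ρ P μ s (F ρ) := by
  induction h with
  | tau => exact .tau
  | tauPair => exact .tauPair
  | op f =>
    rw [LinearMap.comp_apply, krausMap_apply]
    exact .op f
  | meas f =>
    rw [LinearMap.sum_apply]
    exact .meas f
  | send h => exact .send h
  | recv h => exact .recv h
  | iteT h _ ih => exact .iteT h ih
  | iteF h _ ih => exact .iteF h ih
  | sumL _ ih => exact .sumL ih
  | sumR _ ih => exact .sumR ih
  | parL _ h ih => exact .parL ih h
  | parR _ h ih => exact .parR ih h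
  | synchL _ _ ih1 ih2 => exact .synchL ih1 ih2
  | synchR _ _ ih1 ih2 => exact .synchR ih1 ih2
  | res _ h ih => exact .res ih h

/-- At weight zero the target process of a transition is not determined by the resulting
distribution, but then both sides vanish. -/
theorem single_par_eq {ρ : QMat ↥S} {P P' Q Q' : Proc}
    (h : (Finsupp.single P ρ : QDist S) = Finsupp.single P' ρ)
    (h' : (Finsupp.single Q ρ : QDist S) = Finsupp.single Q' ρ) :
    (Finsupp.single (.par P Q) ρ : QDist S) = Finsupp.single (.par P' Q') ρ := by
  by_cases h0 : ρ = 0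
  · simp [h0]
  · rw [Finsupp.single_left_inj h0] at h h'
    rw [h, h']

theorem QStep.exists_sh {ρ : QMat ↥S} {D : QDist S} (h : QStep ρ P μ s D) :
    ∃ F, Sh P μ s F ∧ D = F ρ := by
  induction h with
  | tau => exact ⟨_, .tau, rfl⟩
  | tauPair => exact ⟨_, .tauPair, rfl⟩
  | op f => exact ⟨_, .op f, by rw [LinearMap.comp_apply, krausMap_apply]; rfl⟩
  | meas f => exact ⟨_, .meas f, by rw [LinearMap.sum_apply]; rfl⟩
  | send h => exact ⟨_, .send h, rfl⟩
  | recv h => exact ⟨_, .recv h, rfl⟩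
  | iteT h _ ih =>
    obtain ⟨F, hF, rfl⟩ := ih
    exact ⟨F, .iteT h hF, rfl⟩
  | iteF h _ ih =>
    obtain ⟨F, hF, rfl⟩ := ih
    exact ⟨F, .iteF h hF, rfl⟩
  | sumL _ ih =>
    obtain ⟨F, hF, rfl⟩ := ih
    exact ⟨F, .sumL hF, rfl⟩
  | sumR _ ih =>
    obtain ⟨F, hF, rfl⟩ := ih
    exact ⟨F, .sumR hF, rfl⟩
  | parL _ h ih =>
    obtain ⟨F, hF, rfl⟩ := ih
    exact ⟨_, .parL hF h, rfl⟩
  | parR _ h ih =>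
    obtain ⟨F, hF, rfl⟩ := ih
    exact ⟨_, .parR hF h, rfl⟩
  | synchL _ _ ih1 ih2 =>
    obtain ⟨F, hF, e⟩ := ih1
    obtain ⟨G, hG, e'⟩ := ih2
    obtain ⟨_, P', _, rfl⟩ := hF.visible (by simp)
    obtain ⟨_, Q', _, rfl⟩ := hG.visible (by simp)
    exact ⟨_, .synchL hF hG, single_par_eq e e'⟩
  | synchR _ _ ih1 ih2 =>
    obtain ⟨F, hF, e⟩ := ih1
    obtain ⟨G, hG, e'⟩ := ih2
    obtain ⟨_, P', _, rfl⟩ := hF.visible (by simp)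
    obtain ⟨_, Q', _, rfl⟩ := hG.visible (by simp)
    exact ⟨_, .synchR hF hG, single_par_eq e e'⟩
  | res _ h ih =>
    obtain ⟨F, hF, rfl⟩ := ih
    exact ⟨_, .res hF h, rfl⟩

/-- The quantum distribution of a distribution of configurations. -/
def toQ {S : Finset Qubit} : Dist S →ₗ[ℝ≥0] QDist S :=
  Finsupp.linearCombination ℝ≥0 fun C : Conf S => (Finsupp.single C.2 C.1 : QDist S)

theorem toQ_single (ρ : QMat ↥S) (P : Proc) (p : ℝ≥0) :
    toQ (Finsupp.single (ρ, P) p) = Finsupp.single P (p • ρ) := by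
  simp [toQ, Finsupp.linearCombination_single]

theorem toQ_single_one (ρ : QMat ↥S) (P : Proc) :
    toQ (Finsupp.single (ρ, P) 1) = Finsupp.single P ρ := by
  rw [toQ_single, one_smul]

theorem toQ_mapProc (f : Proc → Proc) (Δ : Dist S) :
    toQ (Δ.mapProc f) = Finsupp.lmapDomain (QMat ↥S) ℂ f (toQ Δ) := by
  induction Δ using Finsupp.induction_linear with
  | zero => simp [Dist.mapProc]
  | add Δ Θ h h' =>
    rw [map_add, map_add, ← h, ← h', ← map_add, Dist.mapProc, Finsupp.mapDomain_add]
    rfl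
  | single C p =>
    obtain ⟨ρ, P⟩ := C
    rw [toQ_single, Dist.mapProc, Finsupp.mapDomain_single, toQ_single, Finsupp.lmapDomain_apply,
      Finsupp.mapDomain_single]

/-- Only measurements distinguish the two semantics, and probability times normalized state is the
unnormalized branch. -/
theorem CStep.exists_sh {ρ : QMat ↥S} {Δ : Dist S} (h : CStep ρ P μ s Δ) (hρ : IsDensity ρ) :
    ∃ F, Sh P μ s F ∧ toQ Δ = F ρ := by
  induction h with
  | tau => exact ⟨_, .tau, toQ_single_one _ _⟩
  | tauPair => exact ⟨_, .tauPair, toQ_single_one _ _⟩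
  | op f => exact ⟨_, .op f, by rw [LinearMap.comp_apply, krausMap_apply]; exact toQ_single_one _ _⟩
  | meas f =>
    refine ⟨_, .meas f, ?_⟩
    rw [LinearMap.sum_apply, map_sum]
    refine Finset.sum_congr rfl fun m _ => ?_
    rw [toQ_single, collapse_eq_conj, prob_smul_normalize (conj_posSemidef _ hρ.1)]
    rfl
  | send h => exact ⟨_, .send h, toQ_single_one _ _⟩
  | recv h => exact ⟨_, .recv h, toQ_single_one _ _⟩
  | iteT h _ ih =>
    obtain ⟨F, hF, e⟩ := ih
    exact ⟨F, .iteT h hF, e⟩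
  | iteF h _ ih =>
    obtain ⟨F, hF, e⟩ := ih
    exact ⟨F, .iteF h hF, e⟩
  | sumL _ ih =>
    obtain ⟨F, hF, e⟩ := ih
    exact ⟨F, .sumL hF, e⟩
  | sumR _ ih =>
    obtain ⟨F, hF, e⟩ := ih
    exact ⟨F, .sumR hF, e⟩
  | parL _ h ih =>
    obtain ⟨F, hF, e⟩ := ih
    exact ⟨_, .parL hF h, by rw [toQ_mapProc, e]; rfl⟩
  | parR _ h ih =>
    obtain ⟨F, hF, e⟩ := ih
    exact ⟨_, .parR hF h, by rw [toQ_mapProc, e]; rfl⟩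
  | synchL _ _ ih1 ih2 =>
    obtain ⟨F, hF, e⟩ := ih1
    obtain ⟨G, hG, e'⟩ := ih2
    obtain ⟨_, P', _, rfl⟩ := hF.visible (by simp)
    obtain ⟨_, Q', _, rfl⟩ := hG.visible (by simp)
    rw [toQ_single_one] at e e' ⊢
    exact ⟨_, .synchL hF hG, single_par_eq e e'⟩
  | synchR _ _ ih1 ih2 =>
    obtain ⟨F, hF, e⟩ := ih1
    obtain ⟨G, hG, e'⟩ := ih2
    obtain ⟨_, P', _, rfl⟩ := hF.visible (by simp)
    obtain ⟨_, Q', _, rfl⟩ := hG.visible (by simp)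
    rw [toQ_single_one] at e e' ⊢
    exact ⟨_, .synchR hF hG, single_par_eq e e'⟩
  | res _ h ih =>
    obtain ⟨F, hF, e⟩ := ih
    exact ⟨_, .res hF h, by rw [toQ_mapProc, e]; rfl⟩

theorem CStep.eq_single {ρ : QMat ↥S} {Δ : Dist S} (h : CStep ρ P μ s Δ) (hμ : μ ≠ .tau)
    (hρ : IsDensity ρ) {P' : Proc} (e : toQ Δ = Finsupp.single P' ρ) :
    Δ = Finsupp.single (ρ, P') 1 := by
  obtain ⟨_, Q, _, rfl⟩ := h.visible hμ
  rw [toQ_single_one, Finsupp.single_left_inj hρ.ne_zero] at e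
  rw [e]

/-- The possibility of a transition does not depend on the state. Facts about configurations,
determinism and subject reduction among them, hence transfer to linear maps. -/
theorem Sh.exists_cstep (h : Sh P μ s F) {ρ : QMat ↥S} (hρ : IsDensity ρ) :
    ∃ Δ, CStep ρ P μ s Δ ∧ toQ Δ = F ρ := by
  induction h with
  | tau => exact ⟨_, .tau, toQ_single_one _ _⟩
  | tauPair => exact ⟨_, .tauPair, toQ_single_one _ _⟩
  | op f => exact ⟨_, .op f, by rw [LinearMap.comp_apply, krausMap_apply]; exact toQ_single_one _ _⟩
  | meas f =>
    refine ⟨_, .meas f, ?_⟩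
    rw [LinearMap.sum_apply, map_sum]
    refine Finset.sum_congr rfl fun m _ => ?_
    rw [toQ_single, collapse_eq_conj, prob_smul_normalize (conj_posSemidef _ hρ.1)]
    rfl
  | send h => exact ⟨_, .send h, toQ_single_one _ _⟩
  | recv h => exact ⟨_, .recv h, toQ_single_one _ _⟩
  | iteT h _ ih =>
    obtain ⟨Δ, hΔ, e⟩ := ih
    exact ⟨Δ, .iteT h hΔ, e⟩
  | iteF h _ ih =>
    obtain ⟨Δ, hΔ, e⟩ := ih
    exact ⟨Δ, .iteF h hΔ, e⟩
  | sumL _ ih =>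
    obtain ⟨Δ, hΔ, e⟩ := ih
    exact ⟨Δ, .sumL hΔ, e⟩
  | sumR _ ih =>
    obtain ⟨Δ, hΔ, e⟩ := ih
    exact ⟨Δ, .sumR hΔ, e⟩
  | parL _ h ih =>
    obtain ⟨Δ, hΔ, e⟩ := ih
    exact ⟨_, .parL hΔ h, by rw [toQ_mapProc, e]; rfl⟩
  | parR _ h ih =>
    obtain ⟨Δ, hΔ, e⟩ := ih
    exact ⟨_, .parR hΔ h, by rw [toQ_mapProc, e]; rfl⟩
  | synchL _ _ ih1 ih2 =>
    obtain ⟨Δ, hΔ, e⟩ := ih1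
    obtain ⟨Θ, hΘ, e'⟩ := ih2
    obtain rfl := hΔ.eq_single (by simp) hρ e
    obtain rfl := hΘ.eq_single (by simp) hρ e'
    exact ⟨_, .synchL hΔ hΘ, toQ_single_one _ _⟩
  | synchR _ _ ih1 ih2 =>
    obtain ⟨Δ, hΔ, e⟩ := ih1
    obtain ⟨Θ, hΘ, e'⟩ := ih2
    obtain rfl := hΔ.eq_single (by simp) hρ e
    obtain rfl := hΘ.eq_single (by simp) hρ e'
    exact ⟨_, .synchR hΔ hΘ, toQ_single_one _ _⟩
  | res _ h ih =>
    obtain ⟨Δ, hΔ, e⟩ := ih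
    exact ⟨_, .res hΔ h, by rw [toQ_mapProc, e]; rfl⟩

/-- The moves of a process with register `T` are given by Kraus operators on `T`. -/
theorem Sh.exists_kraus (h : Sh P μ s F) {T : Finset Qubit} (hP : Typed (ctxOf T) P)
    (hT : T ⊆ S) :
    ∃ (n : ℕ) (K : Fin n → QMat ↥T) (Q : Fin n → Proc), ∑ i, (K i)ᴴ * K i = 1 ∧
      ∀ ρ, F ρ = ∑ i, Finsupp.single (Q i) (conj (pad (incl hT) (K i)) ρ) := by
  have hone : ∀ {T : Finset Qubit} (hT : T ⊆ S) (Q : Proc),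
      ∃ (n : ℕ) (K : Fin n → QMat ↥T) (Q' : Fin n → Proc), ∑ i, (K i)ᴴ * K i = 1 ∧
      ∀ ρ : QMat ↥S, (Finsupp.lsingle Q : QMat ↥S →ₗ[ℂ] QDist S) ρ
        = ∑ i, Finsupp.single (Q' i) (conj (pad (incl hT) (K i)) ρ) := by
    intro T hT Q
    exact ⟨1, fun _ => 1, fun _ => Q, by simp, fun ρ => by simp [pad_one, conj_apply]⟩
  -- Typing forces the qubits acted upon to lie in `T`, so `f` factors through its inclusion.
  have hf : ∀ {T : Finset Qubit} (hT : T ⊆ S) {n : ℕ} (f : Fin n ↪ ↥S) (a : Fin n → Name),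
      (∀ i, a i ∈ ctxOf T) →
      ((fun i => Expr.val (.qubit (f i))) = fun i => (a i).toExpr) →
      ∃ g : Fin n → ↥T, Function.Injective g ∧ ⇑f = incl hT ∘ g := by
    intro T hT n f a ha e
    have hmem : ∀ i, (f i).1 ∈ T := by
      intro i
      rw [← mem_ctxOf]
      have : (Name.qubit (f i).1).toExpr = (a i).toExpr := congrFun e i
      rw [Name.toExpr_injective this]
      exact ha i
    refine ⟨fun i => ⟨(f i).1, hmem i⟩, fun i j h => f.injective (Subtype.ext ?_), rfl⟩
    exact congrArg (fun q : ↥T => q.1) h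
  -- A component of a parallel composition owns a part `T₁` of `T`; padding its Kraus operators
  -- keeps the family complete.
  have hmono : ∀ {T₁ T : Finset Qubit} (h1 : T₁ ⊆ T) (hT : T ⊆ S) (hT₁ : T₁ ⊆ S)
      {F : QMat ↥S →ₗ[ℂ] QDist S} (g : Proc → Proc),
      (∃ (n : ℕ) (K : Fin n → QMat ↥T₁) (Q : Fin n → Proc), ∑ i, (K i)ᴴ * K i = 1 ∧
        ∀ ρ, F ρ = ∑ i, Finsupp.single (Q i) (conj (pad (incl hT₁) (K i)) ρ)) →
      ∃ (n : ℕ) (K : Fin n → QMat ↥T) (Q : Fin n → Proc), ∑ i, (K i)ᴴ * K i = 1 ∧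
        ∀ ρ, (Finsupp.lmapDomain (QMat ↥S) ℂ g ∘ₗ F) ρ
          = ∑ i, Finsupp.single (Q i) (conj (pad (incl hT) (K i)) ρ) := by
    rintro T₁ T h1 hT hT₁ F g ⟨n, K, Q, hK, hF⟩
    refine ⟨n, fun i => pad (incl h1) (K i), fun i => g (Q i), ?_, fun ρ => ?_⟩
    · rw [pad_sum_adjoint_mul (incl_injective h1), hK, pad_one]
    · rw [LinearMap.comp_apply, hF, map_sum]
      refine Finset.sum_congr rfl fun i _ => ?_
      rw [Finsupp.lmapDomain_apply, Finsupp.mapDomain_single, pad_pad (incl_injective hT)]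
      rfl
  induction h generalizing T with
  | tau | tauPair | send | recv | synchL | synchR => exact hone hT _
  | @op t n E P f =>
    obtain ⟨a, _, _, ha, e, _⟩ := hP.op_inv
    obtain ⟨g, hg, e⟩ := hf hT f a ha e
    refine ⟨E.len, fun i => pad g (E.kraus i), fun _ => P, ?_, fun ρ => ?_⟩
    · rw [pad_sum_adjoint_mul hg, E.preserving, pad_one]
    · rw [LinearMap.comp_apply, e, krausMap, LinearMap.sum_apply, map_sum]
      exact Finset.sum_congr rfl fun i _ => by rw [pad_pad (incl_injective hT)]; rfl
  | @meas t n M x P f =>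
    obtain ⟨a, _, ha, e, _, _⟩ := hP.meas_inv
    obtain ⟨g, hg, e⟩ := hf hT f a ha e
    refine ⟨M.outcomes, fun i => pad g (M.ops i), fun i => P.subst x (.nat i), ?_, fun ρ => ?_⟩
    · rw [pad_sum_adjoint_mul hg, M.complete, pad_one]
    · rw [LinearMap.sum_apply, e]
      exact Finset.sum_congr rfl fun i _ => by rw [pad_pad (incl_injective hT)]; rfl
  | iteT _ _ ih => exact ih hP.ite_inv.2.1 hT
  | iteF _ _ ih => exact ih hP.ite_inv.2.2 hT
  | sumL _ ih => exact ih hP.sum_inv.1 hT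
  | sumR _ ih => exact ih hP.sum_inv.2 hT
  | parL _ _ ih =>
    obtain ⟨T₁, T₂, hd, rfl, h1, h2⟩ := hP.par_ctxOf_inv
    exact hmono Finset.subset_union_left hT (Finset.union_subset_left hT) _ (ih h1 _)
  | parR _ _ ih =>
    obtain ⟨T₁, T₂, hd, rfl, h1, h2⟩ := hP.par_ctxOf_inv
    exact hmono Finset.subset_union_right hT (Finset.union_subset_right hT) _ (ih h2 _)
  | res _ _ ih => exact hmono subset_rfl hT hT _ (ih hP.res_inv hT)

theorem Sh.par_inv {P Q : Proc} (h : Sh (.par P Q) μ s F) :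
    (∃ F', Sh P μ s F' ∧ ¬ μ.Steals Q ∧
      F = Finsupp.lmapDomain (QMat ↥S) ℂ (fun R => Proc.par R Q) ∘ₗ F') ∨
    (∃ F', Sh Q μ s F' ∧ ¬ μ.Steals P ∧
      F = Finsupp.lmapDomain (QMat ↥S) ℂ (fun R => Proc.par P R) ∘ₗ F') ∨
    (∃ t u α P' Q', μ = .tau ∧ s = .two t u ∧ α ≠ .tau ∧
      Sh (S := S) P α (.one t) (Finsupp.lsingle P') ∧
      Sh (S := S) Q α.dual (.one u) (Finsupp.lsingle Q') ∧
      F = Finsupp.lsingle (.par P' Q')) := by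
  cases h with
  | parL h h' => exact Or.inl ⟨_, h, h', rfl⟩
  | parR h h' => exact Or.inr (Or.inl ⟨_, h, h', rfl⟩)
  | synchL h h' => exact Or.inr (Or.inr ⟨_, _, _, _, _, rfl, rfl, by simp, h, h', rfl⟩)
  | synchR h h' => exact Or.inr (Or.inr ⟨_, _, _, _, _, rfl, rfl, by simp, h, h', rfl⟩)

theorem Sh.synch {P P' Q Q' : Proc} {α : Act} {t u : Tag} (hα : α ≠ .tau)
    (h : Sh (S := S) P α (.one t) (Finsupp.lsingle P'))
    (h' : Sh (S := S) Q α.dual (.one u) (Finsupp.lsingle Q')) :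
    Sh (S := S) (.par P Q) .tau (.two t u) (Finsupp.lsingle (.par P' Q')) := by
  cases α with
  | tau => exact absurd rfl hα
  | send c v => exact .synchL h h'
  | recv c v => exact .synchR h h'

end Sh

/-! ### Determinism -/

theorem Admissible.deterministic {P : Proc} (h : Admissible P) : Deterministic P :=
  h.2 P .refl

theorem Derives.closed {P Q : Proc} (h : Derives P Q) (hP : P.fv = ∅) : Q.fv = ∅ := by
  obtain ⟨S, T, _, _, ρ, _, μ, s, Δ, h, σ, hσ⟩ := h
  exact h.closed hP hσ

theorem Admissible.derives {P Q : Proc} (h : Admissible P) (hQ : Derives P Q) : Admissible Q :=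
  ⟨hQ.closed h.1, fun R hR => h.2 R (.head hQ hR)⟩

theorem admissible_of_derives {P : Proc} (hP : P.fv = ∅) (hd : Deterministic P)
    (h : ∀ Q, Derives P Q → Admissible Q) : Admissible P := by
  refine ⟨hP, fun Q hQ => ?_⟩
  rcases hQ.cases_head with rfl | ⟨R, hR, hRQ⟩
  · exact hd
  · exact (h R hR).2 Q hRQ

theorem Sched.tags_nonempty (s : Sched) : s.tags.Nonempty := by
  cases s <;> simp [Sched.tags]

/-- With disjoint tags the scheduler tells which component moves, or that they synchronize. In a
synchronization the freedom in the received value disappears, because the sender fixes it. -/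
theorem deterministic_par {P Q : Proc} (hP : Deterministic P) (hQ : Deterministic Q)
    (hd : Disjoint P.tags Q.tags) : Deterministic (.par P Q) := by
  intro S T hT hty ρ hρ s μ ν Δ Θ h₀ h₀'
  obtain ⟨T₁, T₂, _, rfl, h1, h2⟩ := hty.par_ctxOf_inv
  have d1 := hP S T₁ (Finset.union_subset_left hT) h1 ρ hρ
  have d2 := hQ S T₂ (Finset.union_subset_right hT) h2 ρ hρ
  have hLR : ∀ {μ ν s Δ Θ}, CStep ρ P μ s Δ → CStep ρ Q ν s Θ → False := by
    intro μ ν s Δ Θ h h'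
    obtain ⟨t, ht⟩ := s.tags_nonempty
    exact Finset.disjoint_left.mp hd (h.tags_subset.1 ht) (h'.tags_subset.1 ht)
  have hLS : ∀ {μ α t u Δ Θ}, CStep ρ P μ (.two t u) Δ → CStep ρ Q α (.one u) Θ → False := by
    intro μ α t u Δ Θ h h'
    have hu : u ∈ P.tags := h.tags_subset.1 (by simp [Sched.tags])
    exact Finset.disjoint_left.mp hd hu (h'.tags_subset.1 (by simp [Sched.tags]))
  have hRS : ∀ {μ α t u Δ Θ}, CStep ρ Q μ (.two t u) Δ → CStep ρ P α (.one t) Θ → False := by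
    intro μ α t u Δ Θ h h'
    have ht : t ∈ P.tags := h'.tags_subset.1 (by simp [Sched.tags])
    exact Finset.disjoint_left.mp hd ht (h.tags_subset.1 (by simp [Sched.tags]))
  rcases h₀.par_inv with ⟨Δ', h, _, rfl⟩ | ⟨Δ', h, _, rfl⟩ |
    ⟨t, u, α, P', Q', rfl, rfl, hα, h, hq, rfl⟩ <;>
  rcases h₀'.par_inv with ⟨Θ', h', _, rfl⟩ | ⟨Θ', h', _, rfl⟩ |
    ⟨t', u', β, P'', Q'', rfl, e, hβ, h', hq', rfl⟩
  · rcases d1 _ _ _ _ _ h h' with ⟨rfl, rfl⟩ | h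
    · exact Or.inl ⟨rfl, rfl⟩
    · exact Or.inr h
  · exact (hLR h h').elim
  · subst e
    exact (hLS h hq').elim
  · exact (hLR h' h).elim
  · rcases d2 _ _ _ _ _ h h' with ⟨rfl, rfl⟩ | h
    · exact Or.inl ⟨rfl, rfl⟩
    · exact Or.inr h
  · subst e
    exact (hRS h h').elim
  · exact (hLS h' hq).elim
  · exact (hRS h' h).elim
  · obtain ⟨rfl, rfl⟩ : t = t' ∧ u = u' := by simpa using e
    have hsingle : ∀ {X Y : Proc}, (Finsupp.single (ρ, X) 1 : Dist S) = Finsupp.single (ρ, Y) 1 →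
        X = Y := by
      intro X Y h
      rw [Finsupp.single_left_inj one_ne_zero] at h
      exact congrArg Prod.snd h
    rcases d1 _ _ _ _ _ h h' with ⟨rfl, e⟩ | ⟨hne, c, v, w, rfl, rfl⟩
    · obtain rfl := hsingle e
      rcases d2 _ _ _ _ _ hq hq' with ⟨_, e⟩ | ⟨hne, _⟩
      · obtain rfl := hsingle e
        exact Or.inl ⟨rfl, rfl⟩
      · exact absurd rfl hne
    -- Two different inputs on the left would require two different outputs on the right under one
    -- tag.
    · rcases d2 _ _ _ _ _ hq hq' with ⟨e, _⟩ | ⟨_, c', v', w', e, _⟩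
      · exact absurd (Act.dual_injective e) hne
      · cases e

theorem Derives.par_inv {P Q X : Proc} (h : Derives (.par P Q) X) :
    ∃ P' Q', X = .par P' Q' ∧ (P' = P ∨ Derives P P') ∧ (Q' = Q ∨ Derives Q Q') ∧
      P'.tags ⊆ P.tags ∧ Q'.tags ⊆ Q.tags := by
  obtain ⟨S, T, hT, hty, ρ, hρ, μ, s, Δ, h₀, σ, hσ⟩ := h
  obtain ⟨T₁, T₂, _, rfl, h1, h2⟩ := hty.par_ctxOf_inv
  have hT₁ := Finset.union_subset_left hT
  have hT₂ := Finset.union_subset_right hT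
  rcases h₀.par_inv with ⟨Δ', h, _, rfl⟩ | ⟨Δ', h, _, rfl⟩ |
    ⟨t, u, α, P', Q', rfl, rfl, hα, h, hq, rfl⟩
  · obtain ⟨C, hC, e⟩ := Dist.mem_support_mapProc hσ
    exact ⟨C.2, Q, (Prod.ext_iff.mp e).2,
      Or.inr ⟨S, T₁, hT₁, h1, ρ, hρ, μ, s, Δ', h, C.1, hC⟩, Or.inl rfl, h.tags_subset.2 C hC,
      subset_rfl⟩
  · obtain ⟨C, hC, e⟩ := Dist.mem_support_mapProc hσ
    exact ⟨P, C.2, (Prod.ext_iff.mp e).2, Or.inl rfl,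
      Or.inr ⟨S, T₂, hT₂, h2, ρ, hρ, μ, s, Δ', h, C.1, hC⟩, subset_rfl, h.tags_subset.2 C hC⟩
  · have e := mem_support_single hσ
    exact ⟨P', Q', (Prod.ext_iff.mp e).2,
      Or.inr ⟨S, T₁, hT₁, h1, ρ, hρ, _, _, _, h, ρ, mem_support_single_one _⟩,
      Or.inr ⟨S, T₂, hT₂, h2, ρ, hρ, _, _, _, hq, ρ, mem_support_single_one _⟩,
      h.tags_subset.2 _ (mem_support_single_one _), hq.tags_subset.2 _ (mem_support_single_one _)⟩

/-- Whatever is reachable is again a parallel composition of admissible processes with disjoint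
tags, and such compositions are deterministic. -/
theorem Admissible.par {P Q : Proc} (hP : Admissible P) (hQ : Admissible Q)
    (hd : Disjoint P.tags Q.tags) : Admissible (.par P Q) := by
  refine ⟨Set.union_empty_iff.mpr ⟨hP.1, hQ.1⟩, fun X hX => ?_⟩
  have key : ∃ P' Q', X = .par P' Q' ∧ Admissible P' ∧ Admissible Q' ∧
      Disjoint P'.tags Q'.tags := by
    induction hX with
    | refl => exact ⟨P, Q, rfl, hP, hQ, hd⟩
    | tail _ h ih =>
      obtain ⟨P', Q', rfl, hP', hQ', hd'⟩ := ih
      obtain ⟨P'', Q'', rfl, h1, h2, h3, h4⟩ := h.par_inv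
      refine ⟨P'', Q'', rfl, ?_, ?_, hd'.mono h3 h4⟩
      · rcases h1 with rfl | h1
        · exact hP'
        · exact hP'.derives h1
      · rcases h2 with rfl | h2
        · exact hQ'
        · exact hQ'.derives h2
  obtain ⟨P', Q', rfl, hP', hQ', hd'⟩ := key
  exact deterministic_par hP'.deterministic hQ'.deterministic hd'

/-! ### Well-typed admissible processes -/

/-- Admissible processes with register `T`. -/
structure Good (T : Finset Qubit) (P : Proc) : Prop where
  typed : Typed (ctxOf T) P
  admissible : Admissible P

/-- This extends, by linearity, what is known for states to all positive weights; the zero weight is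
a zero multiple of an arbitrary state. -/
theorem exists_isDensity_smul {ι : Type} [Fintype ι] [DecidableEq ι] {ρ : QMat ι}
    (h : ρ.PosSemidef) : ∃ (c : ℂ) (σ : QMat ι), IsDensity σ ∧ ρ = c • σ := by
  by_cases h0 : ρ = 0
  · obtain ⟨σ, hσ⟩ := exists_isDensity ι
    exact ⟨0, σ, hσ, by simp [h0]⟩
  · have h1 : prob ρ ≠ 0 := (prob_eq_zero_iff h).not.mpr h0
    have h2 : ρ.trace ≠ 0 := fun h2 => h0 (h.trace_eq_zero_iff.mp h2)
    exact ⟨ρ.trace, _, isDensity_normalize h h1, by rw [smul_smul, mul_inv_cancel₀ h2, one_smul]⟩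

theorem mem_support_toQ {S : Finset Qubit} {Δ : Dist S} {P : Proc} (h : P ∈ (toQ Δ).support) :
    ∃ σ, (σ, P) ∈ Δ.support := by
  rw [toQ, Finsupp.linearCombination_apply, Finsupp.sum] at h
  obtain ⟨⟨σ, Q⟩, hC, h⟩ := mem_support_sum h
  rw [Finsupp.smul_single] at h
  obtain rfl := mem_support_single h
  exact ⟨σ, hC⟩

section

variable {S T : Finset Qubit} {P : Proc} {μ ν : Act} {s : Sched} {F G : QMat ↥S →ₗ[ℂ] QDist S}

theorem Sh.tags_subset (h : Sh P μ s F) : s.tags ⊆ P.tags := by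
  obtain ⟨ρ, hρ⟩ := exists_isDensity ↥S
  obtain ⟨Δ, hΔ, _⟩ := h.exists_cstep hρ
  exact hΔ.tags_subset.1

theorem Sh.enabled (h : Sh P μ s F) (hP : Typed (ctxOf T) P) : μ.Enabled S T := by
  obtain ⟨ρ, hρ⟩ := exists_isDensity ↥S
  obtain ⟨Δ, hΔ, _⟩ := h.exists_cstep hρ
  exact (hΔ.typed hP).1

theorem Sh.good_of_mem_support (h : Sh P μ s F) (hT : T ⊆ S) (hP : Good T P) {ρ : QMat ↥S}
    (hρ : ρ.PosSemidef) {Q : Proc} (hQ : Q ∈ (F ρ).support) :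
    Good (μ.after T) Q ∧ Q.tags ⊆ P.tags := by
  obtain ⟨c, σ, hσ, rfl⟩ := exists_isDensity_smul hρ
  obtain ⟨Δ, hΔ, e⟩ := h.exists_cstep hσ
  rw [map_smul, ← e] at hQ
  obtain ⟨τ, hτ⟩ := mem_support_toQ (Finsupp.support_smul hQ)
  exact ⟨⟨(hΔ.typed hP.typed).2 _ hτ,
    hP.admissible.derives ⟨S, T, hT, hP.typed, σ, hσ, μ, s, Δ, hΔ, τ, hτ⟩⟩,
    hΔ.tags_subset.2 _ hτ⟩

/-- A scheduler forces a unique transition, up to the choice of a received value. -/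
theorem Sh.deterministic (h : Sh P μ s F) (h' : Sh P ν s G) (hT : T ⊆ S) (hP : Good T P) :
    μ = ν ∨ ∃ c v w, μ = .recv c v ∧ ν = .recv c w := by
  obtain ⟨ρ, hρ⟩ := exists_isDensity ↥S
  obtain ⟨Δ, hΔ, _⟩ := h.exists_cstep hρ
  obtain ⟨Θ, hΘ, _⟩ := h'.exists_cstep hρ
  rcases hP.admissible.deterministic S T hT hP.typed ρ hρ s _ _ _ _ hΔ hΘ with ⟨e, _⟩ | ⟨_, h⟩
  · exact Or.inl e
  · exact Or.inr h

/-- With the action fixed, the exception for inputs in `Deterministic` does not apply, so the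
results agree on states and then on their multiples. -/
theorem Sh.unique (h : Sh P μ s F) (h' : Sh P μ s G) (hT : T ⊆ S) (hP : Good T P) {ρ : QMat ↥S}
    (hρ : ρ.PosSemidef) : F ρ = G ρ := by
  obtain ⟨c, σ, hσ, rfl⟩ := exists_isDensity_smul hρ
  obtain ⟨Δ, hΔ, e⟩ := h.exists_cstep hσ
  obtain ⟨Θ, hΘ, e'⟩ := h'.exists_cstep hσ
  rcases hP.admissible.deterministic S T hT hP.typed σ hσ s _ _ _ _ hΔ hΘ with ⟨_, h⟩ | ⟨h, _⟩
  · rw [map_smul, map_smul, ← e, ← e', h]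
  · exact absurd rfl h

/-- The mass of a quantum distribution, as a linear map. -/
def qmassL {S : Finset Qubit} : QDist S →ₗ[ℂ] QMat ↥S := Finsupp.lsum ℂ fun _ => LinearMap.id

theorem qmassL_apply (D : QDist S) : qmassL D = qmass D := rfl

theorem qmass_add (D E : QDist S) : qmass (D + E) = qmass D + qmass E := map_add qmassL D E

theorem qmass_single (P : Proc) (ρ : QMat ↥S) : qmass (Finsupp.single P ρ) = ρ := by
  simp [qmass]

theorem qmass_mapProc (f : Proc → Proc) (D : QDist S) :
    qmass (Finsupp.lmapDomain (QMat ↥S) ℂ f D) = qmass D := by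
  rw [qmass, qmass, Finsupp.lmapDomain_apply, Finsupp.sum_mapDomain_index] <;> simp

theorem Sh.trace_qmass (h : Sh P μ s F) (hT : T ⊆ S) (hP : Typed (ctxOf T) P) (ρ : QMat ↥S) :
    (qmass (F ρ)).trace = ρ.trace := by
  obtain ⟨n, K, Q, hK, hF⟩ := h.exists_kraus hP hT
  rw [hF, ← qmassL_apply, map_sum, Matrix.trace_sum]
  simp only [qmassL_apply, qmass_single, trace_conj]
  rw [← Matrix.trace_sum, ← Finset.sum_mul, pad_sum_adjoint_mul (incl_injective hT), hK, pad_one,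
    one_mul]

theorem posSemidef_single {P Q : Proc} {ρ : QMat ↥S} (hρ : ρ.PosSemidef) :
    ((Finsupp.single P ρ : QDist S) Q).PosSemidef := by
  classical
  rw [Finsupp.single_apply]
  split_ifs
  · exact hρ
  · exact Matrix.PosSemidef.zero

theorem posSemidef_sum_apply {α : Type} {s : Finset α} {D : α → QDist S}
    (h : ∀ a ∈ s, ∀ Q, (D a Q).PosSemidef) (Q : Proc) : ((∑ a ∈ s, D a) Q).PosSemidef := by
  rw [Finsupp.finsetSum_apply]
  exact Matrix.posSemidef_sum _ fun a ha => h a ha Q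

theorem Sh.posSemidef (h : Sh P μ s F) (hT : T ⊆ S) (hP : Typed (ctxOf T) P) {ρ : QMat ↥S}
    (hρ : ρ.PosSemidef) (Q : Proc) : (F ρ Q).PosSemidef := by
  obtain ⟨n, K, Q', hK, hF⟩ := h.exists_kraus hP hT
  rw [hF]
  exact posSemidef_sum_apply (fun i _ Q => posSemidef_single (conj_posSemidef _ hρ)) Q

/-! ### The moves of quantum distributions -/

open Classical in
/-- The result of the transition of a process with a given action and scheduler, zero if there is
none. -/
def out (μ : Act) (s : Sched) (P : Proc) : QMat ↥S →ₗ[ℂ] QDist S :=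
  if h : ∃ F, Sh (S := S) P μ s F then h.choose else 0

theorem Sh.out_eq (h : Sh P μ s F) (hT : T ⊆ S) (hP : Good T P) {ρ : QMat ↥S}
    (hρ : ρ.PosSemidef) : out μ s P ρ = F ρ := by
  have h' : ∃ F, Sh (S := S) P μ s F := ⟨F, h⟩
  rw [out, dif_pos h']
  exact h'.choose_spec.unique h hT hP hρ

theorem out_eq_zero (h : ∀ F, ¬ Sh (S := S) P μ s F) : out (S := S) μ s P = 0 := by
  rw [out, dif_neg]
  rintro ⟨F, hF⟩
  exact h F hF

theorem out_cases (μ : Act) (s : Sched) (P : Proc) :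
    Sh (S := S) P μ s (out μ s P) ∨ out (S := S) μ s P = 0 := by
  by_cases h : ∃ F, Sh (S := S) P μ s F
  · left
    rw [out, dif_pos h]
    exact h.choose_spec
  · exact Or.inr (out_eq_zero fun F hF => h ⟨F, hF⟩)

/-- The result of the transition of a quantum distribution. -/
def next (μ : Act) (s : Sched) : QDist S →ₗ[ℂ] QDist S := Finsupp.lsum ℂ (out μ s)

theorem next_single (μ : Act) (s : Sched) (P : Proc) (ρ : QMat ↥S) :
    next μ s (Finsupp.single P ρ) = out μ s P ρ := by
  simp [next]

theorem next_apply (μ : Act) (s : Sched) (D : QDist S) :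
    next μ s D = ∑ P ∈ D.support, out μ s P (D P) := rfl

/-- Quantum distributions of positive operators on admissible processes with register `T`. -/
structure QGood (T : Finset Qubit) (D : QDist S) : Prop where
  posSemidef : ∀ P, (D P).PosSemidef
  good : ∀ P ∈ D.support, Good T P

theorem QGood.zero : QGood T (0 : QDist S) :=
  ⟨fun _ => Matrix.PosSemidef.zero, fun P hP => by simp at hP⟩

theorem QGood.add {D E : QDist S} (h : QGood T D) (h' : QGood T E) : QGood T (D + E) := by
  classical
  refine ⟨fun P => (h.posSemidef P).add (h'.posSemidef P), fun P hP => ?_⟩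
  rcases Finset.mem_union.mp (Finsupp.support_add hP) with hP | hP
  · exact h.good P hP
  · exact h'.good P hP

theorem QGood.sum {α : Type} {s : Finset α} {D : α → QDist S} (h : ∀ a ∈ s, QGood T (D a)) :
    QGood T (∑ a ∈ s, D a) := by
  refine ⟨posSemidef_sum_apply fun a ha => (h a ha).posSemidef, fun P hP => ?_⟩
  obtain ⟨a, ha, hP⟩ := mem_support_sum hP
  exact (h a ha).good P hP

theorem QGood.single {ρ : QMat ↥S} (hρ : ρ.PosSemidef) (h : ρ ≠ 0 → Good T P) :
    QGood T (Finsupp.single P ρ : QDist S) := by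
  refine ⟨fun Q => posSemidef_single hρ, fun Q hQ => ?_⟩
  obtain rfl := mem_support_single hQ
  exact h fun h0 => by simp [h0] at hQ

theorem out_qgood (hT : T ⊆ S) (hP : Good T P) {ρ : QMat ↥S} (hρ : ρ.PosSemidef) :
    QGood (μ.after T) (out μ s P ρ) ∧ ∀ Q ∈ (out μ s P ρ).support, Q.tags ⊆ P.tags := by
  rcases out_cases (S := S) μ s P with h | h
  · exact ⟨⟨h.posSemidef hT hP.typed hρ, fun Q hQ => (h.good_of_mem_support hT hP hρ hQ).1⟩,
      fun Q hQ => (h.good_of_mem_support hT hP hρ hQ).2⟩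
  · rw [h]
    exact ⟨QGood.zero, fun Q hQ => by simp at hQ⟩

theorem QGood.next {D : QDist S} (hT : T ⊆ S) (h : QGood T D) (μ : Act) (s : Sched) :
    QGood (μ.after T) (next μ s D) := by
  rw [next_apply]
  exact QGood.sum fun P hP => (out_qgood hT (h.good P hP) (h.posSemidef P)).1

theorem QGood.exists_of_mem_support_next {D : QDist S} (hT : T ⊆ S) (h : QGood T D) {Q : Proc}
    (hQ : Q ∈ (LqCCS.next μ s D).support) : ∃ P ∈ D.support, Q.tags ⊆ P.tags ∧ μ.Enabled S T ∧
      s.tags ⊆ P.tags := by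
  rw [next_apply] at hQ
  obtain ⟨P, hP, hQ⟩ := mem_support_sum hQ
  refine ⟨P, hP, (out_qgood hT (h.good P hP) (h.posSemidef P)).2 Q hQ, ?_⟩
  rcases out_cases (S := S) μ s P with h' | h'
  · exact ⟨h'.enabled (h.good P hP).typed, h'.tags_subset⟩
  · simp [h'] at hQ

theorem trace_qmass (D : QDist S) : (qmass D).trace = ∑ P ∈ D.support, (D P).trace := by
  rw [qmass, Finsupp.sum, Matrix.trace_sum]

/-- Components that move keep their trace, by completeness of the Kraus operators; stuck components
lose all their weight. -/
theorem QGood.trace_next_le {D : QDist S} (hT : T ⊆ S) (h : QGood T D) (μ : Act) (s : Sched) :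
    (qmass (LqCCS.next μ s D)).trace.re ≤ (qmass D).trace.re := by
  rw [next_apply, ← qmassL_apply, map_sum, Matrix.trace_sum, trace_qmass, Complex.re_sum,
    Complex.re_sum]
  refine Finset.sum_le_sum fun P hP => ?_
  rw [qmassL_apply]
  rcases out_cases (S := S) μ s P with h' | h'
  · rw [h'.trace_qmass hT (h.good P hP).typed]
  · rw [h']
    simpa [qmass] using trace_re_nonneg (h.posSemidef P)

theorem eq_zero_of_trace_qmass {D : QDist S} (h : ∀ P, (D P).PosSemidef)
    (h0 : (qmass D).trace.re ≤ 0) : D = 0 := by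
  ext1 P
  by_cases hP : P ∈ D.support
  · refine eq_zero_of_sum_eq_zero (s := D.support) (fun Q _ => h Q) ?_ hP
    refine eq_zero_of_trace_re_le ?_ h0
    exact Matrix.posSemidef_sum _ fun Q _ => h Q
  · simpa using hP

theorem QMove.posSemidef {D D' : QDist S} (h : QMove D μ s D') : ∀ P, (D P).PosSemidef := by
  induction h with
  | step h _ => exact fun Q => posSemidef_single h.1
  | stuck h _ => exact fun Q => posSemidef_single h.1
  | conv _ _ _ ih1 ih2 => exact fun P => (ih1 P).add (ih2 P)

theorem support_subset_add {D E : QDist S} (hD : ∀ P, (D P).PosSemidef)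
    (hE : ∀ P, (E P).PosSemidef) : D.support ⊆ (D + E).support := by
  intro P hP
  rw [Finsupp.mem_support_iff] at hP ⊢
  exact fun h => hP (eq_zero_of_add_eq_zero (hD P) (hE P) h)

/-- A move may split `D` arbitrarily, even cutting the weight of one process into pieces. As single
transitions are unique and linear in the weight, the splitting does not matter. -/
theorem QMove.eq_next {D D' : QDist S} (h : QMove D μ s D') (hT : T ⊆ S)
    (hD : ∀ P ∈ D.support, Good T P) : D' = next μ s D := by
  induction h with
  | @step ρ P μ s D hρ h =>
    obtain ⟨F, hF, rfl⟩ := h.exists_sh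
    rw [next_single]
    -- With weight zero, `P` is outside the support and need not be well typed, but both sides
    -- vanish.
    by_cases h0 : ρ = 0
    · simp [h0]
    · exact (hF.out_eq hT (hD P (by simp [h0])) hρ.1).symm
  | @stuck ρ P μ s hρ h =>
    rw [next_single, out_eq_zero fun F hF => h _ (hF.qstep ρ), LinearMap.zero_apply]
  | conv h1 h2 _ ih1 ih2 =>
    -- Positivity excludes cancellation, so the processes of both summands are among those of the
    -- sum.
    rw [map_add, ih1 fun P hP => hD P (support_subset_add h1.posSemidef h2.posSemidef hP),
      ih2 fun P hP => hD P (by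
        rw [add_comm]; exact support_subset_add h2.posSemidef h1.posSemidef hP)]

theorem qmove_single {ρ : QMat ↥S} (hρ : IsSubDensity ρ) (hT : T ⊆ S) (hP : Good T P) :
    QMove (Finsupp.single P ρ) μ s (out μ s P ρ) := by
  rcases out_cases (S := S) μ s P with h | h
  · exact .step hρ (h.qstep ρ)
  · by_cases h' : ∃ F, Sh (S := S) P μ s F
    · obtain ⟨F, hF⟩ := h'
      rw [hF.out_eq hT hP hρ.1]
      exact .step hρ (hF.qstep ρ)
    · rw [h]
      refine .stuck hρ fun D hD => h' ?_
      obtain ⟨F, hF, _⟩ := hD.exists_sh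
      exact ⟨F, hF⟩

theorem QGood.qmove_next {D : QDist S} (h : QGood T D) (hT : T ⊆ S)
    (hm : (qmass D).trace.re ≤ 1) (μ : Act) (s : Sched) : QMove D μ s (LqCCS.next μ s D) := by
  classical
  have key : ∀ A ⊆ D.support, ∑ P ∈ A, (D P).trace.re ≤ 1 ∧
      QMove (∑ P ∈ A, Finsupp.single P (D P)) μ s (∑ P ∈ A, out μ s P (D P)) := by
    intro A hA
    have hle : ∀ A ⊆ D.support, ∑ P ∈ A, (D P).trace.re ≤ 1 := by
      intro A hA
      refine le_trans ?_ hm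
      rw [trace_qmass, Complex.re_sum]
      exact Finset.sum_le_sum_of_subset_of_nonneg hA fun P _ _ => trace_re_nonneg (h.posSemidef P)
    refine ⟨hle A hA, ?_⟩
    induction A using Finset.induction_on with
    | empty =>
      -- No rule of `QMove` speaks of the empty distribution; its move is that of a zero weight on
      -- an arbitrary process.
      have h0 : IsSubDensity (0 : QMat ↥S) := ⟨Matrix.PosSemidef.zero, by simp⟩
      by_cases h' : ∃ F, Sh (S := S) (.nil []) μ s F
      · obtain ⟨F, hF⟩ := h'
        have := QMove.step h0 (hF.qstep 0)
        simpa using this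
      · have := QMove.stuck (S := S) (P := .nil []) (μ := μ) (s := s) h0 fun D hD => h' (by
          obtain ⟨F, hF, _⟩ := hD.exists_sh
          exact ⟨F, hF⟩)
        simpa using this
    | insert P A hPA ih =>
      have hP := hA (Finset.mem_insert_self P A)
      rw [Finset.sum_insert hPA, Finset.sum_insert hPA]
      refine .conv (qmove_single ⟨h.posSemidef P, ?_⟩ hT (h.good P hP))
        (ih ((Finset.subset_insert P A).trans hA)) ?_
      · simpa using hle {P} (by simpa using hP)
      · rw [← Finset.sum_insert (f := fun P => (Finsupp.single P (D P) : QDist S)) hPA,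
          ← qmassL_apply, map_sum, Matrix.trace_sum, Complex.re_sum]
        simpa only [qmassL_apply, qmass_single] using hle _ hA
  have := (key D.support subset_rfl).2
  have e : ∑ P ∈ D.support, Finsupp.single P (D P) = D := Finsupp.sum_single D
  rwa [e] at this

theorem IsQDist.qgood {D : QDist S} (h : IsQDist D) (hD : D.HasType T) : QGood T D :=
  ⟨h.1, fun P hP => ⟨hD.2 P hP, h.2.2 P hP⟩⟩

theorem QGood.isQDist {D : QDist S} (h : QGood T D) (hm : (qmass D).trace.re ≤ 1) : IsQDist D :=
  ⟨h.posSemidef, hm, fun P hP => (h.good P hP).admissible⟩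

end

/-! ### Distributions of configurations and quantum distributions -/

section

variable {S T : Finset Qubit} {μ : Act} {s : Sched}

/-- Distributions of configurations of states and admissible processes with register `T`. -/
def DGood (T : Finset Qubit) (Δ : Dist S) : Prop :=
  ∀ C ∈ Δ.support, IsDensity C.1 ∧ Good T C.2

theorem IsDist.dgood {Δ : Dist S} (h : IsDist Δ) (hΔ : Δ.HasType T) : DGood T Δ :=
  fun C hC => ⟨(h.2 C hC).1, hΔ.2 C hC, (h.2 C hC).2⟩

theorem toQ_eq_sum (Δ : Dist S) :
    toQ Δ = ∑ C ∈ Δ.support, (Finsupp.single C.2 (Δ C • C.1) : QDist S) := by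
  rw [toQ, Finsupp.linearCombination_apply, Finsupp.sum]
  exact Finset.sum_congr rfl fun C _ => Finsupp.smul_single _ _ _

theorem nnreal_smul_eq {ι : Type} [Fintype ι] [DecidableEq ι] (p : ℝ≥0) (ρ : QMat ι) :
    p • ρ = ((p : ℝ) : ℂ) • ρ := by
  ext i j
  simp [NNReal.smul_def]

theorem posSemidef_nnreal_smul {ι : Type} [Fintype ι] [DecidableEq ι] {ρ : QMat ι}
    (h : ρ.PosSemidef) (p : ℝ≥0) : (p • ρ).PosSemidef := by
  rw [nnreal_smul_eq]
  exact h.smul (by exact_mod_cast p.2)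

theorem trace_nnreal_smul {ι : Type} [Fintype ι] [DecidableEq ι] {ρ : QMat ι}
    (h : IsDensity ρ) (p : ℝ≥0) : (p • ρ).trace = ((p : ℝ) : ℂ) := by
  rw [nnreal_smul_eq, Matrix.trace_smul, h.2, smul_eq_mul, mul_one]

theorem DGood.toQ {Δ : Dist S} (h : DGood T Δ) : QGood T (toQ Δ) := by
  rw [toQ_eq_sum]
  exact QGood.sum fun C hC =>
    QGood.single (posSemidef_nnreal_smul (h C hC).1.1 _) fun _ => (h C hC).2

/-- `toQ` merges configurations with the same process, but positive weights do not cancel. Hence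
typings can be read back from the image. -/
theorem mem_support_toQ_of_mem {Δ : Dist S} (h : ∀ C ∈ Δ.support, IsDensity C.1) {C : Conf S}
    (hC : C ∈ Δ.support) : C.2 ∈ (toQ Δ).support := by
  rw [Finsupp.mem_support_iff, toQ_eq_sum, Finsupp.finsetSum_apply]
  intro h0
  have := eq_zero_of_sum_eq_zero
    (fun D hD => posSemidef_single (posSemidef_nnreal_smul (h D hD).1 _)) h0 hC
  rw [Finsupp.single_eq_same] at this
  have h1 := trace_nnreal_smul (h C hC) (Δ C)
  rw [this, Matrix.trace_zero, eq_comm, Complex.ofReal_eq_zero, NNReal.coe_eq_zero] at h1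
  exact (Finsupp.mem_support_iff.mp hC) h1

theorem trace_toQ {Δ : Dist S} (h : ∀ C ∈ Δ.support, IsDensity C.1) :
    (qmass (toQ Δ)).trace = ((mass Δ : ℝ) : ℂ) := by
  rw [toQ_eq_sum, ← qmassL_apply, map_sum, Matrix.trace_sum, mass, Finsupp.sum, NNReal.coe_sum,
    Complex.ofReal_sum]
  exact Finset.sum_congr rfl fun C hC => by
    rw [qmassL_apply, qmass_single, trace_nnreal_smul (h C hC)]

theorem IsDist.isQDist {Δ : Dist S} (h : IsDist Δ) (hΔ : Δ.HasType T) : IsQDist (toQ Δ) := by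
  refine (h.dgood hΔ).toQ.isQDist ?_
  rw [trace_toQ fun C hC => (h.2 C hC).1, Complex.ofReal_re]
  exact_mod_cast h.1

theorem next_nnreal_smul (p : ℝ≥0) (D : QDist S) : next μ s (p • D) = p • next μ s D := by
  have h : ∀ D : QDist S, p • D = ((p : ℝ) : ℂ) • D := fun D => by
    ext1 P
    rw [Finsupp.smul_apply, Finsupp.smul_apply, nnreal_smul_eq]
  rw [h, h, map_smul]

/-- The lifting is generated by point distributions and linear combinations. On points it agrees
with `out`, and `toQ` and `next` respect nonnegative combinations. -/
theorem DMove.toQ_eq_next {Δ Δ' : Dist S} (h : DMove Δ μ s Δ') (hT : T ⊆ S) (hΔ : DGood T Δ) :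
    toQ Δ' = next μ s (toQ Δ) ∧ DGood (μ.after T) Δ' := by
  unfold DMove at h
  induction h with
  | @point C Θ h =>
    obtain ⟨hρ, hP⟩ := hΔ C (mem_support_single_one C)
    obtain ⟨ρ, P⟩ := C
    rw [toQ_single_one, next_single]
    rcases h with h | ⟨h, rfl⟩
    · obtain ⟨F, hF, e⟩ := h.exists_sh hρ
      refine ⟨by rw [e, hF.out_eq hT hP hρ.1], fun C hC => ⟨h.isDensity hρ C hC,
        (h.typed hP.typed).2 C hC,
        hP.admissible.derives ⟨S, T, hT, hP.typed, ρ, hρ, μ, s, Θ, h, C.1, hC⟩⟩⟩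
    · refine ⟨?_, fun C hC => by simp at hC⟩
      rw [out_eq_zero, map_zero, LinearMap.zero_apply]
      intro F hF
      obtain ⟨Θ, hΘ, _⟩ := hF.exists_cstep hρ
      exact h Θ hΘ
  | @linear n p Δ Θ hp _ hm ih =>
    -- A summand with coefficient zero may contain arbitrary configurations; it contributes to
    -- neither side.
    have hsub : ∀ i, p i ≠ 0 → DGood T (Δ i) := by
      intro i hi C hC
      refine hΔ C ?_
      rw [Finsupp.mem_support_iff] at hC ⊢
      rw [Finsupp.finsetSum_apply]
      intro h0
      have := (Finset.sum_eq_zero_iff.mp h0) i (Finset.mem_univ i)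
      rw [Finsupp.smul_apply, smul_eq_mul] at this
      exact (mul_ne_zero hi hC) this
    constructor
    · rw [map_sum, map_sum, map_sum]
      refine Finset.sum_congr rfl fun i _ => ?_
      by_cases hi : p i = 0
      · simp [hi]
      · rw [map_smul, map_smul, next_nnreal_smul, (ih i (hsub i hi)).1]
    · intro C hC
      obtain ⟨i, _, hi⟩ := mem_support_sum hC
      have hp : p i ≠ 0 := by
        rintro h0
        simp [h0] at hi
      exact (ih i (hsub i hp)).2 C (Finsupp.support_smul hi)

theorem DMove.isDist {Δ Δ' : Dist S} (h : DMove Δ μ s Δ') (hT : T ⊆ S) (hΔ : DGood T Δ)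
    (hm : mass Δ ≤ 1) : IsDist Δ' := by
  obtain ⟨e, h'⟩ := h.toQ_eq_next hT hΔ
  refine ⟨?_, fun C hC => ⟨(h' C hC).1, (h' C hC).2.admissible⟩⟩
  have := hΔ.toQ.trace_next_le hT μ s
  rw [← e, trace_toQ fun C hC => (h' C hC).1, trace_toQ fun C hC => (hΔ C hC).1,
    Complex.ofReal_re, Complex.ofReal_re] at this
  exact le_trans (by exact_mod_cast this) hm

/-- `Bot` is total, so every configuration of the support can be moved separately and the results
added with the weights of `Δ`. -/
theorem exists_dmove (Δ : Dist S) (hm : mass Δ ≤ 1) (μ : Act) (s : Sched) :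
    ∃ Δ', DMove Δ μ s Δ' := by
  have hbot : ∀ C : Conf S, ∃ Θ, Bot μ s C Θ := by
    intro C
    by_cases h : ∃ Θ, CStep C.1 C.2 μ s Θ
    · obtain ⟨Θ, hΘ⟩ := h
      exact ⟨Θ, Or.inl hΘ⟩
    · exact ⟨0, Or.inr ⟨fun Θ hΘ => h ⟨Θ, hΘ⟩, rfl⟩⟩
  choose Θ hΘ using hbot
  let e := Δ.support.equivFin.symm
  have hsum : ∑ i, Δ (e i).1 • (Finsupp.single (e i).1 1 : Dist S) = Δ := by
    rw [Equiv.sum_comp e fun C => Δ C.1 • (Finsupp.single C.1 1 : Dist S),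
      Finset.sum_coe_sort Δ.support fun C => Δ C • (Finsupp.single C 1 : Dist S)]
    conv_rhs => rw [← Finsupp.sum_single Δ]
    exact Finset.sum_congr rfl fun C _ => by rw [Finsupp.smul_single, smul_eq_mul, mul_one]
  have := Lift.linear (R := Bot μ s) (fun i => Δ (e i).1) (fun i => Finsupp.single (e i).1 1)
    (fun i => Θ (e i).1) (fun i => ?_) (fun i => .point (hΘ _)) (by rw [hsum]; exact hm)
  · rw [hsum] at this
    exact ⟨_, this⟩
  · refine le_trans ?_ hm
    exact Finset.single_le_sum (f := fun C => Δ C) (fun _ _ => zero_le) (e i).2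

end

/-! ### Moves of parallel compositions -/

theorem disjoint_elim {A B : Finset Tag} (h : Disjoint A B) (t : Tag) (h1 : t ∈ A) (h2 : t ∈ B) :
    False :=
  Finset.disjoint_left.mp h h1 h2

/-- Put the processes of a quantum distribution in parallel with `R`. -/
def parMap {S : Finset Qubit} (R : Proc) : QDist S →ₗ[ℂ] QDist S :=
  Finsupp.lmapDomain (QMat ↥S) ℂ fun P => .par P R

section

variable {S T V : Finset Qubit} {P R : Proc} {μ : Act} {s : Sched}

theorem parMap_single (R P : Proc) (ρ : QMat ↥S) :
    parMap R (Finsupp.single P ρ) = Finsupp.single (.par P R) ρ := by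
  rw [parMap, Finsupp.lmapDomain_apply, Finsupp.mapDomain_single]

theorem Good.par (hP : Good T P) (hR : Good V R) (hd : Disjoint T V)
    (ht : Disjoint P.tags R.tags) : Good (T ∪ V) (.par P R) :=
  ⟨by rw [ctxOf_union]; exact .par (disjoint_ctxOf.mpr hd) hP.typed hR.typed,
    hP.admissible.par hR.admissible ht⟩

theorem lmapDomain_eq_sum (f : Proc → Proc) (D : QDist S) :
    Finsupp.lmapDomain (QMat ↥S) ℂ f D = ∑ P ∈ D.support, Finsupp.single (f P) (D P) := by
  rw [Finsupp.lmapDomain_apply, Finsupp.mapDomain, Finsupp.sum]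

theorem next_lmapDomain (f : Proc → Proc) (D : QDist S) :
    next μ s (Finsupp.lmapDomain (QMat ↥S) ℂ f D) = ∑ P ∈ D.support, out μ s (f P) (D P) := by
  rw [lmapDomain_eq_sum, map_sum]
  exact Finset.sum_congr rfl fun P _ => next_single _ _ _ _

theorem next_parMap (R : Proc) (D : QDist S) :
    next μ s (parMap R D) = ∑ P ∈ D.support, out μ s (.par P R) (D P) :=
  next_lmapDomain _ D

theorem QGood.parMap {D : QDist S} (h : QGood T D) (hR : Good V R) (hd : Disjoint T V)
    (ht : ∀ P ∈ D.support, Disjoint P.tags R.tags) : QGood (T ∪ V) (LqCCS.parMap R D) := by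
  rw [LqCCS.parMap, lmapDomain_eq_sum]
  exact QGood.sum fun P hP => QGood.single (h.posSemidef P)
    fun _ => (h.good P hP).par hR hd (ht P hP)

/-- A scheduler that avoids the tags of `R` rules out a move of `R` and a synchronization. -/
theorem out_par_left (hT : T ⊆ S) (hV : V ⊆ S) (hP : Good T P) (hR : Good V R)
    (hd : Disjoint T V) (ht : Disjoint P.tags R.tags) (hs : Disjoint s.tags R.tags)
    (hμ : ¬ μ.Steals R) {ρ : QMat ↥S} (hρ : ρ.PosSemidef) :
    out μ s (.par P R) ρ = parMap R (out μ s P ρ) := by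
  by_cases h : ∃ F, Sh (S := S) P μ s F
  · obtain ⟨F, hF⟩ := h
    rw [hF.out_eq hT hP hρ, (hF.parL hμ).out_eq (Finset.union_subset hT hV) (hP.par hR hd ht) hρ]
    rfl
  · rw [out_eq_zero fun F hF => h ⟨F, hF⟩, out_eq_zero, LinearMap.zero_apply, map_zero]
    intro F hF
    rcases hF.par_inv with ⟨F', hF, _⟩ | ⟨F', hF, _⟩ | ⟨t, u, α, P', Q', _, rfl, _, _, hF, _⟩
    · exact h ⟨_, hF⟩
    · obtain ⟨t, ht'⟩ := s.tags_nonempty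
      exact Finset.disjoint_left.mp hs ht' (hF.tags_subset ht')
    · exact disjoint_elim hs u (by simp [Sched.tags])
        (hF.tags_subset (by simp [Sched.tags]))

theorem out_par_left_of_steals (hs : Disjoint s.tags R.tags) (hμ : μ.Steals R) :
    out (S := S) μ s (.par P R) = 0 := by
  refine out_eq_zero fun F hF => ?_
  rcases hF.par_inv with ⟨F', _, hF, _⟩ | ⟨F', hF, _⟩ | ⟨t, u, α, P', Q', _, rfl, _, _, hF, _⟩
  · exact hF hμ
  · obtain ⟨t, ht'⟩ := s.tags_nonempty
    exact Finset.disjoint_left.mp hs ht' (hF.tags_subset ht')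
  · exact disjoint_elim hs u (by simp [Sched.tags])
      (hF.tags_subset (by simp [Sched.tags]))

theorem out_par_right (hT : T ⊆ S) (hV : V ⊆ S) (hP : Good T P) (hR : Good V R)
    (hd : Disjoint T V) (ht : Disjoint P.tags R.tags) (hμ : ¬ μ.Steals P)
    {F : QMat ↥S →ₗ[ℂ] QDist S} (hF : Sh R μ s F) {ρ : QMat ↥S} (hρ : ρ.PosSemidef) :
    out μ s (.par P R) ρ = Finsupp.lmapDomain (QMat ↥S) ℂ (fun Q => .par P Q) (F ρ) := by
  rw [(hF.parR hμ).out_eq (Finset.union_subset hT hV) (hP.par hR hd ht) hρ]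
  rfl

theorem out_par_right_eq_zero (ht : Disjoint P.tags R.tags) (hs : s.tags ⊆ R.tags)
    (h : μ.Steals P ∨ ∀ F, ¬ Sh (S := S) R μ s F) : out (S := S) μ s (.par P R) = 0 := by
  refine out_eq_zero fun F hF => ?_
  rcases hF.par_inv with ⟨F', hF, _⟩ | ⟨F', hF, hμ, _⟩ | ⟨t, u, α, P', Q', _, rfl, _, hF, _, _⟩
  · obtain ⟨t, ht'⟩ := s.tags_nonempty
    exact Finset.disjoint_left.mp ht (hF.tags_subset ht') (hs ht')
  · rcases h with h | h
    · exact hμ h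
    · exact h _ hF
  · exact disjoint_elim ht t (hF.tags_subset (by simp [Sched.tags]))
      (hs (by simp [Sched.tags]))

/-- In a synchronization the first tag is that of the left component, which here is `P`. -/
theorem out_par_swapped {t u : Tag} (ht : Disjoint P.tags R.tags) (h1 : t ∈ R.tags)
    (h2 : u ∉ R.tags) : out (S := S) μ (.two t u) (.par P R) = 0 := by
  refine out_eq_zero fun F hF => ?_
  rcases hF.par_inv with ⟨F', hF, _⟩ | ⟨F', hF, hμ, _⟩ | ⟨t', u', α, P', Q', _, e, _, hF, _, _⟩
  · exact disjoint_elim ht t (hF.tags_subset (by simp [Sched.tags])) h1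
  · exact h2 (hF.tags_subset (by simp [Sched.tags]))
  · obtain ⟨rfl, rfl⟩ : t = t' ∧ u = u' := by simpa using e
    exact disjoint_elim ht t (hF.tags_subset (by simp [Sched.tags])) h1

theorem Sh.synch_inv {t u : Tag} {F : QMat ↥S →ₗ[ℂ] QDist S} (ht : Disjoint P.tags R.tags)
    (h1 : t ∉ R.tags) (h2 : u ∈ R.tags) (hF : Sh (.par P R) μ (.two t u) F) :
    μ = .tau ∧ ∃ α P' R', α ≠ .tau ∧ Sh (S := S) P α (.one t) (Finsupp.lsingle P') ∧
      Sh (S := S) R α.dual (.one u) (Finsupp.lsingle R') := by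
  rcases hF.par_inv with ⟨F', hF, _⟩ | ⟨F', hF, hμ, _⟩ |
    ⟨t', u', α, P', Q', hμ, e, hα, hF, hF', _⟩
  · exact (disjoint_elim ht u (hF.tags_subset (by simp [Sched.tags])) h2).elim
  · exact (h1 (hF.tags_subset (by simp [Sched.tags]))).elim
  · obtain ⟨rfl, rfl⟩ : t = t' ∧ u = u' := by simpa using e
    exact ⟨hμ, α, P', Q', hα, hF, hF'⟩

/-- If `P` sends, its action is determined. If it receives, its partner sends and fixes the value.
-/
theorem Sh.synch_unique {t u : Tag} {F G F' G' : QMat ↥S →ₗ[ℂ] QDist S} {α β : Act} (hT : T ⊆ S)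
    (hV : V ⊆ S) (hP : Good T P) (hR : Good V R) (h1 : Sh P α (.one t) F)
    (h2 : Sh R α.dual (.one u) G) (h3 : Sh P β (.one t) F') (h4 : Sh R β.dual (.one u) G') :
    α = β := by
  rcases h1.deterministic h3 hT hP with h | ⟨c, v, w, rfl, rfl⟩
  · exact h
  · rcases h2.deterministic h4 hV hR with h | ⟨_, _, _, e, _⟩
    · exact Act.dual_injective h
    · cases e

/-- Visible actions leave the weight unchanged, so a synchronization is the visible move of `P` with
`R` replaced by `R'`. If `P` cannot perform `α`, `huniq` excludes every other synchronization. -/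
theorem out_par_synch {t u : Tag} {α : Act} {R' : Proc} (hT : T ⊆ S) (hV : V ⊆ S) (hP : Good T P)
    (hR : Good V R) (hd : Disjoint T V) (ht : Disjoint P.tags R.tags) (h2 : u ∈ R.tags)
    (h1 : t ∉ R.tags) (hα : α ≠ .tau) (hR' : Sh (S := S) R α.dual (.one u) (Finsupp.lsingle R'))
    (huniq : ∀ β P' R', Sh (S := S) P β (.one t) (Finsupp.lsingle P') →
      Sh (S := S) R β.dual (.one u) (Finsupp.lsingle R') → β = α)
    {ρ : QMat ↥S} (hρ : ρ.PosSemidef) :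
    out .tau (.two t u) (.par P R) ρ = parMap R' (out α (.one t) P ρ) := by
  by_cases h : ∃ F, Sh (S := S) P α (.one t) F
  · obtain ⟨F, hF⟩ := h
    obtain ⟨_, P', _, rfl⟩ := hF.visible hα
    rw [hF.out_eq hT hP hρ,
      (hF.synch hα hR').out_eq (Finset.union_subset hT hV) (hP.par hR hd ht) hρ]
    exact (parMap_single _ _ _).symm
  · rw [out_eq_zero fun F hF => h ⟨F, hF⟩, out_eq_zero, LinearMap.zero_apply, map_zero]
    intro F hF
    obtain ⟨_, β, P', R'', hβ, h3, h4⟩ := hF.synch_inv ht h1 h2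
    obtain rfl := huniq β P' R'' h3 h4
    exact h ⟨_, h3⟩

theorem Act.Enabled.after_dual {α : Act} (hα : α ≠ .tau) (h : α.Enabled S T)
    (h' : α.dual.Enabled S V) (hd : Disjoint T V) :
    Disjoint (α.after T) (α.dual.after V) ∧ T ∪ V = α.after T ∪ α.dual.after V := by
  cases α with
  | tau => exact absurd rfl hα
  | send c v => exact after_synch h h' hd
  | recv c v =>
    obtain ⟨h1, h2⟩ := after_synch h' h hd.symm
    exact ⟨h1.symm, by rw [Finset.union_comm, h2, Finset.union_comm]; rfl⟩

end

/-! ### Labelled bisimilarity is a congruence -/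

section

variable {S T U V : Finset Qubit} {μ : Act} {s : Sched} {D E : QDist S}

/-- The empty quantum distribution has every type, which is why the arguments below treat it apart.
-/
theorem QDist.HasType.unique (h : D.HasType T) (h' : D.HasType U) (h0 : D ≠ 0) : T = U := by
  obtain ⟨P, hP⟩ := Finsupp.support_nonempty_iff.mpr h0
  exact ctxOf_injective ((h.2 P hP).unique (h'.2 P hP))

theorem QGood.hasType (h : QGood T D) (hT : T ⊆ S) : D.HasType T :=
  ⟨hT, fun P hP => (h.good P hP).typed⟩

theorem LabBisimilar.isQDist (h : LabBisimilar D E) : IsQDist D ∧ IsQDist E := by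
  obtain ⟨R, hR, h⟩ := h
  exact hR.dist _ _ h

/-- The matching move is forced, as it can only be the one to `next μ s E`. -/
theorem LabBisimilar.next (h : LabBisimilar D E) (hT : T ⊆ S) (hD : QGood T D) (hE : QGood T E)
    (μ : Act) (s : Sched) : LabBisimilar (next μ s D) (LqCCS.next μ s E) := by
  have hD' := h.isQDist.1
  obtain ⟨R, hR, h⟩ := h
  obtain ⟨E', hE', h'⟩ := (hR.closed _ _ h s μ).1 _ (hD.qmove_next hT hD'.2.1 μ s)
  rw [hE'.eq_next hT hE.good] at h'
  exact ⟨R, hR, h'⟩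

theorem LabBisimilar.onEnv (h : LabBisimilar D E) (hD : D.HasType T) (hE : E.HasType T)
    (F : SuperOp ↥(S \ T)) : LabBisimilar (F.onEnv D) (F.onEnv E) := by
  obtain ⟨R, hR, h⟩ := h
  exact ⟨R, hR, hR.superOp _ _ h T hD hE F⟩

/-- A bisimulation grants the equality at some common type; that type is unique unless `D` and `E`
are both zero. -/
theorem LabBisimilar.env_eq (h : LabBisimilar D E) (hD : D.HasType T) (hE : E.HasType T) :
    D.env T = E.env T := by
  obtain ⟨R, hR, h⟩ := h
  obtain ⟨T', hD', hE', e⟩ := hR.env _ _ h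
  by_cases h0 : D = 0
  · by_cases h1 : E = 0
    · rw [h0, h1]
    · rwa [hE'.unique hE h1] at e
  · rwa [hD'.unique hD h0] at e

theorem LabBisimilar.exists_hasType (h : LabBisimilar D E) : ∃ T, D.HasType T ∧ E.HasType T := by
  obtain ⟨R, hR, h⟩ := h
  exact hR.typed _ _ h

theorem LabBisimilar.trace_eq (h : LabBisimilar D E) : (qmass D).trace = (qmass E).trace := by
  obtain ⟨T, hD, hE⟩ := h.exists_hasType
  rw [← trace_ptrace hD.1, ← trace_ptrace hD.1]
  exact congrArg Matrix.trace (h.env_eq hD hE)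

/-! ### Superoperators on the environment. -/

theorem onEnv_apply (F : SuperOp ↥(S \ T)) (D : QDist S) (P : Proc) :
    F.onEnv D P = krausMap (envIncl S T) F.kraus (D P) := by
  rw [krausMap_apply]
  exact Finsupp.mapRange_apply

theorem onEnv_zero (F : SuperOp ↥(S \ T)) : F.onEnv (0 : QDist S) = 0 := by
  ext1 P
  rw [onEnv_apply]
  simp

theorem onEnv_add (F : SuperOp ↥(S \ T)) (D E : QDist S) :
    F.onEnv (D + E) = F.onEnv D + F.onEnv E := by
  ext1 P
  simp [onEnv_apply]

theorem onEnv_single (F : SuperOp ↥(S \ T)) (P : Proc) (ρ : QMat ↥S) :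
    F.onEnv (Finsupp.single P ρ) = Finsupp.single P (krausMap (envIncl S T) F.kraus ρ) := by
  rw [krausMap_apply]
  exact Finsupp.mapRange_single

theorem onEnv_eq_sum (F : SuperOp ↥(S \ T)) (D : QDist S) :
    F.onEnv D = ∑ P ∈ D.support, Finsupp.single P (krausMap (envIncl S T) F.kraus (D P)) := by
  induction D using Finsupp.induction_linear with
  | zero => simp [onEnv_zero]
  | add D E hD hE =>
    classical
    rw [onEnv_add, hD, hE]
    exact (Finsupp.sum_add_index' (f := D) (g := E)
      (h := fun P ρ => (Finsupp.single P (krausMap (envIncl S T) F.kraus ρ) : QDist S))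
      (by simp) (by simp)).symm
  | single P ρ =>
    rw [onEnv_single]
    exact (Finsupp.sum_single_index (a := P) (b := ρ)
      (h := fun P ρ => (Finsupp.single P (krausMap (envIncl S T) F.kraus ρ) : QDist S))
      (by simp)).symm

theorem support_onEnv (F : SuperOp ↥(S \ T)) (D : QDist S) : (F.onEnv D).support ⊆ D.support :=
  Finsupp.support_mapRange

theorem QGood.onEnv (h : QGood U D) (F : SuperOp ↥(S \ T)) : QGood U (F.onEnv D) := by
  refine ⟨fun P => ?_, fun P hP => h.good P (support_onEnv F D hP)⟩
  rw [onEnv_apply, krausMap_apply]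
  exact applyKraus_posSemidef _ _ (h.posSemidef P)

theorem trace_mul_nonneg {ι : Type} [Fintype ι] [DecidableEq ι] {A ρ : QMat ι}
    (hA : A.PosSemidef) (hρ : ρ.PosSemidef) : 0 ≤ (A * ρ).trace.re := by
  obtain ⟨B, rfl⟩ := exists_eq_conjTranspose_mul_self hA
  rw [← trace_conj]
  exact trace_re_nonneg (conj_posSemidef B hρ)

theorem trace_onEnv_le (h : ∀ P, (D P).PosSemidef) (F : SuperOp ↥(S \ T)) :
    (qmass (F.onEnv D)).trace.re ≤ (qmass D).trace.re := by
  rw [onEnv_eq_sum, ← qmassL_apply, map_sum, Matrix.trace_sum, trace_qmass, Complex.re_sum,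
    Complex.re_sum]
  refine Finset.sum_le_sum fun P _ => ?_
  rw [qmassL_apply, qmass_single, krausMap_apply, trace_applyKraus (envIncl_injective S T)]
  have := trace_mul_nonneg (pad_posSemidef (envIncl_injective S T) F.nonincreasing) (h P)
  rw [pad_sub, pad_one, sub_mul, one_mul, Matrix.trace_sub, Complex.sub_re] at this
  linarith

theorem IsQDist.onEnv (h : IsQDist D) (hD : D.HasType U) (F : SuperOp ↥(S \ T)) :
    IsQDist (F.onEnv D) :=
  ((h.qgood hD).onEnv F).isQDist ((trace_onEnv_le h.1 F).trans h.2.1)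

/-- A superoperator on the qubits outside `U`, on the larger set of those outside `T`. -/
def SuperOp.extend (hTU : T ⊆ U) (F : SuperOp ↥(S \ U)) : SuperOp ↥(S \ T) where
  len := F.len
  kraus i := pad (incl (Finset.sdiff_subset_sdiff subset_rfl hTU)) (F.kraus i)
  nonincreasing := by
    rw [pad_sum_adjoint_mul (incl_injective _),
      ← pad_one (incl (Finset.sdiff_subset_sdiff subset_rfl hTU)), ← pad_sub]
    exact pad_posSemidef (incl_injective _) F.nonincreasing

theorem onEnv_extend (hTU : T ⊆ U) (F : SuperOp ↥(S \ U)) (D : QDist S) :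
    (F.extend hTU).onEnv D = F.onEnv D := by
  ext1 P
  rw [onEnv_apply, onEnv_apply, krausMap, krausMap]
  simp only [SuperOp.extend, pad_pad (envIncl_injective S T)]
  rfl

theorem onEnv_parMap (R : Proc) (F : SuperOp ↥(S \ T)) (D : QDist S) :
    F.onEnv (parMap R D) = parMap R (F.onEnv D) := by
  induction D using Finsupp.induction_linear with
  | zero => simp [onEnv_zero]
  | add D E hD hE => rw [map_add, onEnv_add, hD, hE, onEnv_add, map_add]
  | single P ρ => rw [parMap_single, onEnv_single, onEnv_single, parMap_single]

/-- The superoperator with a single Kraus operator, on qubits outside `T`. -/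
def singleKraus (hV : V ⊆ S \ T) (K : QMat ↥V) (hK : (1 - Kᴴ * K).PosSemidef) :
    SuperOp ↥(S \ T) where
  len := 1
  kraus _ := pad (incl hV) K
  nonincreasing := by
    rw [pad_sum_adjoint_mul (incl_injective _), ← pad_one (incl hV), ← pad_sub]
    simpa using pad_posSemidef (incl_injective hV) hK

theorem krausMap_singleKraus (hV : V ⊆ S \ T) (hVS : V ⊆ S) (K : QMat ↥V)
    (hK : (1 - Kᴴ * K).PosSemidef) :
    krausMap (envIncl S T) (singleKraus hV K hK).kraus = conj (pad (incl hVS) K) := by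
  have : krausMap (envIncl S T) (singleKraus hV K hK).kraus
      = ∑ _i : Fin 1, conj (pad (envIncl S T) (pad (incl hV) K)) := rfl
  rw [this, Fin.sum_univ_one, pad_pad (envIncl_injective S T)]
  rfl

/-- Sums of related quantum distributions in parallel contexts, with joint register `U`. -/
inductive ParClosure (U : Finset Qubit) : QDist S → QDist S → Prop where
  | zero : ParClosure U 0 0
  | add {D E D' E' : QDist S} : ParClosure U D E → ParClosure U D' E' →
      ParClosure U (D + D') (E + E')
  | par {T V : Finset Qubit} {R : Proc} {D E : QDist S} : Disjoint T V → T ∪ V = U →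
      Good V R → QGood T D → QGood T E → (∀ P ∈ D.support, Disjoint P.tags R.tags) →
      (∀ P ∈ E.support, Disjoint P.tags R.tags) → LabBisimilar D E →
      ParClosure U (parMap R D) (parMap R E)

theorem ParClosure.sum {α : Type} {A : Finset α} {D E : α → QDist S}
    (h : ∀ a ∈ A, ParClosure U (D a) (E a)) : ParClosure U (∑ a ∈ A, D a) (∑ a ∈ A, E a) := by
  classical
  induction A using Finset.induction_on with
  | empty => exact .zero
  | insert a A ha ih =>
    rw [Finset.sum_insert ha, Finset.sum_insert ha]
    exact .add (h a (Finset.mem_insert_self a A))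
      (ih fun b hb => h b (Finset.mem_insert_of_mem hb))

theorem ParClosure.qgood (h : ParClosure U D E) : QGood U D ∧ QGood U E := by
  induction h with
  | zero => exact ⟨QGood.zero, QGood.zero⟩
  | add _ _ ih1 ih2 => exact ⟨ih1.1.add ih2.1, ih1.2.add ih2.2⟩
  | par hd e hR hD hE ht ht' _ =>
    subst e
    exact ⟨hD.parMap hR hd ht, hE.parMap hR hd ht'⟩

/-- A parallel component takes qubits away from the environment and does not change the mass, so the
equality follows by tracing out more. -/
theorem ParClosure.ptrace_eq (h : ParClosure U D E) (hU : U ⊆ S) :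
    ptrace U (qmass D) = ptrace U (qmass E) := by
  induction h with
  | zero => rfl
  | add _ _ ih1 ih2 =>
    rw [ptrace_eq_iff hU] at ih1 ih2 ⊢
    intro A
    rw [qmass_add, qmass_add, mul_add, mul_add, Matrix.trace_add, Matrix.trace_add, ih1, ih2]
  | par hd e hR hD hE ht ht' h =>
    subst e
    rw [parMap, qmass_mapProc, qmass_mapProc]
    have hT := Finset.union_subset_left hU
    exact ptrace_eq_mono Finset.subset_union_left hU (h.env_eq (hD.hasType hT) (hE.hasType hT))

theorem ParClosure.onEnv (h : ParClosure U D E) (hU : U ⊆ S) (F : SuperOp ↥(S \ U)) :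
    ParClosure U (F.onEnv D) (F.onEnv E) := by
  induction h with
  | zero =>
    rw [onEnv_zero]
    exact .zero
  | add _ _ ih1 ih2 =>
    rw [onEnv_add, onEnv_add]
    exact .add ih1 ih2
  | @par T V R D E hd e hR hD hE ht ht' h =>
    have hTU : T ⊆ U := e ▸ Finset.subset_union_left
    rw [onEnv_parMap, onEnv_parMap]
    refine .par hd e hR (hD.onEnv F) (hE.onEnv F) (fun P hP => ht P (support_onEnv F D hP))
      (fun P hP => ht' P (support_onEnv F E hP)) ?_
    rw [← onEnv_extend hTU, ← onEnv_extend hTU]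
    exact h.onEnv (hD.hasType (hTU.trans hU)) (hE.hasType (hTU.trans hU)) _

/-- The hypotheses on a quantum distribution in parallel with a process. -/
structure ParGood (T V : Finset Qubit) (R : Proc) (D : QDist S) : Prop where
  disjoint : Disjoint T V
  left : T ⊆ S
  right : V ⊆ S
  good : Good V R
  qgood : QGood T D
  tags : ∀ P ∈ D.support, Disjoint P.tags R.tags

variable {R : Proc}

/-! ### Moves of a quantum distribution in a parallel context. -/

theorem ParGood.next_left (h : ParGood T V R D) (hs : Disjoint s.tags R.tags)
    (hμ : ¬ μ.Steals R) : next μ s (parMap R D) = parMap R (next μ s D) := by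
  rw [next_parMap, next_apply, map_sum]
  exact Finset.sum_congr rfl fun P hP => out_par_left h.left h.right (h.qgood.good P hP) h.good
    h.disjoint (h.tags P hP) hs hμ (h.qgood.posSemidef P)

theorem next_left_of_steals (hs : Disjoint s.tags R.tags) (hμ : μ.Steals R) (D : QDist S) :
    next μ s (parMap R D) = 0 := by
  rw [next_parMap]
  exact Finset.sum_eq_zero fun P _ => by
    rw [out_par_left_of_steals hs hμ, LinearMap.zero_apply]

/-- The qubits of `R` lie in the environment of `D`. A move of `R` is thus a sum, over its Kraus
operators, of superoperators applied to `D`, each with its own continuation of `R`. -/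
theorem ParGood.next_right (h : ParGood T V R D) (hμ : ¬ ∃ c q, μ = .recv c (.qubit q) ∧ q ∈ T)
    {n : ℕ} {K : Fin n → QMat ↥V} {Q : Fin n → Proc} {F : QMat ↥S →ₗ[ℂ] QDist S}
    (hF : Sh R μ s F)
    (hFK : ∀ ρ, F ρ = ∑ i, Finsupp.single (Q i) (conj (pad (incl h.right) (K i)) ρ))
    (hV : V ⊆ S \ T) (hK : ∀ i, (1 - (K i)ᴴ * K i).PosSemidef) :
    next μ s (parMap R D) = ∑ i, parMap (Q i) ((singleKraus hV (K i) (hK i)).onEnv D) := by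
  rw [next_parMap]
  simp only [onEnv_eq_sum, map_sum, krausMap_singleKraus hV h.right, parMap_single]
  rw [Finset.sum_comm]
  refine Finset.sum_congr rfl fun P hP => ?_
  have hP' := h.qgood.good P hP
  rw [out_par_right h.left h.right hP' h.good h.disjoint (h.tags P hP)
    ((Act.steals_iff hP'.typed).not.mpr hμ) hF (h.qgood.posSemidef P), hFK, map_sum]
  exact Finset.sum_congr rfl fun i _ => by
    rw [Finsupp.lmapDomain_apply, Finsupp.mapDomain_single]

theorem ParGood.next_right_eq_zero (h : ParGood T V R D) (hs : s.tags ⊆ R.tags)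
    (hμ : (∃ c q, μ = .recv c (.qubit q) ∧ q ∈ T) ∨ ∀ F, ¬ Sh (S := S) R μ s F) :
    next μ s (parMap R D) = 0 := by
  rw [next_parMap]
  refine Finset.sum_eq_zero fun P hP => ?_
  rw [out_par_right_eq_zero (h.tags P hP) hs, LinearMap.zero_apply]
  exact hμ.imp_left (Act.steals_iff (h.qgood.good P hP).typed).mpr

/-- The actions of the processes in `A` that can synchronize with `R`. -/
def synchActs (S : Finset Qubit) (A : Finset Proc) (R : Proc) (t u : Tag) : Set Act :=
  {α | ∃ P ∈ A, α ≠ .tau ∧ ∃ P' R', Sh (S := S) P α (.one t) (Finsupp.lsingle P') ∧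
    Sh (S := S) R α.dual (.one u) (Finsupp.lsingle R')}

/-- Each process contributes at most one action, although inputs range over infinitely many values.
-/
theorem finite_synchActs {A : Finset Proc} {t u : Tag} (hT : T ⊆ S) (hV : V ⊆ S)
    (hA : ∀ P ∈ A, Good T P) (hR : Good V R) : (synchActs S A R t u).Finite := by
  have : synchActs S A R t u = ⋃ P ∈ A, {α | α ≠ .tau ∧ ∃ P' R',
      Sh (S := S) P α (.one t) (Finsupp.lsingle P') ∧
      Sh (S := S) R α.dual (.one u) (Finsupp.lsingle R')} := by
    ext α
    simp only [synchActs, Set.mem_iUnion, Set.mem_ofPred_eq, exists_prop]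
  rw [this]
  refine A.finite_toSet.biUnion fun P hP => Set.Subsingleton.finite ?_
  rintro α ⟨_, P', R', h1, h2⟩ β ⟨_, P'', R'', h3, h4⟩
  exact Sh.synch_unique hT hV (hA P hP) hR h1 h2 h3 h4

/-- Each process of `D` synchronizes with `R` through at most one action, so at most one summand
sees it. `W` may be larger than necessary, so that the same sum can serve two quantum distributions.
-/
theorem ParGood.next_synch (h : ParGood T V R D) {t u : Tag} (h1 : t ∉ R.tags) (h2 : u ∈ R.tags)
    {W : Finset Act} (hW : synchActs S D.support R t u ⊆ W) {r : Act → Proc}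
    (hr : ∀ α ∈ W, α ≠ .tau ∧ Sh (S := S) R α.dual (.one u) (Finsupp.lsingle (r α))) :
    next .tau (.two t u) (parMap R D) = ∑ α ∈ W, parMap (r α) (next α (.one t) D) := by
  rw [next_parMap]
  simp only [next_apply, map_sum]
  rw [Finset.sum_comm]
  refine Finset.sum_congr rfl fun P hP => ?_
  have hP' := h.qgood.good P hP
  have ht := h.tags P hP
  by_cases hex : ∃ α P' R', α ≠ .tau ∧ Sh (S := S) P α (.one t) (Finsupp.lsingle P') ∧
      Sh (S := S) R α.dual (.one u) (Finsupp.lsingle R')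
  · obtain ⟨α, P', R', hα, h3, h4⟩ := hex
    have hαW : α ∈ W := hW ⟨P, hP, hα, P', R', h3, h4⟩
    rw [Finset.sum_eq_single_of_mem α hαW]
    · exact out_par_synch h.left h.right hP' h.good h.disjoint ht h2 h1 hα (hr α hαW).2
        (fun β P'' R'' h5 h6 => Sh.synch_unique h.left h.right hP' h.good h5 h6 h3 h4)
        (h.qgood.posSemidef P)
    · intro β hβ hne
      rw [out_eq_zero, LinearMap.zero_apply, map_zero]
      intro F hF
      exact hne (Sh.synch_unique h.left h.right hP' h.good hF (hr β hβ).2 h3 h4)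
  · rw [out_eq_zero, LinearMap.zero_apply]
    · refine (Finset.sum_eq_zero fun α hα => ?_).symm
      rw [out_eq_zero, LinearMap.zero_apply, map_zero]
      intro F hF
      obtain ⟨_, P', _, rfl⟩ := hF.visible (hr α hα).1
      exact hex ⟨α, P', r α, (hr α hα).1, hF, (hr α hα).2⟩
    · intro F hF
      obtain ⟨_, α, P', R', hα, h3, h4⟩ := hF.synch_inv ht h1 h2
      exact hex ⟨α, P', R', hα, h3, h4⟩

theorem ParGood.next_two_eq_zero (h : ParGood T V R D) {t u : Tag}
    (h' : (t ∈ R.tags ∧ u ∉ R.tags) ∨ (t ∉ R.tags ∧ u ∈ R.tags ∧ μ ≠ .tau)) :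
    next μ (.two t u) (parMap R D) = 0 := by
  rw [next_parMap]
  refine Finset.sum_eq_zero fun P hP => ?_
  have ht := h.tags P hP
  rcases h' with ⟨h1, h2⟩ | ⟨h1, h2, hμ⟩
  · rw [out_par_swapped ht h1 h2, LinearMap.zero_apply]
  · rw [out_eq_zero fun F hF => hμ (hF.synch_inv ht h1 h2).1, LinearMap.zero_apply]

theorem Sh.good_lsingle {P P' : Proc} (h : Sh (S := S) P μ s (Finsupp.lsingle P')) (hT : T ⊆ S)
    (hP : Good T P) : Good (μ.after T) P' ∧ P'.tags ⊆ P.tags := by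
  obtain ⟨ρ, hρ⟩ := exists_isDensity ↥S
  exact h.good_of_mem_support hT hP hρ.1 (by simp [hρ.ne_zero])

/-- The scheduler decides between the hole, the context and a synchronization in the same way for
`D` and `E`. Each case expresses both results through operations under which labelled bisimilarity
is closed. -/
theorem ParClosure.next (h : ParClosure U D E) (hU : U ⊆ S) (μ : Act) (s : Sched) :
    ParClosure (μ.after U) (next μ s D) (LqCCS.next μ s E) := by
  induction h with
  | zero =>
    rw [map_zero]
    exact .zero
  | add _ _ ih1 ih2 =>
    rw [map_add, map_add]
    exact .add ih1 ih2
  | @par T V R D E hd e hR hD hE ht ht' h =>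
    subst e
    have hT := Finset.union_subset_left hU
    have hV := Finset.union_subset_right hU
    have gD : ParGood T V R D := ⟨hd, hT, hV, hR, hD, ht⟩
    have gE : ParGood T V R E := ⟨hd, hT, hV, hR, hE, ht'⟩
    have hleft : Disjoint s.tags R.tags → ParClosure (μ.after (T ∪ V))
        (LqCCS.next μ s (parMap R D)) (LqCCS.next μ s (parMap R E)) := by
      intro hs
      by_cases hμ : μ.Steals R
      · rw [next_left_of_steals hs hμ, next_left_of_steals hs hμ]
        exact .zero
      · rw [gD.next_left hs hμ, gE.next_left hs hμ]
        -- When a result is nonzero, some process performs `μ`, so `μ` is enabled and changes the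
        -- register of the hole only.
        by_cases h0 : LqCCS.next μ s D = 0 ∧ LqCCS.next μ s E = 0
        · rw [h0.1, h0.2, map_zero]
          exact .zero
        have hen : μ.Enabled S T := by
          by_cases h1 : LqCCS.next μ s D = 0
          · obtain ⟨P, hP⟩ := Finsupp.support_nonempty_iff.mpr fun h2 => h0 ⟨h1, h2⟩
            exact (hE.exists_of_mem_support_next hT hP).choose_spec.2.2.1
          · obtain ⟨P, hP⟩ := Finsupp.support_nonempty_iff.mpr h1
            exact (hD.exists_of_mem_support_next hT hP).choose_spec.2.2.1
        obtain ⟨h1, h2, _⟩ := hen.after_union hd ((Act.steals_iff hR.typed).not.mp hμ)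
        refine .par h1 h2.symm hR (hD.next hT μ s) (hE.next hT μ s) (fun Q hQ => ?_)
          (fun Q hQ => ?_) (h.next hT hD hE μ s)
        · obtain ⟨P, hP, hQP, _⟩ := hD.exists_of_mem_support_next hT hQ
          exact (ht P hP).mono_left hQP
        · obtain ⟨P, hP, hQP, _⟩ := hE.exists_of_mem_support_next hT hQ
          exact (ht' P hP).mono_left hQP
    have hright : s.tags ⊆ R.tags → ParClosure (μ.after (T ∪ V))
        (LqCCS.next μ s (parMap R D)) (LqCCS.next μ s (parMap R E)) := by
      intro hs
      by_cases hμ : (∃ c q, μ = .recv c (.qubit q) ∧ q ∈ T) ∨ ∀ F, ¬ Sh (S := S) R μ s F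
      · rw [gD.next_right_eq_zero hs hμ, gE.next_right_eq_zero hs hμ]
        exact .zero
      · push Not at hμ
        obtain ⟨hμ, F, hF⟩ := hμ
        replace hμ : ¬ ∃ c q, μ = .recv c (.qubit q) ∧ q ∈ T := by
          rintro ⟨c, q, h1, h2⟩
          exact hμ c q h1 h2
        obtain ⟨n, K, Q, hK, hFK⟩ := hF.exists_kraus hR.typed hV
        have hK' := posSemidef_one_sub_of_sum_eq_one K hK
        have hVT : V ⊆ S \ T := fun q hq =>
          Finset.mem_sdiff.mpr ⟨hV hq, fun hq' => Finset.disjoint_left.mp hd hq' hq⟩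
        rw [gD.next_right hμ hF hFK hVT hK', gE.next_right hμ hF hFK hVT hK']
        refine ParClosure.sum fun i _ => ?_
        -- The continuation `Q i` is known to be well typed only if it is reached with nonzero
        -- weight. A nonzero `K i` ensures this from the weight `1`, as `K i * (K i)ᴴ` is then
        -- nonzero; a zero `K i` gives a zero summand.
        by_cases h0 : K i = 0
        · have hz : ∀ D : QDist S, (singleKraus hVT (K i) (hK' i)).onEnv D = 0 := by
            intro D
            rw [onEnv_eq_sum, krausMap_singleKraus hVT hV, h0]
            simp [conj_apply]
          rw [hz, hz, map_zero]
          exact .zero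
        · have hQ : Q i ∈ (F 1).support := by
            rw [hFK, Finsupp.mem_support_iff, Finsupp.finsetSum_apply]
            intro h1
            have := eq_zero_of_sum_eq_zero (fun j _ =>
              posSemidef_single (conj_posSemidef _ Matrix.PosSemidef.one)) h1 (Finset.mem_univ i)
            rw [Finsupp.single_eq_same, conj_apply, mul_one,
              Matrix.self_mul_conjTranspose_eq_zero] at this
            -- Padding loses nothing: indices extended by `0` off `V` recover every entry of `K i`.
            refine h0 ?_
            ext a b
            have h2 := congrFun (congrFun this (Function.extend (incl hV) a 0))
              (Function.extend (incl hV) b 0)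
            have hc : ∀ a : Idx ↥V, Function.extend (incl hV) a (0 : Idx ↥S) ∘ incl hV = a :=
              fun a => funext fun k => (incl_injective hV).extend_apply a _ k
            rwa [pad_apply, hc, hc] at h2
            intro q hq
            rw [Function.extend_apply' _ _ _ hq, Function.extend_apply' _ _ _ hq]
          obtain ⟨hg, hQt⟩ := hF.good_of_mem_support hV hR Matrix.PosSemidef.one hQ
          obtain ⟨h1, h2, _⟩ := (hF.enabled hR.typed).after_union hd.symm hμ
          refine .par h1.symm ?_ hg (hD.onEnv _) (hE.onEnv _)
            (fun P hP => (ht P (support_onEnv _ _ hP)).mono_right hQt)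
            (fun P hP => (ht' P (support_onEnv _ _ hP)).mono_right hQt)
            (h.onEnv (hD.hasType hT) (hE.hasType hT) _)
          rw [Finset.union_comm T V, h2, Finset.union_comm]
    cases s with
    | one t =>
      by_cases h1 : t ∈ R.tags
      · exact hright (by simpa [Sched.tags] using h1)
      · exact hleft (by simpa [Sched.tags] using h1)
    | two t u =>
      -- A pair is owned by `R`, or by the hole, or belongs to a synchronization with the hole on
      -- the left; the opposite order is impossible.
      by_cases h1 : t ∈ R.tags <;> by_cases h2 : u ∈ R.tags
      · exact hright (by simpa [Sched.tags, Finset.insert_subset_iff] using ⟨h1, h2⟩)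
      · rw [gD.next_two_eq_zero (Or.inl ⟨h1, h2⟩), gE.next_two_eq_zero (Or.inl ⟨h1, h2⟩)]
        exact .zero
      · by_cases hμ : μ = .tau
        · subst hμ
          classical
          -- The synchronizing actions are collected over both supports, so that the two sums have
          -- the same index set.
          have hA : ∀ P ∈ D.support ∪ E.support, Good T P := by
            intro P hP
            rcases Finset.mem_union.mp hP with hP | hP
            · exact hD.good P hP
            · exact hE.good P hP
          have hfin := finite_synchActs (t := t) (u := u) hT hV hA hR
          have hex : ∀ α, ∃ R', α ∈ hfin.toFinset →
              α ≠ .tau ∧ Sh (S := S) R α.dual (.one u) (Finsupp.lsingle R') := by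
            intro α
            by_cases hα : α ∈ hfin.toFinset
            · obtain ⟨P, _, hne, P', R', _, h3⟩ := hfin.mem_toFinset.mp hα
              exact ⟨R', fun _ => ⟨hne, h3⟩⟩
            · exact ⟨R, fun h => absurd h hα⟩
          choose r hr using hex
          have hsubD : synchActs S D.support R t u ⊆ hfin.toFinset := by
            rintro α ⟨P, hP, h⟩
            exact hfin.mem_toFinset.mpr ⟨P, Finset.mem_union_left _ hP, h⟩
          have hsubE : synchActs S E.support R t u ⊆ hfin.toFinset := by
            rintro α ⟨P, hP, h⟩
            exact hfin.mem_toFinset.mpr ⟨P, Finset.mem_union_right _ hP, h⟩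
          rw [gD.next_synch h1 h2 hsubD hr, gE.next_synch h1 h2 hsubE hr]
          refine ParClosure.sum fun α hα => ?_
          obtain ⟨hne, hα'⟩ := hr α hα
          obtain ⟨P, hP, _, P', _, h3, _⟩ := hfin.mem_toFinset.mp hα
          obtain ⟨hd', e⟩ := Act.Enabled.after_dual hne (h3.enabled (hA P hP).typed)
            (hα'.enabled hR.typed) hd
          obtain ⟨hg, hgt⟩ := hα'.good_lsingle hV hR
          refine .par hd' e.symm hg (hD.next hT _ _) (hE.next hT _ _) (fun Q hQ => ?_)
            (fun Q hQ => ?_) (h.next hT hD hE _ _)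
          · obtain ⟨P, hP, hQP, _⟩ := hD.exists_of_mem_support_next hT hQ
            exact (ht P hP).mono hQP hgt
          · obtain ⟨P, hP, hQP, _⟩ := hE.exists_of_mem_support_next hT hQ
            exact (ht' P hP).mono hQP hgt
        · rw [gD.next_two_eq_zero (Or.inr ⟨h1, h2, hμ⟩), gE.next_two_eq_zero (Or.inr ⟨h1, h2, hμ⟩)]
          exact .zero
      · exact hleft (by simp [Sched.tags, h1, h2])

/-- A relation between quantum distributions with weights and types as required is a labelled
bisimulation as soon as it is closed under the deterministic moves. -/
theorem isLabBisim_of_next {R : QDist S → QDist S → Prop}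
    (dist : ∀ D E, R D E → IsQDist D ∧ IsQDist E) (typed : WellTypedRel R)
    (closed : ∀ D E, R D E → ∀ (s : Sched) (μ : Act), R (LqCCS.next μ s D) (LqCCS.next μ s E))
    (env : EnvPreserving R) (superOp : SuperOpClosed R) : IsLabBisim R := by
  refine ⟨dist, typed, fun D E h s μ => ?_, env, superOp⟩
  obtain ⟨T, hD, hE⟩ := typed D E h
  have hD' := (dist D E h).1
  have hE' := (dist D E h).2
  constructor
  · intro D' h'
    rw [h'.eq_next hD.1 (hD'.qgood hD).good]
    exact ⟨_, (hE'.qgood hE).qmove_next hE.1 hE'.2.1 μ s, closed D E h s μ⟩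
  · intro E' h'
    rw [h'.eq_next hE.1 (hE'.qgood hE).good]
    exact ⟨_, (hD'.qgood hD).qmove_next hD.1 hD'.2.1 μ s, closed D E h s μ⟩

/-- The common register is existentially quantified because it changes with inputs and outputs of
qubits. -/
theorem isLabBisim_parClosure (S : Finset Qubit) :
    IsLabBisim fun D E : QDist S =>
      IsQDist D ∧ IsQDist E ∧ ∃ U, U ⊆ S ∧ ParClosure U D E := by
  refine isLabBisim_of_next (fun D E h => ⟨h.1, h.2.1⟩) ?_ ?_ ?_ ?_
  · rintro D E ⟨_, _, U, hU, h⟩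
    exact ⟨U, h.qgood.1.hasType hU, h.qgood.2.hasType hU⟩
  · rintro D E ⟨hD, hE, U, hU, h⟩ s μ
    have hD' := (h.qgood.1.next hU μ s).isQDist ((h.qgood.1.trace_next_le hU μ s).trans hD.2.1)
    have hE' := (h.qgood.2.next hU μ s).isQDist ((h.qgood.2.trace_next_le hU μ s).trans hE.2.1)
    refine ⟨hD', hE', ?_⟩
    -- If nothing moves, `μ.after U` may leave `S`, but the zero pair has every register.
    by_cases h0 : LqCCS.next μ s D = 0 ∧ LqCCS.next μ s E = 0
    · rw [h0.1, h0.2]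
      exact ⟨∅, Finset.empty_subset S, .zero⟩
    · refine ⟨μ.after U, ?_, h.next hU μ s⟩
      have hen : μ.Enabled S U := by
        by_cases h1 : LqCCS.next μ s D = 0
        · obtain ⟨P, hP⟩ := Finsupp.support_nonempty_iff.mpr fun h2 => h0 ⟨h1, h2⟩
          exact (h.qgood.2.exists_of_mem_support_next hU hP).choose_spec.2.2.1
        · obtain ⟨P, hP⟩ := Finsupp.support_nonempty_iff.mpr h1
          exact (h.qgood.1.exists_of_mem_support_next hU hP).choose_spec.2.2.1
      exact hen.after_subset hU
  · rintro D E ⟨_, _, U, hU, h⟩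
    exact ⟨U, h.qgood.1.hasType hU, h.qgood.2.hasType hU, h.ptrace_eq hU⟩
  · rintro D E ⟨hD, hE, U, hU, h⟩ T hDT hET F
    refine ⟨hD.onEnv hDT F, hE.onEnv hET F, ?_⟩
    by_cases h0 : D = 0 ∧ E = 0
    · rw [h0.1, h0.2, onEnv_zero]
      exact ⟨∅, Finset.empty_subset S, .zero⟩
    · obtain rfl : U = T := by
        by_cases h1 : D = 0
        · exact (h.qgood.2.hasType hU).unique hET fun h2 => h0 ⟨h1, h2⟩
        · exact (h.qgood.1.hasType hU).unique hDT h1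
      exact ⟨U, hU, h.onEnv hU F⟩

theorem IsQDist.parMap (hD : IsQDist D) (hT : D.HasType T) (hR : Good V R) (hd : Disjoint T V)
    (ht : ∀ P ∈ D.support, Disjoint P.tags R.tags) : IsQDist (LqCCS.parMap R D) := by
  refine ((hD.qgood hT).parMap hR hd ht).isQDist ?_
  rw [LqCCS.parMap, qmass_mapProc]
  exact hD.2.1

/-- Labelled bisimilarity is preserved by parallel contexts. -/
theorem LabBisimilar.mapProc {B : Ctx} (h : LabBisimilar D E) (hD : B.QCompatible U T D)
    (hE : B.QCompatible U T E) : LabBisimilar (D.mapProc B.fill) (E.mapProc B.fill) := by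
  obtain ⟨hB, hDT, hU, ht⟩ := hD
  obtain ⟨_, hET, _, ht'⟩ := hE
  cases hB with
  | hole =>
    have hid : ∀ D : QDist S, D.mapProc Ctx.hole.fill = D := fun D => Finsupp.mapDomain_id
    rw [hid, hid]
    exact h
  | @par _ R hR hRty hTU =>
    have hg : Good (U \ T) R := ⟨hRty, hR⟩
    have hd : Disjoint T (U \ T) := Finset.disjoint_sdiff
    refine ⟨_, isLabBisim_parClosure S, h.isQDist.1.parMap hDT hg hd ht,
      h.isQDist.2.parMap hET hg hd ht', U, hU, ?_⟩
    exact .par hd (Finset.union_sdiff_of_subset hTU) hg (h.isQDist.1.qgood hDT)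
      (h.isQDist.2.qgood hET) ht ht' h

/-! ### Labelled bisimilarity is contained in saturated bisimilarity -/

theorem toQ_mapProc_fill (R : Proc) (Δ : Dist S) :
    toQ (Δ.mapProc (Ctx.par R).fill) = parMap R (toQ Δ) :=
  toQ_mapProc _ Δ

theorem mass_mapProc (f : Proc → Proc) (Δ : Dist S) : mass (Δ.mapProc f) = mass Δ := by
  rw [mass, mass, Dist.mapProc, Finsupp.sum_mapDomain_index] <;> simp

theorem IsDist.mapProc {B : Ctx} {Δ : Dist S} (h : IsDist Δ) (hB : B.Compatible U T Δ) :
    DGood U (Δ.mapProc B.fill) := by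
  obtain ⟨hB, hΔ, hU, ht⟩ := hB
  intro C hC
  obtain ⟨C', hC', rfl⟩ := Dist.mem_support_mapProc hC
  obtain ⟨h1, h2⟩ := h.dgood hΔ C' hC'
  refine ⟨h1, ?_⟩
  cases hB with
  | hole => exact h2
  | @par _ R hR hRty hTU =>
    have := h2.par ⟨hRty, hR⟩ Finset.disjoint_sdiff (ht C' hC')
    rwa [Finset.union_sdiff_of_subset hTU] at this

theorem Ctx.Compatible.toQ {B : Ctx} {Δ : Dist S} (h : B.Compatible U T Δ) :
    B.QCompatible U T (toQ Δ) := by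
  obtain ⟨hB, hΔ, hU, ht⟩ := h
  refine ⟨hB, ⟨hΔ.1, fun P hP => ?_⟩, hU, fun P hP => ?_⟩
  · obtain ⟨σ, hσ⟩ := mem_support_toQ hP
    exact hΔ.2 _ hσ
  · obtain ⟨σ, hσ⟩ := mem_support_toQ hP
    exact ht _ hσ

theorem hasType_of_toQ {Δ : Dist S} (h : IsDist Δ) (hΔ : (toQ Δ).HasType T) : Δ.HasType T :=
  ⟨hΔ.1, fun _ hC => hΔ.2 _ (mem_support_toQ_of_mem (fun C hC => (h.2 C hC).1) hC)⟩

/-- Any move of the second distribution will do, since under `toQ` all of them have the same image.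
Congruence deals with the context. -/
theorem labBisimilar_dmove {Δ Θ Δ' : Dist S} {B : Ctx} (hΔ : IsDist Δ) (hΘ : IsDist Θ)
    (h : LabBisimilar (toQ Δ) (toQ Θ)) (hB : B.Compatible U T Δ) (hB' : B.Compatible U T Θ)
    (hm : DMove (Δ.mapProc B.fill) μ s Δ') :
    ∃ Θ', DMove (Θ.mapProc B.fill) μ s Θ' ∧ IsDist Δ' ∧ IsDist Θ' ∧
      LabBisimilar (toQ Δ') (toQ Θ') := by
  have hU := hB.2.2.1
  have gΔ := hΔ.mapProc hB
  have gΘ := hΘ.mapProc hB'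
  have mΔ : mass (Δ.mapProc B.fill) ≤ 1 := (mass_mapProc _ Δ).trans_le hΔ.1
  have mΘ : mass (Θ.mapProc B.fill) ≤ 1 := (mass_mapProc _ Θ).trans_le hΘ.1
  obtain ⟨Θ', hΘ'⟩ := exists_dmove (Θ.mapProc B.fill) mΘ μ s
  refine ⟨Θ', hΘ', hm.isDist hU gΔ mΔ, hΘ'.isDist hU gΘ mΘ, ?_⟩
  rw [(hm.toQ_eq_next hU gΔ).1, (hΘ'.toQ_eq_next hU gΘ).1]
  have := h.mapProc hB.toQ hB'.toQ
  refine LabBisimilar.next ?_ hU gΔ.toQ gΘ.toQ μ s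
  rw [toQ_mapProc, toQ_mapProc]
  exact this

theorem LabBisimilar.mass_eq {Δ Θ : Dist S} (hΔ : IsDist Δ) (hΘ : IsDist Θ)
    (h : LabBisimilar (toQ Δ) (toQ Θ)) : mass Δ = mass Θ := by
  have := h.trace_eq
  rw [trace_toQ fun C hC => (hΔ.2 C hC).1, trace_toQ fun C hC => (hΘ.2 C hC).1] at this
  exact_mod_cast this

theorem LabBisimilar.symm (h : LabBisimilar D E) : LabBisimilar E D := by
  obtain ⟨R, hR, h⟩ := h
  refine ⟨fun D E => R E D, ⟨fun D E h => (hR.dist E D h).symm, fun D E h => ?_,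
    fun D E h s μ => (hR.closed E D h s μ).symm, fun D E h => ?_,
    fun D E h T hD hE F => hR.superOp E D h T hE hD F⟩, h⟩
  · obtain ⟨T, h1, h2⟩ := hR.typed E D h
    exact ⟨T, h2, h1⟩
  · obtain ⟨T, h1, h2, e⟩ := hR.env E D h
    exact ⟨T, h2, h1, e.symm⟩

theorem isSatBisim_labBisimilar (S : Finset Qubit) :
    IsSatBisim fun Δ Θ : Dist S => IsDist Δ ∧ IsDist Θ ∧ LabBisimilar (toQ Δ) (toQ Θ) := by
  refine ⟨fun Δ Θ h => ⟨h.1, h.2.1⟩, ?_, fun Δ Θ h => h.2.2.mass_eq h.1 h.2.1, ?_, ?_⟩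
  · rintro Δ Θ ⟨hΔ, hΘ, h⟩
    obtain ⟨T, h1, h2⟩ := h.exists_hasType
    exact ⟨T, hasType_of_toQ hΔ h1, hasType_of_toQ hΘ h2⟩
  · rintro Δ Θ ⟨hΔ, hΘ, h⟩ U T B hB hB' s Δ' hm
    exact labBisimilar_dmove hΔ hΘ h hB hB' hm
  · rintro Δ Θ ⟨hΔ, hΘ, h⟩ U T B hB hB' s Θ' hm
    obtain ⟨Δ', h1, h2, h3, h4⟩ := labBisimilar_dmove hΘ hΔ h.symm hB' hB hm
    exact ⟨Δ', h1, h3, h2, h4.symm⟩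

end

/-! ### Admissible prefixes -/

theorem admissible_nil {es : List Expr} (h : (Proc.nil es).fv = ∅) : Admissible (.nil es) := by
  refine admissible_of_derives h ?_ ?_
  · intro S T _ _ ρ _ s μ ν Δ Θ h
    cases h
  · rintro Q ⟨S, T, _, _, ρ, _, μ, s, Δ, h, _⟩
    cases h

theorem admissible_tau {t : Tag} {P : Proc} (h : Admissible P) : Admissible (.tau t P) := by
  refine admissible_of_derives h.1 ?_ ?_
  · intro S T _ _ ρ _ s μ ν Δ Θ h h'
    cases h
    cases h'
    exact Or.inl ⟨rfl, rfl⟩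
  · rintro Q ⟨S, T, _, _, ρ, _, μ, s, Δ, h', σ, hσ⟩
    cases h'
    obtain rfl := (Prod.ext_iff.mp (mem_support_single hσ)).2
    exact h

theorem admissible_send {t : Tag} {c : Chan} {v : Val} {P : Proc} (h : Admissible P) :
    Admissible (.send t c (.val v) P) := by
  refine admissible_of_derives (Set.union_empty_iff.mpr ⟨rfl, h.1⟩) ?_ ?_
  · intro S T _ _ ρ _ s μ ν Δ Θ h h'
    cases h with
    | send h =>
      cases h' with
      | send h' =>
        cases h
        cases h'
        exact Or.inl ⟨rfl, rfl⟩
  · rintro Q ⟨S, T, _, _, ρ, _, μ, s, Δ, h', σ, hσ⟩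
    cases h'
    obtain rfl := (Prod.ext_iff.mp (mem_support_single hσ)).2
    exact h

theorem CStep.recv_inv {S : Finset Qubit} {ρ : QMat ↥S} {t : Tag} {c : Chan} {x : Var} {P : Proc}
    {μ : Act} {s : Sched} {Δ : Dist S} (h : CStep ρ (.recv t c x P) μ s Δ) :
    ∃ v, CanRecv S c v P ∧ μ = .recv c v ∧ Δ = Finsupp.single (ρ, P.subst x v) 1 := by
  cases h with
  | recv h => exact ⟨_, h, rfl, rfl⟩

theorem admissible_recv {t : Tag} {c : Chan} {x : Var} {P : Proc}
    (hP : (Proc.recv t c x P).fv = ∅) (h : ∀ v, v.ty = c.ty → Admissible (P.subst x v)) :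
    Admissible (.recv t c x P) := by
  refine admissible_of_derives hP ?_ ?_
  · intro S T _ _ ρ _ s μ ν Δ Θ h h'
    obtain ⟨v, _, rfl, rfl⟩ := h.recv_inv
    obtain ⟨w, _, rfl, rfl⟩ := h'.recv_inv
    by_cases e : v = w
    · subst e
      exact Or.inl ⟨rfl, rfl⟩
    · exact Or.inr ⟨by simpa using e, c, v, w, rfl, rfl⟩
  · rintro Q ⟨S, T, _, _, ρ, _, μ, s, Δ, h', σ, hσ⟩
    obtain ⟨v, hv, rfl, rfl⟩ := h'.recv_inv
    obtain rfl := (Prod.ext_iff.mp (mem_support_single hσ)).2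
    exact h v hv.1

theorem CStep.ite_inv {S : Finset Qubit} {ρ : QMat ↥S} {e : Expr} {P Q : Proc} {μ : Act}
    {s : Sched} {Δ : Dist S} {b : Bool} (he : e.eval = some (.bool b))
    (h : CStep ρ (.ite e P Q) μ s Δ) : CStep ρ (cond b P Q) μ s Δ := by
  cases h with
  | iteT he' h =>
    obtain rfl : true = b := by simpa [he'] using he
    exact h
  | iteF he' h =>
    obtain rfl : false = b := by simpa [he'] using he
    exact h

theorem Typed.cond {G : Finset Name} {P Q : Proc} (h : Typed G P) (h' : Typed G Q) (b : Bool) :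
    Typed G (cond b P Q) := by
  cases b
  · exact h'
  · exact h

theorem admissible_ite {e : Expr} {P Q : Proc} {b : Bool} (he : e.eval = some (.bool b))
    (hfv : (Proc.ite e P Q).fv = ∅) (h : Admissible (cond b P Q)) : Admissible (.ite e P Q) := by
  refine admissible_of_derives hfv ?_ ?_
  · intro S T hT hty ρ hρ s μ ν Δ Θ h1 h2
    obtain ⟨_, hP, hQ⟩ := hty.ite_inv
    exact h.deterministic S T hT (hP.cond hQ b) ρ hρ s μ ν Δ Θ (h1.ite_inv he) (h2.ite_inv he)
  · rintro R ⟨S, T, hT, hty, ρ, hρ, μ, s, Δ, h', σ, hσ⟩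
    obtain ⟨_, hP, hQ⟩ := hty.ite_inv
    exact h.derives ⟨S, T, hT, hP.cond hQ b, ρ, hρ, μ, s, Δ, h'.ite_inv he, σ, hσ⟩

theorem CStep.meas_inv {S : Finset Qubit} {ρ : QMat ↥S} {t : Tag} {n : ℕ} {M : Meas n}
    {es : Fin n → Expr} {x : Var} {P : Proc} {μ : Act} {s : Sched} {Δ : Dist S}
    (h : CStep ρ (.meas t n M es x P) μ s Δ) :
    ∃ f : Fin n ↪ ↥S, (es = fun i => .val (.qubit (f i))) ∧ μ = .tau ∧
      Δ = ∑ m : Fin M.outcomes, Finsupp.single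
          ((collapse f (M.ops m) ρ).trace⁻¹ • collapse f (M.ops m) ρ, P.subst x (.nat m))
          (prob (collapse f (M.ops m) ρ)) := by
  cases h with
  | meas f => exact ⟨f, rfl, rfl, rfl⟩

theorem admissible_meas {t : Tag} {n : ℕ} {M : Meas n} {es : Fin n → Expr} {x : Var} {P : Proc}
    (hP : (Proc.meas t n M es x P).fv = ∅) (h : ∀ m : ℕ, Admissible (P.subst x (.nat m))) :
    Admissible (.meas t n M es x P) := by
  refine admissible_of_derives hP ?_ ?_
  · intro S T _ _ ρ _ s μ ν Δ Θ h h'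
    obtain ⟨f, e, rfl, rfl⟩ := h.meas_inv
    obtain ⟨g, e', rfl, rfl⟩ := h'.meas_inv
    have : f = g := by
      ext i
      have := congrFun (e.symm.trans e') i
      simpa using this
    rw [this]
    exact Or.inl ⟨rfl, rfl⟩
  · rintro Q ⟨S, T, _, _, ρ, _, μ, s, Δ, h', σ, hσ⟩
    obtain ⟨f, _, rfl, rfl⟩ := h'.meas_inv
    obtain ⟨m, _, hm⟩ := mem_support_sum hσ
    obtain rfl := (Prod.ext_iff.mp (mem_support_single hm)).2
    exact h m

/-! ### The processes used as tests -/

/-- The process that holds the names in `G` and does nothing. -/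
def nilOf (G : Finset Name) : Proc := .nil (G.toList.map Name.toExpr)

theorem typed_nilOf (G : Finset Name) : Typed G (nilOf G) := by
  have := Typed.nil G.nodup_toList
  rwa [Finset.toList_toFinset] at this

theorem mem_fv_nilOf {G : Finset Name} {x : Var} (h : x ∈ (nilOf G).fv) : Name.var x ∈ G := by
  obtain ⟨e, he, hx⟩ := h
  obtain ⟨a, ha, rfl⟩ := List.mem_map.mp he
  cases a with
  | qubit q => cases hx
  | var y =>
    obtain rfl : x = y := hx
    exact Finset.mem_toList.mp ha

theorem fv_nilOf_ctxOf (T : Finset Qubit) : (nilOf (ctxOf T)).fv = ∅ :=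
  Set.eq_empty_of_forall_notMem fun _ hx => var_notMem_ctxOf (mem_fv_nilOf hx)

theorem good_nilOf (T : Finset Qubit) : Good T (nilOf (ctxOf T)) :=
  ⟨typed_nilOf _, admissible_nil (fv_nilOf_ctxOf T)⟩

section

variable {S T : Finset Qubit} {R : Proc} {c : Chan} {v : Val}

theorem not_sh_nil {es : List Expr} {μ : Act} {s : Sched} {F : QMat ↥S →ₗ[ℂ] QDist S} :
    ¬ Sh (.nil es) μ s F := by
  intro h
  cases h

theorem Sh.send_inv {t : Tag} {μ : Act} {s : Sched} {F : QMat ↥S →ₗ[ℂ] QDist S}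
    (h : Sh (.send t c (.val v) R) μ s F) : μ = .send c v := by
  cases h with
  | send h =>
    cases h
    rfl

theorem Sh.recv_inv {t : Tag} {x : Var} {μ : Act} {s : Sched} {F : QMat ↥S →ₗ[ℂ] QDist S}
    (h : Sh (.recv t c x R) μ s F) : ∃ v, CanRecv S c v R ∧ μ = .recv c v := by
  cases h with
  | recv h => exact ⟨_, h, rfl⟩

theorem Sh.ite_false_inv {e : Expr} {P Q : Proc} {μ : Act} {s : Sched}
    {F : QMat ↥S →ₗ[ℂ] QDist S} (he : e.eval = some (.bool false)) (h : Sh (.ite e P Q) μ s F) :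
    Sh Q μ s F := by
  cases h with
  | iteT he' h => simp [he] at he'
  | iteF he' h => exact h

/-- A test that sends a value. -/
theorem good_sender {u : Tag} (hen : (Act.recv c v).Enabled S T)
    (hR : Good (S \ (Act.recv c v).after T) R) : Good (S \ T) (.send u c (.val v) R) := by
  refine ⟨?_, admissible_send hR.admissible⟩
  have h := hR.typed
  by_cases hc : c.ty = .qubit
  · obtain ⟨q, rfl⟩ : ∃ q, v = .qubit q := by
      have := hen.1.trans hc
      rcases v with _ | _ | q
      · cases this
      · cases this
      · exact ⟨q, rfl⟩
    obtain ⟨hqS, hqT⟩ := hen.2 q rfl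
    refine Typed.qsend (a := .qubit q) hc (mem_ctxOf.mpr (Finset.mem_sdiff.mpr ⟨hqS, hqT⟩)) ?_
    rw [← ctxOf_erase]
    have e : S \ (Act.recv c (.qubit q)).after T = (S \ T).erase q := by
      ext r
      simp only [Act.after, Finset.mem_sdiff, Finset.mem_insert, Finset.mem_erase]
      tauto
    rwa [e] at h
  · rw [Act.after_of_ne (by simp)] at h
    · exact .csend hc (hen.1 ▸ .val v) h
    · rintro c' q e
      cases e
      exact hc hen.1.symm

/-- The continuation of a test that receives a value, and proceeds only if it is `v`. -/
def checkThen (u : Tag) (x : Var) (v : Val) (R : Proc) (G : Finset Name) : Proc :=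
  .ite (.eq (.var x) (.val v)) (.tau u R) (nilOf G)

theorem eval_check (x : Var) (v w : Val) (h : w.ty = v.ty) :
    (Expr.subst x w (.eq (.var x) (.val v))).eval = some (.bool (decide (w = v))) := by
  simp [Expr.subst, Expr.eval, h]

/-- A test that receives a value. -/
theorem exists_receiver (u : Tag) (hen : (Act.send c v).Enabled S T) (hT : T ⊆ S)
    (hR : Good (S \ (Act.send c v).after T) R) :
    ∃ x P, Good (S \ T) (.recv u c x P) ∧ P.tags ⊆ insert u R.tags ∧ u ∈ P.tags ∧
      Sh (S := S) (P.subst x v) .tau (.one u) (Finsupp.lsingle R) ∧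
      ∀ w, w.ty = c.ty → w ≠ v → ∀ μ s F, ¬ Sh (S := S) (P.subst x w) μ s F := by
  -- Classical and quantum channels differ only in the continuation: `R` itself, or `R` with the
  -- qubit replaced by the received variable. After a wrong value the process is stuck, whereas the
  -- right one allows a silent move with tag `u`.
  have key : ∀ (x : Var) (R' : Proc) (G : Finset Name), x.ty = c.ty → R'.fv ⊆ {x} →
      (∀ y, Name.var y ∈ G → y = x) → R'.tags ⊆ R.tags → R'.subst x v = R →
      Typed (ctxOf (S \ T)) (.recv u c x (checkThen u x v R' G)) →
      ∃ x P, Good (S \ T) (.recv u c x P) ∧ P.tags ⊆ insert u R.tags ∧ u ∈ P.tags ∧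
        Sh (S := S) (P.subst x v) .tau (.one u) (Finsupp.lsingle R) ∧
        ∀ w, w.ty = c.ty → w ≠ v → ∀ μ s F, ¬ Sh (S := S) (P.subst x w) μ s F := by
    intro x R' G hx hfv hG htags hsub hty
    have hfv' : (checkThen u x v R' G).fv ⊆ {x} := by
      refine Set.union_subset ?_ (Set.union_subset hfv fun y hy => hG y (mem_fv_nilOf hy))
      simp [Expr.fv]
    have hcl : ∀ w, ((checkThen u x v R' G).subst x w).fv = ∅ := by
      intro w
      refine Set.subset_empty_iff.mp ((Proc.fv_subst _ _ _).trans ?_)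
      rw [Set.sdiff_eq_empty.mpr hfv']
    refine ⟨x, checkThen u x v R' G, ⟨hty, ?_⟩, ?_, ?_, ?_, ?_⟩
    · refine admissible_recv (Set.sdiff_eq_empty.mpr hfv') fun w hw => ?_
      refine admissible_ite (eval_check x v w (hw.trans hen.1.symm)) (hcl w) ?_
      by_cases h : w = v
      · subst h
        rw [decide_eq_true rfl]
        have : (Proc.tau u R').subst x w = .tau u R := by rw [← hsub]; rfl
        rw [cond_true, this]
        exact admissible_tau hR.admissible
      · rw [decide_eq_false h]
        refine admissible_nil ?_
        exact (Set.union_empty_iff.mp (Set.union_empty_iff.mp (hcl w)).2).2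
    · simp only [checkThen, Proc.tags, nilOf, Finset.union_empty]
      exact Finset.insert_subset_insert _ htags
    · simp [checkThen, Proc.tags]
    · refine .iteT (by rw [eval_check x v v rfl]; simp) ?_
      rw [← hsub]
      exact .tau
    · intro w hw hne μ s F h
      refine not_sh_nil (h.ite_false_inv ?_)
      rw [eval_check x v w (hw.trans hen.1.symm), decide_eq_false hne]
  have hchk : ∀ x : Var, x.ty = c.ty → Expr.HasTy (.eq (.var x) (.val v)) .bool := by
    intro x hx
    exact .eq (.var x) (by rw [hx, ← hen.1]; exact .val v)
  by_cases hc : c.ty = .qubit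
  · obtain ⟨q, rfl⟩ : ∃ q, v = .qubit q := by
      have := hen.1.trans hc
      rcases v with _ | _ | q
      · cases this
      · cases this
      · exact ⟨q, rfl⟩
    have hq := hen.2 q rfl
    obtain ⟨N, hN⟩ := R.exists_avoids
    -- A variable that does not occur in `R`, so that receiving `q` gives back `R` exactly.
    let x : Var := ⟨.qubit, N⟩
    have hx := hN x le_rfl
    refine key x (R.abs q x) (insert (.var x) (ctxOf (S \ T))) hc.symm ?_ ?_
      (Proc.tags_abs R q x).subset (Proc.abs_subst hx) ?_
    · refine (Proc.fv_abs R q x).trans ?_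
      rw [hR.admissible.1]
      simp
    · intro y hy
      rcases Finset.mem_insert.mp hy with e | hy
      · cases e
        rfl
      · exact (var_notMem_ctxOf hy).elim
    -- Comparing `x` with a qubit name does not consume it linearly; both branches must still own
    -- `x`.
    · refine .qrecv hc rfl var_notMem_ctxOf (.ite (hchk x hc.symm) (.tau ?_) (typed_nilOf _))
      refine Typed.abs_ctxOf (fun h => (Finset.mem_sdiff.mp h).2 hq) ?_ rfl hx
      have e : insert q (S \ T) = S \ (Act.send c (.qubit q)).after T := by
        ext r
        simp only [Act.after, Finset.mem_sdiff, Finset.mem_insert, Finset.mem_erase]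
        constructor
        · rintro (rfl | ⟨h1, h2⟩)
          · exact ⟨hT hq, fun h => h.1 rfl⟩
          · exact ⟨h1, fun h => h2 h.2⟩
        · rintro ⟨h1, h2⟩
          by_cases h : r = q
          · exact Or.inl h
          · exact Or.inr ⟨h1, fun h' => h2 ⟨h, h'⟩⟩
      rw [e]
      exact hR.typed
  · have e : (Act.send c v).after T = T := by
      refine Act.after_of_ne ?_ (by simp)
      rintro c' q e
      cases e
      exact hc hen.1.symm
    have hfv := hR.admissible.1
    refine key ⟨c.ty, 0⟩ R (ctxOf (S \ T)) rfl (by rw [hfv]; exact Set.empty_subset _)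
      (fun y hy => (var_notMem_ctxOf hy).elim) subset_rfl
      (Proc.subst_of_notMem (by rw [hfv]; exact Set.notMem_empty _)) ?_
    refine .crecv hc rfl (.ite (hchk _ rfl) (.tau ?_) (typed_nilOf _))
    rw [← e]
    exact hR.typed

end

/-! ### Observing a quantum distribution through tests -/

section

variable {S T V : Finset Qubit} {D E : QDist S} {R : Proc} {A : Finset Tag} {μ : Act} {s : Sched}

theorem ParGood.next_right_lsingle (h : ParGood T V R D) {R' : Proc}
    (hR : Sh (S := S) R .tau s (Finsupp.lsingle R')) :
    next .tau s (parMap R D) = parMap R' D := by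
  rw [next_parMap, parMap, lmapDomain_eq_sum]
  refine Finset.sum_congr rfl fun P hP => ?_
  rw [out_par_right h.left h.right (h.qgood.good P hP) h.good h.disjoint (h.tags P hP)
    (by rintro ⟨c, q, e, _⟩; cases e) hR (h.qgood.posSemidef P)]
  simp

theorem next_two_of_ne_tau (hμ : μ ≠ .tau) (t u : Tag) (D : QDist S) :
    next μ (.two t u) D = 0 := by
  rw [next_apply]
  refine Finset.sum_eq_zero fun P _ => ?_
  rw [out_eq_zero, LinearMap.zero_apply]
  intro F hF
  obtain ⟨t', _, e, _⟩ := hF.visible hμ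
  cases e

/-- The result of the silent moves forced by a list of schedulers. -/
def run : List Sched → QDist S →ₗ[ℂ] QDist S
  | [] => LinearMap.id
  | s :: l => run l ∘ₗ next .tau s

theorem run_cons (s : Sched) (l : List Sched) (D : QDist S) :
    run (s :: l) D = run l (next .tau s D) := rfl

/-- Quantum distributions with register `T` and tags in `A`. -/
structure TestGood (T : Finset Qubit) (A : Finset Tag) (D : QDist S) : Prop where
  qgood : QGood T D
  tags : ∀ P ∈ D.support, P.tags ⊆ A

theorem TestGood.zero : TestGood T A (0 : QDist S) := ⟨QGood.zero, by simp⟩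

theorem TestGood.next (h : TestGood T A D) (hT : T ⊆ S) (μ : Act) (s : Sched) :
    TestGood (μ.after T) A (next μ s D) := by
  refine ⟨h.qgood.next hT μ s, fun Q hQ => ?_⟩
  obtain ⟨P, hP, hQP, _⟩ := h.qgood.exists_of_mem_support_next hT hQ
  exact hQP.trans (h.tags P hP)

theorem TestGood.onEnv (h : TestGood T A D) (F : SuperOp ↥(S \ T)) : TestGood T A (F.onEnv D) :=
  ⟨h.qgood.onEnv F, fun P hP => h.tags P (support_onEnv F D hP)⟩

theorem TestGood.parGood (h : TestGood T A D) (hT : T ⊆ S) (hV : V ⊆ S) (hd : Disjoint T V)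
    (hR : Good V R) (hA : Disjoint A R.tags) : ParGood T V R D :=
  ⟨hd, hT, hV, hR, h.qgood, fun P hP => hA.mono_left (h.tags P hP)⟩

theorem disjoint_insert_tags {B : Finset Tag} {u : Tag} (hu : u ∉ A) (hA : Disjoint A R.tags)
    (hB : B ⊆ insert u R.tags) : Disjoint A B :=
  (Finset.disjoint_insert_right.mpr ⟨hu, hA⟩).mono_right hB

/-- A test for the result of a silent move. -/
theorem test_tau (hT : T ⊆ S) (hs : s.tags ⊆ A) (hR : Good (S \ T) R) (hA : Disjoint A R.tags)
    (h : TestGood T A D) : next .tau s (parMap R D) = parMap R (next .tau s D) :=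
  (h.parGood hT Finset.sdiff_subset Finset.disjoint_sdiff hR hA).next_left (hA.mono_left hs)
    (by rintro ⟨c, q, e, _⟩; cases e)

/-- A test for the result of an input. -/
theorem test_recv {c : Chan} {v : Val} {t u : Tag} (hT : T ⊆ S) (ht : t ∈ A) (hu : u ∉ A)
    (hR : Good (S \ T) (.send u c (.val v) R)) (hA : Disjoint A R.tags) (h : TestGood T A D) :
    next .tau (.two t u) (parMap (.send u c (.val v) R) D)
      = parMap R (next (.recv c v) (.one t) D) := by
  have hA' : Disjoint A (Proc.send u c (.val v) R).tags :=
    disjoint_insert_tags hu hA subset_rfl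
  have hp := h.parGood hT Finset.sdiff_subset Finset.disjoint_sdiff hR hA'
  rw [hp.next_synch (W := {.recv c v}) (r := fun _ => R) (Finset.disjoint_left.mp hA' ht)
    (Finset.mem_insert_self _ _), Finset.sum_singleton]
  · rintro α ⟨P, _, hα, _, _, _, hα'⟩
    have e := congrArg Act.dual hα'.send_inv
    rw [Act.dual_dual] at e
    rw [e]
    exact Finset.mem_coe.mpr (Finset.mem_singleton_self _)
  · intro α hα
    rw [Finset.mem_singleton.mp hα]
    exact ⟨by simp, .send rfl⟩

/-- A test for the result of an output. -/
theorem test_send {c : Chan} {v : Val} {t u : Tag} {x : Var} {P : Proc} (hT : T ⊆ S)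
    (hen : (Act.send c v).Enabled S T) (ht : t ∈ A)
    (hP : Good (S \ T) (.recv u c x P)) (hA : Disjoint A (insert u P.tags)) (hu : u ∈ P.tags)
    (hv : Sh (S := S) (P.subst x v) .tau (.one u) (Finsupp.lsingle R))
    (hw : ∀ w, w.ty = c.ty → w ≠ v → ∀ μ s F, ¬ Sh (S := S) (P.subst x w) μ s F)
    (h : TestGood T A D) :
    next .tau (.one u) (next .tau (.two t u) (parMap (.recv u c x P) D))
      = parMap R (next (.send c v) (.one t) D) := by
  classical
  have hp := h.parGood hT Finset.sdiff_subset Finset.disjoint_sdiff hP hA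
  -- The test owns all of `S \ T`, so the qubits it can receive are precisely those of the tested
  -- process.
  have hcan : ∀ w, CanRecv S c w P ↔ (Act.send c w).Enabled S T := by
    intro w
    refine and_congr_right fun _ => forall₂_congr fun q _ => ?_
    rw [hP.typed.recv_owns_iff, Finset.mem_sdiff]
    exact ⟨fun h => by tauto, fun h => ⟨hT h, fun h' => h'.2 h⟩⟩
  have hfin := finite_synchActs (t := t) (u := u) hT Finset.sdiff_subset h.qgood.good hP
  let r : Act → Proc := fun α => match α with
    | .send _ w => P.subst x w
    | _ => P
  -- The intended output is inserted so that its summand is present even if no process of `D`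
  -- performs it.
  have hW : ∀ α ∈ insert (Act.send c v) hfin.toFinset, ∃ w, α = .send c w ∧ CanRecv S c w P := by
    intro α hα
    rcases Finset.mem_insert.mp hα with rfl | hα
    · exact ⟨v, rfl, (hcan v).mpr hen⟩
    · obtain ⟨_, _, _, _, _, _, hα⟩ := hfin.mem_toFinset.mp hα
      obtain ⟨w, hw, e⟩ := hα.recv_inv
      exact ⟨w, by rw [← Act.dual_dual α, e]; rfl, hw⟩
  rw [hp.next_synch (W := insert (.send c v) hfin.toFinset) (r := r)
    (Finset.disjoint_left.mp hA ht) (Finset.mem_insert_self _ _), map_sum]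
  · have hpar : ∀ w, CanRecv S c w P → ParGood ((Act.send c w).after T)
        ((Act.recv c w).after (S \ T)) (P.subst x w) (next (.send c w) (.one t) D) := by
      intro w hw
      have hsh : Sh (S := S) (.recv u c x P) (.recv c w) (.one u)
        (Finsupp.lsingle (P.subst x w)) := .recv hw
      have hen' := hsh.enabled hP.typed
      refine (h.next hT _ _).parGood (((hcan w).mp hw).after_subset hT)
        (hen'.after_subset Finset.sdiff_subset) ?_
        (hsh.good_lsingle Finset.sdiff_subset hP).1
        (hA.mono_right (hsh.good_lsingle Finset.sdiff_subset hP).2)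
      exact (Act.Enabled.after_dual (α := .send c w) (by simp) ((hcan w).mp hw) hen'
        Finset.disjoint_sdiff).1
    -- The synchronization accepts every value; the following silent move erases all summands but
    -- that of `v`, whose check succeeds.
    rw [Finset.sum_eq_single_of_mem _ (Finset.mem_insert_self _ _)]
    · exact (hpar v ((hcan v).mpr hen)).next_right_lsingle hv
    · intro α hα hne
      obtain ⟨w, rfl, hcw⟩ := hW α hα
      refine (hpar w hcw).next_right_eq_zero ?_ (Or.inr fun F => hw w hcw.1 ?_ _ _ _)
      · rw [Proc.tags_subst]
        simpa [Sched.tags] using hu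
      · rintro rfl
        exact hne rfl
  · intro α hα
    exact Finset.mem_coe.mpr (Finset.mem_insert_of_mem (hfin.mem_toFinset.mpr hα))
  · intro α hα
    obtain ⟨w, rfl, hw⟩ := hW α hα
    exact ⟨by simp, .recv hw⟩

/-- Tests reach the results of all actions. -/
theorem exists_test_next (hT : T ⊆ S) (hen : μ.Enabled S T) (hs : s.tags ⊆ A)
    (hμs : μ = .tau ∨ ∃ t, s = .one t) (hR : Good (S \ μ.after T) R) (hA : Disjoint A R.tags) :
    ∃ R' l', Good (S \ T) R' ∧ Disjoint A R'.tags ∧ ∀ D : QDist S, TestGood T A D →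
      ∀ l, run (l' ++ l) (parMap R' D) = run l (parMap R (next μ s D)) := by
  -- The prefix needs a tag foreign to the tested processes only; it may occur in `R`.
  obtain ⟨u, hu⟩ := Infinite.exists_notMem_finset A
  rcases hμs with rfl | ⟨t, rfl⟩
  · refine ⟨R, [s], hR, hA, fun D h l => ?_⟩
    rw [List.singleton_append, run_cons, test_tau hT hs hR hA h]
  have ht : t ∈ A := hs (Finset.mem_singleton_self t)
  cases μ with
  | tau =>
    refine ⟨R, [.one t], hR, hA, fun D h l => ?_⟩
    rw [List.singleton_append, run_cons, test_tau hT hs hR hA h]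
  | recv c v =>
    refine ⟨.send u c (.val v) R, [.two t u], good_sender hen hR,
      disjoint_insert_tags hu hA subset_rfl, fun D h l => ?_⟩
    rw [List.singleton_append, run_cons, test_recv hT ht hu (good_sender hen hR) hA h]
  | send c v =>
    obtain ⟨x, P, hP, htags, huP, hv, hw⟩ := exists_receiver u hen hT hR
    have hA' : Disjoint A (insert u P.tags) :=
      disjoint_insert_tags hu hA (Finset.insert_subset (Finset.mem_insert_self _ _) htags)
    refine ⟨.recv u c x P, [.two t u, .one u], hP, hA', fun D h l => ?_⟩
    rw [List.cons_append, List.singleton_append, run_cons, run_cons,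
      test_send hT hen ht hP hA' huP hv hw h]

/-- The continuation of a test that measures, and proceeds when the outcome is less than `n`. -/
def outcomeThen (u : Tag) (x : Var) (n : ℕ) (R : Proc) (G : Finset Name) : Proc :=
  .ite (.not (.le (.val (.nat n)) (.var x))) (.tau u R) (nilOf G)

theorem outcomeThen_subst {u : Tag} {x : Var} {n : ℕ} (m : ℕ) (hR : R.fv = ∅) :
    (outcomeThen u x n R (ctxOf V)).subst x (.nat m) =
      .ite (.not (.le (.val (.nat n)) (.val (.nat m)))) (.tau u R) (nilOf (ctxOf V)) := by
  have h1 : R.subst x (.nat m) = R :=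
    Proc.subst_of_notMem (by rw [hR]; exact Set.notMem_empty _)
  have h2 : (nilOf (ctxOf V)).subst x (.nat m) = nilOf (ctxOf V) :=
    Proc.subst_of_notMem (by rw [fv_nilOf_ctxOf]; exact Set.notMem_empty _)
  simp [outcomeThen, Proc.subst, Expr.subst, h1, h2]

/-- The strict inequality is written with the available `≤` and negation. -/
theorem eval_outcome (n m : ℕ) : (Expr.not (.le (.val (.nat n)) (.val (.nat m)))).eval
    = some (.bool (decide (m < n))) := by
  simp only [Expr.eval, ← not_le, decide_not]

/-- A measurement whose outcomes, but the last, act like the Kraus operators of `F`. -/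
theorem exists_meas {κ : Type} [Fintype κ] [DecidableEq κ] (F : SuperOp κ) :
    ∃ K : Fin (F.len + 1) → QMat κ,
      ∑ m, (K m)ᴴ * K m = 1 ∧ ∀ i, K (Fin.castSucc i) = F.kraus i := by
  -- The operator of the last outcome accounts for the trace that `F` loses.
  obtain ⟨L, hL⟩ := exists_eq_conjTranspose_mul_self F.nonincreasing
  refine ⟨Fin.snoc (α := fun _ => QMat κ) F.kraus L, ?_, fun i => by simp⟩
  rw [Fin.sum_univ_castSucc]
  simp [← hL]

/-- Tests perform all superoperators on the environment. -/
theorem exists_test_onEnv (hT : T ⊆ S) (F : SuperOp ↥(S \ T)) (hR : Good (S \ T) R)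
    (hA : Disjoint A R.tags) :
    ∃ R' l', Good (S \ T) R' ∧ Disjoint A R'.tags ∧ ∀ D : QDist S, TestGood T A D →
      ∀ l, run (l' ++ l) (parMap R' D) = run l (parMap R (F.onEnv D)) := by
  obtain ⟨u, hu⟩ := Infinite.exists_notMem_finset A
  obtain ⟨K, hK, hKF⟩ := exists_meas F
  let e : Fin (Fintype.card ↥(S \ T)) ≃ ↥(S \ T) := (Fintype.equivFin _).symm
  let f : Fin (Fintype.card ↥(S \ T)) ↪ ↥S :=
    e.toEmbedding.trans ⟨envIncl S T, envIncl_injective S T⟩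
  -- The measurement acts on the whole environment. Measurements may have arity zero, so an empty
  -- environment is no exception.
  let M : Meas (Fintype.card ↥(S \ T)) := {
    outcomes := F.len + 1
    ops := fun m => pad e.symm (K m)
    complete := by rw [pad_sum_adjoint_mul e.symm.injective, hK, pad_one] }
  have hM : ∀ m : Fin (F.len + 1), pad f (M.ops m) = pad (incl Finset.sdiff_subset) (K m) := by
    intro m
    refine (pad_pad f.injective e.symm (K m)).trans ?_
    congr 1
    funext q
    simp [f, incl, envIncl]
  let x : Var := ⟨.nat, 0⟩
  have hfv := hR.admissible.1
  let B : ℕ → Proc := fun m =>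
    .ite (.not (.le (.val (.nat F.len)) (.val (.nat m)))) (.tau u R) (nilOf (ctxOf (S \ T)))
  have hB : ∀ m : ℕ, (outcomeThen u x F.len R (ctxOf (S \ T))).subst x (.nat m) = B m :=
    fun m => outcomeThen_subst m hfv
  have hBt : ∀ m, (B m).tags = insert u R.tags := fun m => by
    simp [B, Proc.tags, nilOf]
  have hBg : ∀ m, Good (S \ T) (B m) := by
    intro m
    refine ⟨.ite (.not (.le (.val _) (.val _))) (.tau hR.typed) (typed_nilOf _), ?_⟩
    refine admissible_ite (eval_outcome _ _) ?_ ?_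
    · simp [Proc.fv, Expr.fv, hfv, fv_nilOf_ctxOf]
    · cases decide (m < F.len)
      · exact (good_nilOf _).admissible
      · exact admissible_tau hR.admissible
  let R' : Proc := .meas u _ M (fun i => .val (.qubit (f i))) x
    (outcomeThen u x F.len R (ctxOf (S \ T)))
  have hR' : Good (S \ T) R' := by
    constructor
    · refine Typed.meas (a := fun i => .qubit (f i)) ?_ ?_ rfl
        (.ite (.not (.le (.val _) (.var _))) (.tau hR.typed) (typed_nilOf _))
      · intro i j h
        exact f.injective (Subtype.ext (Name.qubit.inj h))
      · intro i
        exact mem_ctxOf.mpr (e i).2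
    · refine admissible_meas ?_ fun m => ?_
      · simp [Proc.fv, outcomeThen, Expr.fv, hfv, fv_nilOf_ctxOf]
      · rw [hB]
        exact (hBg m).admissible
  have hA' : Disjoint A (insert u R.tags) := disjoint_insert_tags hu hA subset_rfl
  have hAR' : Disjoint A R'.tags := by
    refine disjoint_insert_tags hu hA ?_
    simp [R', Proc.tags, outcomeThen, nilOf]
  have hK' := posSemidef_one_sub_of_sum_eq_one K hK
  -- One silent move for the measurement, one for the branch that accepts its outcome.
  refine ⟨R', [.one u, .one u], hR', hAR', fun D h l => ?_⟩
  have hp := h.parGood hT Finset.sdiff_subset Finset.disjoint_sdiff hR' hAR'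
  have hsh : Sh (S := S) R' .tau (.one u) _ := Sh.meas f
  rw [List.cons_append, List.singleton_append, run_cons, run_cons,
    hp.next_right (n := F.len + 1) (K := K) (Q := fun m => B m) (by rintro ⟨c, q, e, _⟩; cases e)
      hsh ?_ subset_rfl hK', map_sum, Fin.sum_univ_castSucc]
  · have hpi : ∀ m : Fin (F.len + 1), ParGood T (S \ T) (B m)
        ((singleKraus subset_rfl (K m) (hK' m)).onEnv D) := fun m =>
      (h.onEnv _).parGood hT Finset.sdiff_subset Finset.disjoint_sdiff (hBg m)
        (by rwa [hBt])
    -- The completing outcome blocks and is erased; the others all continue with the same `R`, so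
    -- their branches add up to the action of `F`.
    rw [(hpi (Fin.last F.len)).next_right_eq_zero, add_zero]
    · congr 1
      have : F.onEnv D = ∑ i : Fin F.len,
          (singleKraus subset_rfl (K i.castSucc) (hK' i.castSucc)).onEnv D := by
        ext1 P
        rw [Finsupp.finsetSum_apply, onEnv_apply, krausMap, LinearMap.sum_apply]
        refine Finset.sum_congr rfl fun i _ => ?_
        rw [onEnv_apply, krausMap_singleKraus subset_rfl Finset.sdiff_subset, hKF]
        rfl
      rw [this, map_sum]
      refine Finset.sum_congr rfl fun i _ => (hpi _).next_right_lsingle ?_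
      exact .iteT (by rw [eval_outcome]; simp) .tau
    · rw [hBt]
      simp [Sched.tags]
    · refine Or.inr fun G hG => not_sh_nil (hG.ite_false_inv ?_)
      rw [eval_outcome]
      simp
  · intro ρ
    rw [LinearMap.sum_apply]
    refine Finset.sum_congr rfl fun m _ => ?_
    rw [LinearMap.comp_apply, Finsupp.lsingle_apply, hB]
    congr 2
    exact congrArg conj (hM m)

end

/-! ### Saturated bisimilarity is contained in labelled bisimilarity -/

section

variable {S T : Finset Qubit} {D E : QDist S} {R : Proc} {A : Finset Tag}

/-- Quantum distributions that pass all tests with the same probability. -/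
structure Tested (T : Finset Qubit) (A : Finset Tag) (D E : QDist S) : Prop where
  left : TestGood T A D
  right : TestGood T A E
  trace_run_eq : ∀ R, Good (S \ T) R → Disjoint A R.tags → ∀ l,
    (qmass (run l (parMap R D))).trace = (qmass (run l (parMap R E))).trace

theorem Tested.zero : Tested T A (0 : QDist S) 0 :=
  ⟨TestGood.zero, TestGood.zero, fun _ _ _ _ => rfl⟩

/-- The test that holds the environment and makes no move. -/
theorem Tested.trace_eq (h : Tested T A D E) : (qmass D).trace = (qmass E).trace := by
  have := h.trace_run_eq _ (good_nilOf _) (Finset.disjoint_empty_right A) []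
  simp only [run, LinearMap.id_apply] at this
  rwa [parMap, qmass_mapProc, qmass_mapProc] at this

theorem Tested.eq_zero_iff (h : Tested T A D E) : D = 0 ↔ E = 0 := by
  have key : ∀ {D E : QDist S}, (∀ P, (E P).PosSemidef) →
      (qmass D).trace = (qmass E).trace → D = 0 → E = 0 := by
    rintro D E hE e rfl
    refine eq_zero_of_trace_qmass hE ?_
    rw [← e]
    simp [qmass]
  exact ⟨key h.right.qgood.posSemidef h.trace_eq, key h.left.qgood.posSemidef h.trace_eq.symm⟩

/-- Every test of the results is a longer test of `D` and `E`. If a result is nonzero, a process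
that moved shows that `μ` is enabled and that the tags of `s` are in `A`; otherwise the zero pair
passes all tests. -/
theorem Tested.next (h : Tested T A D E) (hT : T ⊆ S) (μ : Act) (s : Sched) :
    ∃ U ⊆ S, Tested U A (next μ s D) (LqCCS.next μ s E) := by
  by_cases h0 : LqCCS.next μ s D = 0 ∧ LqCCS.next μ s E = 0
  · rw [h0.1, h0.2]
    exact ⟨∅, Finset.empty_subset S, .zero⟩
  have hX : ∃ X : QDist S, TestGood T A X ∧ LqCCS.next μ s X ≠ 0 := by
    by_cases h1 : LqCCS.next μ s D = 0
    · exact ⟨E, h.right, fun h2 => h0 ⟨h1, h2⟩⟩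
    · exact ⟨D, h.left, h1⟩
  obtain ⟨X, hX, hne⟩ := hX
  obtain ⟨Q, hQ⟩ := Finsupp.support_nonempty_iff.mpr hne
  obtain ⟨P, hP, _, hen, hs⟩ := hX.qgood.exists_of_mem_support_next hT hQ
  have hμs : μ = .tau ∨ ∃ t, s = .one t := by
    by_cases hμ : μ = .tau
    · exact Or.inl hμ
    · cases s with
      | one t => exact Or.inr ⟨t, rfl⟩
      | two t u => exact absurd (next_two_of_ne_tau hμ t u X) hne
  refine ⟨μ.after T, hen.after_subset hT, h.left.next hT μ s, h.right.next hT μ s,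
    fun R hR hA l => ?_⟩
  obtain ⟨R', l', hR', hA', e⟩ := exists_test_next hT hen (hs.trans (hX.tags P hP)) hμs hR hA
  rw [← e D h.left l, ← e E h.right l]
  exact h.trace_run_eq R' hR' hA' _

theorem Tested.onEnv (h : Tested T A D E) (hT : T ⊆ S) (F : SuperOp ↥(S \ T)) :
    Tested T A (F.onEnv D) (F.onEnv E) := by
  refine ⟨h.left.onEnv F, h.right.onEnv F, fun R hR hA l => ?_⟩
  obtain ⟨R', l', hR', hA', e⟩ := exists_test_onEnv hT F hR hA
  rw [← e D h.left l, ← e E h.right l]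
  exact h.trace_run_eq R' hR' hA' _

theorem qmass_onEnv (F : SuperOp ↥(S \ T)) (D : QDist S) :
    qmass (F.onEnv D) = krausMap (envIncl S T) F.kraus (qmass D) := by
  have : qmass D = ∑ P ∈ D.support, D P := rfl
  rw [this, map_sum, onEnv_eq_sum, ← qmassL_apply, map_sum]
  exact Finset.sum_congr rfl fun P _ => by rw [qmassL_apply, qmass_single]

/-- Applying a projector on a vector `v` of the environment and comparing traces yields, up to a
common nonzero factor, the quadratic form of the environment at `v`. -/
theorem Tested.env_eq (h : Tested T A D E) (hT : T ⊆ S) : D.env T = E.env T := by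
  refine eq_of_quadratic_form_eq fun v => ?_
  by_cases hv : v = 0
  · simp [hv]
  obtain ⟨K, c, hc, hKK, hK, hKv⟩ := exists_projector v hv
  have key : ∀ D : QDist S, (qmass ((singleKraus (T := T) subset_rfl K hK).onEnv D)).trace
      = c * (star v ⬝ᵥ D.env T *ᵥ v) := by
    intro D
    have e : pad (incl (Finset.sdiff_subset (s := S) (t := T))) K = pad (envIncl S T) K := rfl
    rw [qmass_onEnv, krausMap_singleKraus subset_rfl Finset.sdiff_subset, e, trace_conj,
      pad_conjTranspose, ← pad_mul (envIncl_injective S T), hKK, trace_pad_envIncl_mul hT, hKv]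
    rfl
  have := (h.onEnv hT (singleKraus subset_rfl K hK)).trace_eq
  rw [key, key] at this
  exact mul_left_cancel₀ hc this

theorem isLabBisim_tested (S : Finset Qubit) :
    IsLabBisim fun D E : QDist S =>
      IsQDist D ∧ IsQDist E ∧ ∃ T A, T ⊆ S ∧ Tested T A D E := by
  refine isLabBisim_of_next (fun D E h => ⟨h.1, h.2.1⟩) ?_ ?_ ?_ ?_
  · rintro D E ⟨_, _, T, A, hT, h⟩
    exact ⟨T, h.left.qgood.hasType hT, h.right.qgood.hasType hT⟩
  · rintro D E ⟨hD, hE, T, A, hT, h⟩ s μ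
    obtain ⟨U, hU, h'⟩ := h.next hT μ s
    exact ⟨h'.left.qgood.isQDist ((h.left.qgood.trace_next_le hT μ s).trans hD.2.1),
      h'.right.qgood.isQDist ((h.right.qgood.trace_next_le hT μ s).trans hE.2.1), U, A, hU, h'⟩
  · rintro D E ⟨_, _, T, A, hT, h⟩
    exact ⟨T, h.left.qgood.hasType hT, h.right.qgood.hasType hT, h.env_eq hT⟩
  · rintro D E ⟨hD, hE, T, A, hT, h⟩ U hDU hEU F
    refine ⟨hD.onEnv hDU F, hE.onEnv hEU F, ?_⟩
    by_cases h0 : D = 0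
    · rw [h.eq_zero_iff.mp h0, h0, onEnv_zero]
      exact ⟨T, A, hT, .zero⟩
    · obtain rfl : T = U := (h.left.qgood.hasType hT).unique hDU h0
      exact ⟨T, A, hT, h.onEnv hT F⟩

/-! ### Tests on saturated bisimilar distributions. -/

variable {Δ Θ : Dist S} {Rel : Dist S → Dist S → Prop}

theorem IsSatBisim.exists_next (hRel : IsSatBisim Rel) (h : Rel Δ Θ) {U : Finset Qubit} {B : Ctx}
    (hB : B.Compatible U T Δ) (hB' : B.Compatible U T Θ) (s : Sched) :
    ∃ Δ' Θ', Rel Δ' Θ' ∧ toQ Δ' = next .tau s (toQ (Δ.mapProc B.fill)) ∧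
      toQ Θ' = next .tau s (toQ (Θ.mapProc B.fill)) := by
  obtain ⟨hΔ, hΘ⟩ := hRel.dist _ _ h
  obtain ⟨Δ', hΔ'⟩ := exists_dmove (Δ.mapProc B.fill) ((mass_mapProc _ Δ).trans_le hΔ.1) .tau s
  obtain ⟨Θ', hΘ', h'⟩ := hRel.left _ _ h U T B hB hB' s Δ' hΔ'
  exact ⟨Δ', Θ', h', (hΔ'.toQ_eq_next hB.2.2.1 (hΔ.mapProc hB)).1,
    (hΘ'.toQ_eq_next hB.2.2.1 (hΘ.mapProc hB')).1⟩

theorem IsSatBisim.trace_eq (hRel : IsSatBisim Rel) (h : Rel Δ Θ) :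
    (qmass (toQ Δ)).trace = (qmass (toQ Θ)).trace := by
  obtain ⟨hΔ, hΘ⟩ := hRel.dist _ _ h
  rw [trace_toQ fun C hC => (hΔ.2 C hC).1, trace_toQ fun C hC => (hΘ.2 C hC).1,
    hRel.mass_eq _ _ h]

/-- The trivial context suffices: at each silent move the bisimulation supplies a pair that is
related again, and masses agree at the end. -/
theorem IsSatBisim.trace_run_eq (hRel : IsSatBisim Rel) (h : Rel Δ Θ) (l : List Sched) :
    (qmass (run l (toQ Δ))).trace = (qmass (run l (toQ Θ))).trace := by
  induction l generalizing Δ Θ with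
  | nil => exact hRel.trace_eq h
  | cons s l ih =>
    obtain ⟨T, hΔ, hΘ⟩ := hRel.typed _ _ h
    obtain ⟨Δ', Θ', h', e, e'⟩ := hRel.exists_next h (B := .hole) (U := T)
      ⟨.hole, hΔ, hΔ.1, fun _ _ => Finset.disjoint_empty_right _⟩
      ⟨.hole, hΘ, hΘ.1, fun _ _ => Finset.disjoint_empty_right _⟩ s
    have hid : ∀ Δ : Dist S, Δ.mapProc Ctx.hole.fill = Δ := fun Δ => Finsupp.mapDomain_id
    rw [hid] at e e'
    rw [run_cons, run_cons, ← e, ← e']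
    exact ih h'

/-- The context is applied at the first move only. The distributions reached are related and already
contain the rest of the test, so the remaining moves use the hole. -/
theorem IsSatBisim.trace_run_parMap_eq (hRel : IsSatBisim Rel) (h : Rel Δ Θ) (hΔ : Δ.HasType T)
    (hΘ : Θ.HasType T) (hR : Good (S \ T) R) (ht : ∀ C ∈ Δ.support, Disjoint C.2.tags R.tags)
    (ht' : ∀ C ∈ Θ.support, Disjoint C.2.tags R.tags) (l : List Sched) :
    (qmass (run l (parMap R (toQ Δ)))).trace = (qmass (run l (parMap R (toQ Θ)))).trace := by
  cases l with
  | nil =>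
    simp only [run, LinearMap.id_apply]
    rw [parMap, qmass_mapProc, qmass_mapProc]
    exact hRel.trace_eq h
  | cons s l =>
    have hB : (Ctx.par R).HasType S T := .par hR.admissible hR.typed hΔ.1
    obtain ⟨Δ', Θ', h', e, e'⟩ := hRel.exists_next h (B := .par R) (U := S)
      ⟨hB, hΔ, subset_rfl, ht⟩ ⟨hB, hΘ, subset_rfl, ht'⟩ s
    rw [toQ_mapProc_fill] at e e'
    rw [run_cons, run_cons, ← e, ← e']
    exact hRel.trace_run_eq h' l

theorem SatBisimilar.labBisimilar (h : SatBisimilar Δ Θ) : LabBisimilar (toQ Δ) (toQ Θ) := by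
  classical
  obtain ⟨Rel, hRel, h⟩ := h
  obtain ⟨T, hΔT, hΘT⟩ := hRel.typed _ _ h
  obtain ⟨hΔ, hΘ⟩ := hRel.dist _ _ h
  have hΔ' := hΔ.isQDist hΔT
  have hΘ' := hΘ.isQDist hΘT
  -- Tests must avoid the tags of both sides to be compatible with both.
  let A : Finset Tag := (Δ.support ∪ Θ.support).biUnion fun C => C.2.tags
  have hA : ∀ C ∈ Δ.support ∪ Θ.support, C.2.tags ⊆ A := fun C hC =>
    Finset.subset_biUnion_of_mem (fun C : Conf S => C.2.tags) hC
  have hAΔ : ∀ C ∈ Δ.support, C.2.tags ⊆ A := fun C hC => hA C (Finset.mem_union_left _ hC)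
  have hAΘ : ∀ C ∈ Θ.support, C.2.tags ⊆ A := fun C hC => hA C (Finset.mem_union_right _ hC)
  refine ⟨_, isLabBisim_tested S, hΔ', hΘ', T, A, hΔT.1, ?_, ?_, fun R hR hAR l => ?_⟩
  · refine ⟨(hΔ.dgood hΔT).toQ, fun P hP => ?_⟩
    obtain ⟨σ, hσ⟩ := mem_support_toQ hP
    exact hAΔ _ hσ
  · refine ⟨(hΘ.dgood hΘT).toQ, fun P hP => ?_⟩
    obtain ⟨σ, hσ⟩ := mem_support_toQ hP
    exact hAΘ _ hσ
  · exact hRel.trace_run_parMap_eq h hΔT hΘT hR (fun C hC => hAR.mono_left (hAΔ C hC))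
      (fun C hC => hAR.mono_left (hAΘ C hC)) l

theorem isDist_single {ρ : QMat ↥S} {P : Proc} (hρ : IsDensity ρ) (hP : Admissible P) :
    IsDist (Finsupp.single (ρ, P) 1 : Dist S) := by
  refine ⟨by simp [mass], fun C hC => ?_⟩
  obtain rfl := mem_support_single hC
  exact ⟨hρ, hP⟩

end

end

end LqCCS

/-! ### Full abstraction and congruence. -/

theorem mainTheorem1 (S : Finset LqCCS.Qubit) :
    (∀ (ρ σ : LqCCS.QMat ↥S) (P Q : LqCCS.Proc),
      LqCCS.IsDensity ρ → LqCCS.IsDensity σ → LqCCS.Admissible P → LqCCS.Admissible Q →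
      (LqCCS.SatBisimilar (Finsupp.single (ρ, P) 1) (Finsupp.single (σ, Q) 1) ↔
        LqCCS.LabBisimilar (Finsupp.single P ρ) (Finsupp.single Q σ))) ∧
    (∀ (D E : LqCCS.QDist S) (U T : Finset LqCCS.Qubit) (B : LqCCS.Ctx),
      LqCCS.LabBisimilar D E → B.QCompatible U T D → B.QCompatible U T E →
      LqCCS.LabBisimilar (D.mapProc B.fill) (E.mapProc B.fill)) := by
  refine ⟨fun ρ σ P Q hρ hσ hP hQ => ?_, fun D E U T B h hD hE => h.mapProc hD hE⟩
  rw [← LqCCS.toQ_single_one ρ P, ← LqCCS.toQ_single_one σ Q]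
  exact ⟨LqCCS.SatBisimilar.labBisimilar, fun h => ⟨_, LqCCS.isSatBisim_labBisimilar S,
    LqCCS.isDist_single hρ hP, LqCCS.isDist_single hσ hQ, h⟩⟩
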